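/- **Setting.** Let $X, X_1,X_2,\dots$ be i.i.d. mean-zero random elements of $\mathcal L^2([0,1]^2)$ with $\mathbb E\|X\|^4<\infty$ and covariance operator $C=A_1\tilde\otimes A_2+B$, where $A_1,A_2$ (on $\mathcal L^2[0,1]$) and $B$ (on $\mathcal L^2([0,1]^2)$) are positive semi-definite and trace class, and $(A_1\tilde\otimes A_2)(x\otimes y)=A_1x\otimes A_2y$. Let $\delta\in[0,1)$, and let $B$ be banded by $\delta$, i.e. its kernel $b(t,s,t',s')$ vanishes almost everywhere on $\{\max(|t-t'|,|s-s'|)\ge\delta\}$. Let $A:=A_1\tilde\otimes A_2$ have a kernel $a(t,s,t',s')$ that is Lipschitz on $[0,1]^4$ with constant $L>0$ (Euclidean distance), and assume $\mathrm{Tr}^\delta(A):=\int_0^{1-\delta}\!\int_0^{1-\delta}a(t,s,t+\delta,s+\delta)\,dt\,ds\neq0$. For each $K\ge 1$ divide $[0,1]^2$ into the $K^2$ pixels $I_i^K\times I_j^K$, $I^K_i=[\frac{i-1}K,\frac iK)$. One observes $\widetilde{\mathbf X}_n^K[i,j]=\mathbf X_n^K[i,j]+\mathbf E_n^K[i,j]$,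 $1\le i,j\le K$, where either * (S1) $X_n$ has continuous realizations with $\sup_{n}\sup_{t,s}\mathbb E X_n(t,s)^4<\infty$, and $\mathbf X_n^K[i,j]=X_n(t_i^K,s_j^K)$ for some points $(t^K_i,s^K_j)$ in the (closed) pixels; or * (S2) $\mathbf X_n^K[i,j]=K^2\int_{I_i^K\times I_j^K}X_n$. For every $K$ the pairs $(X_n,\mathbf E_n^K)$ are i.i.d. in $n$. With pixels denoted by $p,q,r,s$ and with $\sigma_K^2=\mathcal O(\sqrt K)$, the errors have mean zero; $\mathbb E\,\mathbf E_n^K[p]^2\le\sigma_K^2$; $\mathbb E\,\mathbf E_n^K[p]\mathbf E_n^K[q]=0$ for $p\ne q$; $\mathbb E\,\mathbf E_n^K[p]\mathbf X_n^K[q]=0$; $\mathbb E\,\mathbf E_n^K[p]\mathbf E_n^K[q]\mathbf X_n^K[r]\mathbf X_n^K[s]=\mathbb E(\mathbf E_n^K[p]\mathbf E_n^K[q])\,\mathbb E(\mathbf X_n^K[r]\mathbf X_n^K[s])$ (all these moments being finite); and for $p\neq q$, $r\ne s$, $\mathbb E\,\mathbf E_n^K[p]^2\mathbf E_n^K[q]^2\le\sigma_K^4$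 and $\mathbb E\,\mathbf E_n^K[p]\mathbf E_n^K[q]\mathbf E_n^K[r]\mathbf E_n^K[s]=0$ unless $\{p,q\}=\{r,s\}$. (The last two conditions hold, for example, if the errors in different pixels are independent.) **Estimators.** Let $d=d_K=\lceil\delta K\rceil+1$, $\widehat{\mathbf C}=\frac1N\sum_{n=1}^N\widetilde{\mathbf X}_n^K\otimes\widetilde{\mathbf X}_n^K$, $\mathrm{Tr}_1^d(\mathbf M)[i,k]=\sum_{j\le K-d}\mathbf M[i,j,k,j+d]$, $\mathrm{Tr}_2^d(\mathbf M)[j,l]=\sum_{i\le K-d}\mathbf M[i,j,i+d,l]$ and $\mathrm{Tr}^d(\mathbf M)=\sum_{i,j\le K-d}\mathbf M[i,j,i+d,j+d]$. Let $\widehat A_1^K,\widehat A_2^K$ be the integral operators on $\mathcal L^2[0,1]$ whose kernels are the piecewise constant continuations of $\mathrm{Tr}_1^d(\widehat{\mathbf C})$ and $\mathrm{Tr}_2^d(\widehat{\mathbf C})/\mathrm{Tr}^d(\widehat{\mathbf C})$ or, alternatively, of the symmetrizations $\frac12(\mathbf M+\mathbf M^\top)$ of these two matrices. They are defined if $\mathrm{Tr}^d(\widehat{\mathbf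 C})\ne0$. Say that a quantity depending on the data is $\mathcal O_P(N^{-1})+\beta_K$ uniformly in $K\ge K_0$ if for every $\varepsilon>0$ there are $M$ and $N_0$ such that for all $N\ge N_0$ and $K\ge K_0$, with probability at least $1-\varepsilon$, the estimators are defined and the quantity is at most $M/N+\beta_K$. **Theorem.** For both choices of the estimators there is a $K_0\in\mathbb N$ such that, uniformly in $K\ge K_0$, $$\big|\!\big|\!\big|\widehat A_1^K\tilde\otimes\widehat A_2^K-A_1\tilde\otimes A_2\big|\!\big|\!\big|_2^2=\mathcal O_P(N^{-1})+2K^{-2}L^2,$$ where $|\!|\!|\cdot|\!|\!|_2$ is the Hilbert–Schmidt norm. Furthermore, let $A_1=\sum_j\lambda_je_j\otimes e_j$ and $A_2=\sum_j\rho_jf_j\otimes f_j$ be eigendecompositions, and, whenever $\widehat A_1^K$, $\widehat A_2^K$ are symmetric, $\widehat A_1^K=\sum_j\widehat\lambda_j^K\widehat e_j^K\otimes\widehat e_j^K$ and $\widehat A_2^K=\sum_j\widehat\rho_j^K\widehat f_j^K\otimes\widehat f_j^K$ (orthonormal eigenvectors, eigenvalues in non-increasing order of modulus). Then, with the same $K_0$,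 for all $i,j$, $$|\widehat\lambda_i^K\widehat\rho_j^K-\lambda_i\rho_j|^2=\mathcal O_P(N^{-1})+2K^{-2}L^2 ,$$ and if the eigenspace of $A_1$ for $\lambda_j$ is one-dimensional, there is a constant $c$, independent of $N$ and $K$, such that $$\|\widehat e_j^K-\mathrm{sign}(\langle\widehat e_j^K,e_j\rangle)e_j\|^2=\mathcal O_P(N^{-1})+c\cdot2K^{-2}L^2 .$$ -/

import Mathlib

open MeasureTheory ProbabilityTheory Filter Set
open scoped RealInnerProductSpace ENNReal Topology

noncomputable section

/-! ### The Hilbert spaces `L²[0,1]` and `L²([0,1]²)` -/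

/-- Lebesgue measure on `[0,1]`. -/
abbrev unitMeasure : Measure ℝ := volume.restrict (Icc (0 : ℝ) 1)

/-- Lebesgue measure on `[0,1]²`. -/
abbrev squareMeasure : Measure (ℝ × ℝ) := unitMeasure.prod unitMeasure

/-- The closed unit square `[0,1]²`. -/
abbrev unitSquare : Set (ℝ × ℝ) := Icc (0 : ℝ) 1 ×ˢ Icc (0 : ℝ) 1

/-- The real Hilbert space `L²[0,1]`. -/
abbrev L2I : Type := Lp ℝ 2 unitMeasure

/-- The real Hilbert space `L²([0,1]²)`. -/
abbrev L2Q : Type := Lp ℝ 2 squareMeasure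

/-- Random surfaces are random elements of `L²([0,1]²)` with its Borel σ-algebra. -/
instance instMeasurableSpaceL2Q : MeasurableSpace L2Q := borel L2Q

instance instBorelSpaceL2Q : BorelSpace L2Q := ⟨rfl⟩

theorem memLp_tensor (x y : L2I) :
    MemLp (fun p : ℝ × ℝ => x p.1 * y p.2) 2 squareMeasure := by
  have hx : MemLp x 2 unitMeasure := Lp.memLp x
  have hy : MemLp y 2 unitMeasure := Lp.memLp y
  have hm : AEStronglyMeasurable (fun p : ℝ × ℝ => x p.1 * y p.2) squareMeasure :=
    hx.1.comp_fst.mul hy.1.comp_snd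
  rw [memLp_two_iff_integrable_sq hm]
  have h := hx.integrable_sq.mul_prod hy.integrable_sq
  simpa [mul_pow] using h

/-- The product function `(x ⊗ y)(t,s) = x(t) y(s)`. -/
def tensorFun (x y : L2I) : L2Q := (memLp_tensor x y).toLp _

/-! ### Operators -/

section Operators

variable {H : Type*} [NormedAddCommGroup H] [InnerProductSpace ℝ H] [CompleteSpace H]

/-- The squared Hilbert–Schmidt norm `∑ⱼ ‖T vⱼ‖²` (over an orthonormal basis `(vⱼ)`), written
independently of the choice of a basis as the supremum over finite orthonormal systems.  It is
finite exactly for Hilbert–Schmidt operators. -/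
def hsNormSq (T : H →L[ℝ] H) : ℝ≥0∞ :=
  ⨆ (n : ℕ) (v : Fin n → H) (_ : Orthonormal ℝ v), ∑ i, ENNReal.ofReal (‖T (v i)‖ ^ 2)

/-- `T` is positive semi-definite (in particular self-adjoint) and of trace class: its trace
`∑ⱼ ⟨T vⱼ, vⱼ⟩` over an orthonormal basis converges. -/
def IsPosTraceClass (T : H →L[ℝ] H) : Prop :=
  T.IsPositive ∧ ∃ v : HilbertBasis ℕ ℝ H, Summable fun j => ⟪T (v j), v j⟫

/-- `T = ∑ⱼ lam j • (e j ⊗ e j)` is an eigendecomposition: the `e j` are orthonormal, and the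
eigenvalues `lam j` are listed with multiplicity, in non-increasing order of their moduli. -/
def IsEigendecomposition (T : H →L[ℝ] H) (lam : ℕ → ℝ) (e : ℕ → H) : Prop :=
  Orthonormal ℝ e ∧ Antitone (fun j => |lam j|) ∧
    ∀ f : H, HasSum (fun j => (lam j * ⟪e j, f⟫) • e j) (T f)

end Operators

/-- `T` is the integral operator on `L²(μ)` with the square-integrable kernel `k`. -/
def HasKernel {α : Type*} [MeasurableSpace α] {μ : Measure α}
    (T : Lp ℝ 2 μ →L[ℝ] Lp ℝ 2 μ) (k : α → α → ℝ) : Prop :=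
  MemLp (fun p : α × α => k p.1 p.2) 2 (μ.prod μ) ∧
    ∀ f : Lp ℝ 2 μ, T f =ᵐ[μ] fun x => ∫ y, k x y * f y ∂μ

/-- `A` is the operator `A₁ ⊗̃ A₂`, i.e. `A (x ⊗ y) = A₁ x ⊗ A₂ y` for all `x, y`. -/
def IsTensorOp (A₁ A₂ : L2I →L[ℝ] L2I) (A : L2Q →L[ℝ] L2Q) : Prop :=
  ∀ x y : L2I, A (tensorFun x y) = tensorFun (A₁ x) (A₂ y)

/-- `B` is banded by `δ`: its kernel vanishes almost everywhere on
`{max (|t - t'|, |s - s'|) ≥ δ}`. -/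
def IsBanded (B : L2Q →L[ℝ] L2Q) (δ : ℝ) : Prop :=
  ∃ b : ℝ × ℝ → ℝ × ℝ → ℝ, HasKernel B b ∧
    ∀ᵐ z ∂(squareMeasure.prod squareMeasure),
      δ ≤ max |z.1.1 - z.2.1| |z.1.2 - z.2.2| → b z.1 z.2 = 0

/-- The kernel `a` is Lipschitz on `[0,1]⁴` with constant `L` (for the Euclidean distance). -/
def LipschitzKernel (L : ℝ) (a : ℝ × ℝ → ℝ × ℝ → ℝ) : Prop :=
  ∀ x ∈ unitSquare, ∀ x' ∈ unitSquare, ∀ y ∈ unitSquare, ∀ y' ∈ unitSquare,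
    |a x x' - a y y'| ≤ L * Real.sqrt ((x.1 - y.1) ^ 2 + (x.2 - y.2) ^ 2 +
      (x'.1 - y'.1) ^ 2 + (x'.2 - y'.2) ^ 2)

/-- The `δ`-shifted trace of an operator with continuous kernel `a`. -/
def shiftedTrace (δ : ℝ) (a : ℝ × ℝ → ℝ × ℝ → ℝ) : ℝ :=
  ∫ t in (0 : ℝ)..(1 - δ), ∫ s in (0 : ℝ)..(1 - δ), a (t, s) (t + δ, s + δ)

/-- `C` is the covariance operator of the random element `Y`. -/
def IsCovariance {Ω : Type*} [MeasurableSpace Ω] (P : Measure Ω) (Y : Ω → L2Q)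
    (C : L2Q →L[ℝ] L2Q) : Prop :=
  ∀ f g : L2Q,
    ∫ ω, ⟪Y ω - ∫ ω', Y ω' ∂P, f⟫ * ⟪Y ω - ∫ ω', Y ω' ∂P, g⟫ ∂P = ⟪C f, g⟫

/-! ### The grid and the piecewise constant continuations -/

/-- The `i`-th of the `K` cells of the partition of `[0,1)` into intervals of length `1/K`
(`i = 0, …, K - 1`). -/
def cell (K : ℕ) (i : Fin K) : Set ℝ := Ico ((i : ℝ) / K) (((i : ℝ) + 1) / K)

theorem measurableSet_cell (K : ℕ) (i : Fin K) : MeasurableSet (cell K i) := measurableSet_Ico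

/-- The indicator of a cell, as an element of `L²[0,1]`. -/
def cellInd (K : ℕ) (i : Fin K) : L2I :=
  indicatorConstLp 2 (measurableSet_cell K i) (measure_ne_top unitMeasure _) (1 : ℝ)

/-- The piecewise constant continuation of the matrix `M`: the operator on `L²[0,1]` with kernel
`∑ M i k 1_{Iᵢ}(t) 1_{Iₖ}(t')`. -/
def contOp {K : ℕ} (M : Fin K → Fin K → ℝ) : L2I →L[ℝ] L2I :=
  ∑ i, ∑ k, M i k • InnerProductSpace.rankOne ℝ (cellInd K i) (cellInd K k)

/-- The operator `contOp M₁ ⊗̃ contOp M₂` on `L²([0,1]²)`, i.e. the operator with kernel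
`∑ M₁ i k M₂ j l 1_{Iᵢ × Iⱼ}(t,s) 1_{Iₖ × Iₗ}(t',s')`; see `isTensorOp_contOpTensor`. -/
def contOpTensor {K : ℕ} (M₁ M₂ : Fin K → Fin K → ℝ) : L2Q →L[ℝ] L2Q :=
  ∑ i, ∑ k, ∑ j, ∑ l, (M₁ i k * M₂ j l) •
    InnerProductSpace.rankOne ℝ (tensorFun (cellInd K i) (cellInd K j))
      (tensorFun (cellInd K k) (cellInd K l))

theorem inner_tensorFun (x y x' y' : L2I) :
    ⟪tensorFun x y, tensorFun x' y'⟫ = ⟪x, x'⟫ * ⟪y, y'⟫ := by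
  simp only [L2.inner_def]
  rw [← integral_prod_mul]
  apply integral_congr_ae
  filter_upwards [(memLp_tensor x y).coeFn_toLp, (memLp_tensor x' y').coeFn_toLp] with p h1 h2
  simp only [tensorFun, h1, h2]
  simp
  ring

theorem coeFn_tensorFun (x y : L2I) :
    tensorFun x y =ᵐ[squareMeasure] fun p => x p.1 * y p.2 := (memLp_tensor x y).coeFn_toLp

theorem tensorFun_add_left (x x' y : L2I) :
    tensorFun (x + x') y = tensorFun x y + tensorFun x' y := by
  apply Lp.ext
  have h := Measure.quasiMeasurePreserving_fst (μ := unitMeasure) (ν := unitMeasure) |>.ae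
    (Lp.coeFn_add x x')
  filter_upwards [coeFn_tensorFun (x + x') y, coeFn_tensorFun x y, coeFn_tensorFun x' y,
    Lp.coeFn_add (tensorFun x y) (tensorFun x' y), h] with p h1 h2 h3 h4 h5
  simp only [h1, h4, Pi.add_apply, h2, h3, h5]
  ring

theorem tensorFun_add_right (x y y' : L2I) :
    tensorFun x (y + y') = tensorFun x y + tensorFun x y' := by
  apply Lp.ext
  have h := Measure.quasiMeasurePreserving_snd (μ := unitMeasure) (ν := unitMeasure) |>.ae
    (Lp.coeFn_add y y')
  filter_upwards [coeFn_tensorFun x (y + y'), coeFn_tensorFun x y, coeFn_tensorFun x y',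
    Lp.coeFn_add (tensorFun x y) (tensorFun x y'), h] with p h1 h2 h3 h4 h5
  simp only [h1, h4, Pi.add_apply, h2, h3, h5]
  ring

theorem tensorFun_smul_left (c : ℝ) (x y : L2I) :
    tensorFun (c • x) y = c • tensorFun x y := by
  apply Lp.ext
  have h := Measure.quasiMeasurePreserving_fst (μ := unitMeasure) (ν := unitMeasure) |>.ae
    (Lp.coeFn_smul c x)
  filter_upwards [coeFn_tensorFun (c • x) y, coeFn_tensorFun x y,
    Lp.coeFn_smul c (tensorFun x y), h] with p h1 h2 h4 h5
  simp only [h1, h4, Pi.smul_apply, h2, h5, smul_eq_mul]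
  ring

theorem tensorFun_smul_right (c : ℝ) (x y : L2I) :
    tensorFun x (c • y) = c • tensorFun x y := by
  apply Lp.ext
  have h := Measure.quasiMeasurePreserving_snd (μ := unitMeasure) (ν := unitMeasure) |>.ae
    (Lp.coeFn_smul c y)
  filter_upwards [coeFn_tensorFun x (c • y), coeFn_tensorFun x y,
    Lp.coeFn_smul c (tensorFun x y), h] with p h1 h2 h4 h5
  simp only [h1, h4, Pi.smul_apply, h2, h5, smul_eq_mul]
  ring

/-- `x ⊗ y` as a bilinear map. -/
def tensorFunBilin : L2I →ₗ[ℝ] L2I →ₗ[ℝ] L2Q :=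
  LinearMap.mk₂ ℝ tensorFun tensorFun_add_left tensorFun_smul_left
    tensorFun_add_right tensorFun_smul_right

theorem isTensorOp_contOpTensor {K : ℕ} (M₁ M₂ : Fin K → Fin K → ℝ) :
    IsTensorOp (contOp M₁) (contOp M₂) (contOpTensor M₁ M₂) := by
  intro x y
  have h1 : ∀ v, tensorFun (contOp M₁ x) v =
      ∑ i, ∑ k, (M₁ i k * ⟪cellInd K k, x⟫) • tensorFun (cellInd K i) v := fun v => by
    change tensorFunBilin.flip v (contOp M₁ x) = _
    simp only [contOp, sum_apply, smul_apply, InnerProductSpace.rankOne_apply, map_sum, map_smul,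
      smul_smul]
    rfl
  have h2 : ∀ u, tensorFun u (contOp M₂ y) =
      ∑ j, ∑ l, (M₂ j l * ⟪cellInd K l, y⟫) • tensorFun u (cellInd K j) := fun u => by
    change tensorFunBilin u (contOp M₂ y) = _
    simp only [contOp, sum_apply, smul_apply, InnerProductSpace.rankOne_apply, map_sum, map_smul,
      smul_smul]
    rfl
  rw [h1]
  simp only [h2, contOpTensor, sum_apply, smul_apply, InnerProductSpace.rankOne_apply,
    inner_tensorFun, smul_smul, Finset.smul_sum]
  refine Finset.sum_congr rfl fun i _ => Finset.sum_congr rfl fun k _ =>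
    Finset.sum_congr rfl fun j _ => Finset.sum_congr rfl fun l _ => ?_
  congr 1
  ring

/-! ### The sampling schemes and the noise -/

/-- Pointwise sampling: the surfaces have continuous realizations `Y n ω`, which are observed at
the points `(t K i, s K j)`, one in each pixel of the grid (closed pixels allow for any convention
about the edges).  Point evaluations have uniformly bounded fourth moments. -/
def PointSampled {Ω : Type*} [MeasurableSpace Ω] (P : Measure Ω) (X : ℕ → Ω → L2Q)
    (D : (K : ℕ) → ℕ → Ω → Fin K → Fin K → ℝ) : Prop :=
  ∃ (Y : ℕ → Ω → ℝ × ℝ → ℝ) (t s : (K : ℕ) → Fin K → ℝ),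
    (∀ n ω, ContinuousOn (Y n ω) unitSquare) ∧
    (∀ n ω, X n ω =ᵐ[squareMeasure] Y n ω) ∧
    (∃ S : ℝ, ∀ n, ∀ x ∈ unitSquare,
      Integrable (fun ω => Y n ω x ^ 4) P ∧ ∫ ω, Y n ω x ^ 4 ∂P ≤ S) ∧
    (∀ (K : ℕ) (i : Fin K), t K i ∈ Icc ((i : ℝ) / K) (((i : ℝ) + 1) / K)) ∧
    (∀ (K : ℕ) (j : Fin K), s K j ∈ Icc ((j : ℝ) / K) (((j : ℝ) + 1) / K)) ∧
    ∀ K n ω i j, D K n ω i j = Y n ω (t K i, s K j)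

/-- Pixel-wise sampling: the average of each surface over each pixel is observed. -/
def PixelSampled {Ω : Type*} (X : ℕ → Ω → L2Q)
    (D : (K : ℕ) → ℕ → Ω → Fin K → Fin K → ℝ) : Prop :=
  ∀ K n ω i j, D K n ω i j = (K : ℝ) ^ 2 * ∫ x in cell K i ×ˢ cell K j, X n ω x ∂squareMeasure

/-- Moment conditions on the measurement errors `E` of one `K × K` observation `D`, with variances
at most `v`.  Pixels are written as pairs `p = (i, j)`. -/
structure IsNoise {Ω : Type*} [MeasurableSpace Ω] (P : Measure Ω) {K : ℕ}
    (D E : Ω → Fin K → Fin K → ℝ) (v : ℝ) : Prop where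
  /-- finite second moments -/
  memLp : ∀ p : Fin K × Fin K, MemLp (fun ω => E ω p.1 p.2) 2 P
  /-- zero mean -/
  mean : ∀ p : Fin K × Fin K, ∫ ω, E ω p.1 p.2 ∂P = 0
  /-- variances bounded by `v` -/
  var_le : ∀ p : Fin K × Fin K, ∫ ω, E ω p.1 p.2 ^ 2 ∂P ≤ v
  /-- errors in distinct pixels are uncorrelated -/
  uncorr : ∀ p q : Fin K × Fin K, p ≠ q → ∫ ω, E ω p.1 p.2 * E ω q.1 q.2 ∂P = 0
  /-- the (mean zero) errors are uncorrelated with the signal -/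
  uncorr_signal : ∀ p q : Fin K × Fin K, ∫ ω, E ω p.1 p.2 * D ω q.1 q.2 ∂P = 0
  /-- the mixed fourth moments exist and factorize -/
  mixed_integrable : ∀ p q r s : Fin K × Fin K,
    Integrable (fun ω => E ω p.1 p.2 * E ω q.1 q.2 * D ω r.1 r.2 * D ω s.1 s.2) P
  mixed : ∀ p q r s : Fin K × Fin K,
    ∫ ω, E ω p.1 p.2 * E ω q.1 q.2 * D ω r.1 r.2 * D ω s.1 s.2 ∂P =
      (∫ ω, E ω p.1 p.2 * E ω q.1 q.2 ∂P) * ∫ ω, D ω r.1 r.2 * D ω s.1 s.2 ∂P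
  /-- products of errors in two distinct pixels have second moment at most `v²` … -/
  fourth_integrable : ∀ p q : Fin K × Fin K, p ≠ q →
    Integrable (fun ω => E ω p.1 p.2 ^ 2 * E ω q.1 q.2 ^ 2) P
  fourth_le : ∀ p q : Fin K × Fin K, p ≠ q →
    ∫ ω, E ω p.1 p.2 ^ 2 * E ω q.1 q.2 ^ 2 ∂P ≤ v ^ 2
  /-- … and two such products are uncorrelated, unless they belong to the same pair of pixels -/
  fourth_uncorr : ∀ p q r s : Fin K × Fin K, p ≠ q → r ≠ s →
    ¬ (p = r ∧ q = s) → ¬ (p = s ∧ q = r) →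
    ∫ ω, E ω p.1 p.2 * E ω q.1 q.2 * E ω r.1 r.2 * E ω s.1 s.2 ∂P = 0

/-! ### The estimators -/

section Estimators

variable {K : ℕ}

/-- The empirical covariance tensor `(1/N) ∑ₙ Zₙ ⊗ Zₙ` of `Z 0, …, Z (N - 1)`. -/
def empCov (N : ℕ) (Z : ℕ → Fin K → Fin K → ℝ) (i j k l : Fin K) : ℝ :=
  (1 / (N : ℝ)) * ∑ n ∈ Finset.range N, Z n i j * Z n k l

/-- The discrete `d`-shifted partial trace `Tr₁ᵈ(M)[i,k] = ∑ⱼ M[i,j,k,j+d]`. -/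
def discTr1 (d : ℕ) (M : Fin K → Fin K → Fin K → Fin K → ℝ) (i k : Fin K) : ℝ :=
  ∑ j : Fin K, if h : (j : ℕ) + d < K then M i j k ⟨j + d, h⟩ else 0

/-- The discrete `d`-shifted partial trace `Tr₂ᵈ(M)[j,l] = ∑ᵢ M[i,j,i+d,l]`. -/
def discTr2 (d : ℕ) (M : Fin K → Fin K → Fin K → Fin K → ℝ) (j l : Fin K) : ℝ :=
  ∑ i : Fin K, if h : (i : ℕ) + d < K then M i j ⟨i + d, h⟩ l else 0

/-- The discrete `d`-shifted trace `Trᵈ(M) = ∑ᵢⱼ M[i,j,i+d,j+d]`. -/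
def discTr (d : ℕ) (M : Fin K → Fin K → Fin K → Fin K → ℝ) : ℝ :=
  ∑ i : Fin K, ∑ j : Fin K,
    if h : (i : ℕ) + d < K ∧ (j : ℕ) + d < K then M i j ⟨i + d, h.1⟩ ⟨j + d, h.2⟩ else 0

/-- The matrix `M` itself (`symm = false`), or its symmetrization `(M + Mᵀ)/2` (`symm = true`). -/
def symmetrize (symm : Bool) (M : Fin K → Fin K → ℝ) (i k : Fin K) : ℝ :=
  if symm then (M i k + M k i) / 2 else M i k

/-- The discrete bandwidth `d_K = ⌈δ K⌉ + 1`. -/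
def discBandwidth (δ : ℝ) (K : ℕ) : ℕ := ⌈δ * K⌉₊ + 1

/-- The normalizing shifted trace of the empirical covariance; the estimators are defined if it
does not vanish. -/
def trHat (δ : ℝ) (N : ℕ) (Z : ℕ → Fin K → Fin K → ℝ) : ℝ :=
  discTr (discBandwidth δ K) (empCov N Z)

/-- The estimator of the first factor, optionally symmetrized. -/
def A1Hat (symm : Bool) (δ : ℝ) (N : ℕ) (Z : ℕ → Fin K → Fin K → ℝ) : Fin K → Fin K → ℝ :=
  symmetrize symm (discTr1 (discBandwidth δ K) (empCov N Z))

/-- The estimator of the second factor, optionally symmetrized. -/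
def A2Hat (symm : Bool) (δ : ℝ) (N : ℕ) (Z : ℕ → Fin K → Fin K → ℝ) : Fin K → Fin K → ℝ :=
  symmetrize symm fun j l => discTr2 (discBandwidth δ K) (empCov N Z) j l / trHat δ N Z

end Estimators

/-- The noisy observations `Z n = D n + E n` on the `K × K` grid, at the outcome `ω`. -/
def noisyData {Ω : Type*} (D E : (K : ℕ) → ℕ → Ω → Fin K → Fin K → ℝ) (K : ℕ) (ω : Ω) :
    ℕ → Fin K → Fin K → ℝ :=
  fun n i j => D K n ω i j + E K n ω i j

/-- A quantity is `O_P(N⁻¹) + β K`, where the `O_P(N⁻¹)` term is uniform in `K ≥ K₀`.  Here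
`G N K r ω` says that at the outcome `ω` the quantity is defined and at most `r`: for every
`ε > 0` there are `M`, `N₀` such that, with probability at least `1 - ε`, it is at most
`M / N + β K`, for all `N ≥ N₀` and all `K ≥ K₀`. -/
def HasRate {Ω : Type*} [MeasurableSpace Ω] (P : Measure Ω) (K₀ : ℕ) (β : ℕ → ℝ)
    (G : ℕ → ℕ → ℝ → Ω → Prop) : Prop :=
  ∀ ε : ℝ, 0 < ε → ∃ (M : ℝ) (N₀ : ℕ), ∀ N ≥ N₀, ∀ K ≥ K₀,
    P {ω | ¬ G N K (M / N + β K) ω} ≤ ENNReal.ofReal ε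

end

noncomputable section

/-! ### Perturbation of eigendecompositions -/

section Eigen

variable {H : Type*} [NormedAddCommGroup H] [InnerProductSpace ℝ H]

/-! Shifting by `d ≥ δK + 1` separates the pixels being compared by at least `δ`, so the banded part
`B` contributes nothing to the covariances entering the three shifted traces, and neither do the
error variances. Off the band the covariance of the noiseless data is therefore a tensor `α` coming
from the separable part alone (`exists_sampled_tensor`). It satisfies the exchange identity of
product tensors, and each of its entries is a value of the kernel `a` at points of the two closed
pixels. Consequently `Tr₁ᵈ(α)[i,k] · Tr₂ᵈ(α)[j,l] = α[i,j,k,l] · Trᵈ(α)`: dividing by the shifted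
trace recovers `α` itself, and the step operator `AK` with values `α` is what the estimators target.

Bias. The kernels of `AK` and `A` differ on a pair of pixels by at most `L` times a distance.
Integrating the squared distance over four coordinates gives `4/3 · L² / K²` instead of the cruder
`4 L² / K²` (`hsNormSq_contOpTensor_sub_kernel_le`). The slack between `4/3` and `2` pays for the
cross terms between bias and stochastic error.

Stochastic error. Each shifted partial trace of the empirical covariance is an average of `N` i.i.d.
variables with mean the partial trace of `α`. Its summed variance is at most `b K⁴ / N`: the pure
signal part is controlled by Cauchy–Schwarz and the fourth moments, the parts with noise by
orthogonality of the summands (`IsNoise.integral_sum_partialTrace_sq_le`). The condition `σ² =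
O(√K)` is what makes the pure noise part `σ⁴ K³` of order `K⁴`. Since `Trᵈ(α) / K²` is a Riemann sum
for the nonzero shifted trace of `a`, the denominator is at least `c K²` for large `K`, and the
quotient is stable (`sum_sq_ratio_sub_le`). The powers of `K` cancel, which gives uniformity in `K`;
`K₀` is fixed by these requirements alone.

Spectra. Only the tensor products are close, not the factors, whose scales are arbitrary. Products
of eigenvalues are compared by a Courant–Fischer argument on product vectors. As `AK` is nonnegative
on product vectors, a wrong sign of an estimated product costs stochastic error but no bias. For
eigenvectors, evaluating the second factor at a top eigenvector of `A₂` gives multiples of the two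
first factors which are close to each other, and the spectral gap of `A₁` finishes the argument. -/

theorem Orthonormal.summable_inner_sq {e : ℕ → H} (he : Orthonormal ℝ e) (x : H) :
    Summable fun k => ⟪e k, x⟫ ^ 2 := by
  simpa using he.inner_products_summable x

theorem Orthonormal.tsum_inner_sq_le {e : ℕ → H} (he : Orthonormal ℝ e) (x : H) :
    ∑' k, ⟪e k, x⟫ ^ 2 ≤ ‖x‖ ^ 2 := by
  simpa using he.tsum_inner_products_le x

variable [CompleteSpace H]

set_option linter.unusedSectionVars false

namespace IsEigendecomposition

variable {T T' : H →L[ℝ] H} {lam lam' : ℕ → ℝ} {e e' : ℕ → H}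

theorem hasSum_inner (h : IsEigendecomposition T lam e) (y z : H) :
    HasSum (fun k => lam k * ⟪e k, y⟫ * ⟪e k, z⟫) ⟪T y, z⟫ := by
  have := (h.2.2 y).mapL (innerSL ℝ z)
  simp only [innerSL_apply_apply, inner_smul_right] at this
  rw [real_inner_comm (T y) z] at this
  simpa only [real_inner_comm z] using this

theorem apply_self (h : IsEigendecomposition T lam e) (j : ℕ) : T (e j) = lam j • e j := by
  have h1 := h.2.2 (e j)
  have h2 : HasSum (fun k => (lam k * ⟪e k, e j⟫) • e k) ((lam j * ⟪e j, e j⟫) • e j) := by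
    apply hasSum_single j
    intro k hk
    rw [h.1.2 hk]; simp
  rw [h1.unique h2, real_inner_self_eq_norm_sq, h.1.1 j]; simp

theorem inner_apply (h : IsEigendecomposition T lam e) (j : ℕ) (y : H) :
    ⟪e j, T y⟫ = lam j * ⟪e j, y⟫ := by
  have h1 := h.hasSum_inner y (e j)
  have h2 : HasSum (fun k => lam k * ⟪e k, y⟫ * ⟪e k, e j⟫) (lam j * ⟪e j, y⟫ * ⟪e j, e j⟫) := by
    apply hasSum_single j
    intro k hk
    rw [h.1.2 hk]; simp
  rw [real_inner_comm, h1.unique h2, real_inner_self_eq_norm_sq, h.1.1 j]; simp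

theorem hasSum_norm_sq (h : IsEigendecomposition T lam e) (y : H) :
    HasSum (fun k => lam k ^ 2 * ⟪e k, y⟫ ^ 2) (‖T y‖ ^ 2) := by
  have := h.hasSum_inner y (T y)
  rw [real_inner_self_eq_norm_sq] at this
  convert this using 2 with k
  rw [h.inner_apply]; ring

theorem smul (h : IsEigendecomposition T lam e) (c : ℝ) :
    IsEigendecomposition (c • T) (fun k => c * lam k) e := by
  refine ⟨h.1, fun i j hij => ?_, fun f => ?_⟩
  · simp only [abs_mul]
    exact mul_le_mul_of_nonneg_left (h.2.1 hij) (abs_nonneg c)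
  · have := (h.2.2 f).const_smul c
    simpa [smul_smul, mul_assoc] using this

theorem norm_apply_le (h : IsEigendecomposition T lam e) {i : ℕ} {u : H} (hu : ‖u‖ = 1)
    (ho : ∀ k < i, ⟪e k, u⟫ = 0) : ‖T u‖ ≤ |lam i| := by
  rw [← abs_of_nonneg (norm_nonneg (T u)), ← sq_le_sq, ← (h.hasSum_norm_sq u).tsum_eq]
  calc ∑' k, lam k ^ 2 * ⟪e k, u⟫ ^ 2 ≤ ∑' k, lam i ^ 2 * ⟪e k, u⟫ ^ 2 := by
        refine (h.hasSum_norm_sq u).summable.tsum_le_tsum (fun k => ?_)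
          ((h.1.summable_inner_sq u).mul_left _)
        rcases lt_or_ge k i with hk | hk
        · simp [ho k hk]
        · exact mul_le_mul_of_nonneg_right (sq_le_sq.2 (h.2.1 hk)) (sq_nonneg _)
    _ = lam i ^ 2 * ∑' k, ⟪e k, u⟫ ^ 2 := tsum_mul_left
    _ ≤ lam i ^ 2 * 1 := by
        gcongr
        simpa [hu] using h.1.tsum_inner_sq_le u
    _ = lam i ^ 2 := mul_one _

/-- Dimension count behind the min-max principle: the span of the first `i + 1` vectors `e'`
contains a unit vector orthogonal to the first `i` vectors `e`. One vector serving both operators is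
what allows products of such vectors to be used for tensor products. -/
theorem exists_unit_vector (h : IsEigendecomposition T lam e)
    (h' : IsEigendecomposition T' lam' e') (i : ℕ) :
    ∃ u : H, ‖u‖ = 1 ∧ |lam' i| ≤ ‖T' u‖ ∧ ‖T u‖ ≤ |lam i| := by
  -- A kernel element of this map from `i + 1` to `i` dimensions lists the coefficients of a vector
  -- in the span of `e' 0, …, e' i` orthogonal to `e 0, …, e (i - 1)`.
  let F : (Fin (i + 1) → ℝ) →ₗ[ℝ] (Fin i → ℝ) :=
    { toFun := fun c k => ∑ m, c m * ⟪e k, e' m⟫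
      map_add' := fun c d => by ext k; simp [add_mul, Finset.sum_add_distrib]
      map_smul' := fun r c => by ext k; simp [Finset.mul_sum, mul_assoc] }
  have hF : LinearMap.ker F ≠ ⊥ := F.ker_ne_bot_of_finrank_lt (by simp)
  obtain ⟨c, hc, hc0⟩ := (Submodule.ne_bot_iff _).1 hF
  set w : H := ∑ m, c m • e' (m : ℕ) with hw
  have hinj : Function.Injective fun m : Fin (i + 1) => (m : ℕ) := Fin.val_injective
  have hwc : ∀ m : Fin (i + 1), ⟪e' m, w⟫ = c m := fun m =>
    (h'.1.comp _ hinj).inner_right_fintype c m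
  have hw0 : w ≠ 0 := by
    intro h0
    apply hc0
    ext m
    rw [← hwc, h0]; simp
  have hwn : 0 < ‖w‖ := norm_pos_iff.2 hw0
  have horth : ∀ k < i, ⟪e k, w⟫ = 0 := by
    intro k hk
    have := congrFun (LinearMap.mem_ker.1 hc) ⟨k, hk⟩
    simpa [F, hw, inner_sum, inner_smul_right] using this
  have hzero : ∀ k, i < k → ⟪e' k, w⟫ = 0 := by
    intro k hk
    rw [hw, inner_sum]
    refine Finset.sum_eq_zero fun m _ => ?_
    rw [inner_smul_right, h'.1.2 (by have := m.2; omega), mul_zero]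
  have hsum : ∑' k, ⟪e' k, w⟫ ^ 2 = ‖w‖ ^ 2 := by
    rw [tsum_eq_sum (s := Finset.range (i + 1)) (fun k hk => by
      rw [hzero k (by simpa using hk)]; simp), ← real_inner_self_eq_norm_sq]
    conv_rhs => rw [hw, sum_inner]
    rw [← Fin.sum_univ_eq_sum_range (fun k => ⟪e' k, w⟫ ^ 2)]
    refine Finset.sum_congr rfl fun m _ => ?_
    rw [inner_smul_left, hwc]
    simp [sq]
  refine ⟨‖w‖⁻¹ • w, ?_, ?_, ?_⟩
  · rw [norm_smul, norm_inv, norm_norm, inv_mul_cancel₀ hwn.ne']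
  · rw [map_smul, norm_smul, norm_inv, norm_norm, inv_mul_eq_div, le_div_iff₀ hwn]
    rw [← abs_of_nonneg (norm_nonneg (T' w)), ← abs_of_pos hwn, ← abs_mul, ← sq_le_sq,
      ← (h'.hasSum_norm_sq w).tsum_eq, mul_pow, ← hsum, ← tsum_mul_left]
    refine Summable.tsum_le_tsum (fun k => ?_) ((h'.1.summable_inner_sq w).mul_left _)
      (h'.hasSum_norm_sq w).summable
    rcases lt_or_ge i k with hk | hk
    · simp [hzero k hk]
    · exact mul_le_mul_of_nonneg_right (sq_le_sq.2 (h'.2.1 hk)) (sq_nonneg _)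
  · refine h.norm_apply_le ?_ fun k hk => ?_
    · rw [norm_smul, norm_inv, norm_norm, inv_mul_cancel₀ hwn.ne']
    · rw [inner_smul_right, horth k hk, mul_zero]

theorem nonneg (h : IsEigendecomposition T lam e) (hT : T.IsPositive) (j : ℕ) : 0 ≤ lam j := by
  have := hT.2 (e j)
  rw [ContinuousLinearMap.reApplyInnerSelf_apply, h.apply_self, inner_smul_left,
    real_inner_self_eq_norm_sq, h.1.1 j] at this
  simpa using this

theorem eq_zero_of_zero (h : IsEigendecomposition T lam e) (h0 : lam 0 = 0) : T = 0 := by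
  have : ∀ k, lam k = 0 := fun k => by
    have := h.2.1 (Nat.zero_le k)
    simpa [h0] using this
  ext f
  have h1 := h.2.2 f
  simp only [this, zero_mul, zero_smul] at h1
  exact h1.unique hasSum_zero

/-- A simple eigenvalue is isolated in the spectrum. -/
theorem exists_gap (h : IsEigendecomposition T lam e) (hT : T.IsPositive) {j : ℕ}
    (hj : Module.finrank ℝ (Module.End.eigenspace (T : H →ₗ[ℝ] H) (lam j)) = 1) :
    ∃ g : ℝ, 0 < g ∧ g ≤ lam j ∧ ∀ k, k ≠ j → g ≤ |lam k - lam j| := by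
  have hmem : ∀ k, lam k = lam j →
      e k ∈ Module.End.eigenspace (T : H →ₗ[ℝ] H) (lam j) := by
    intro k hk
    rw [Module.End.mem_eigenspace_iff]
    rw [← hk]
    exact h.apply_self k
  have hne : ∀ k, k ≠ j → lam k ≠ lam j := by
    intro k hk heq
    obtain ⟨v, hv, hspan⟩ := finrank_eq_one_iff'.1 hj
    obtain ⟨a, ha⟩ := hspan ⟨e j, hmem j rfl⟩
    obtain ⟨b, hb⟩ := hspan ⟨e k, hmem k heq⟩
    have ha' : a • (v : H) = e j := congrArg Subtype.val ha
    have hb' : b • (v : H) = e k := congrArg Subtype.val hb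
    have ho : ⟪e k, e j⟫ = 0 := h.1.2 hk
    have hj1 := h.1.1 j
    have hk1 := h.1.1 k
    rw [← ha', ← hb', inner_smul_left, inner_smul_right, real_inner_self_eq_norm_sq] at ho
    rw [← ha', norm_smul] at hj1
    rw [← hb', norm_smul] at hk1
    simp only [mul_eq_zero, conj_trivial] at ho
    rcases ho with h1 | h1 | h1
    · simp [h1] at hk1
    · simp [h1] at hj1
    · rw [pow_eq_zero_iff two_ne_zero] at h1
      simp [h1] at hj1
  have hanti : Antitone lam := fun i k hik => by
    have := h.2.1 hik
    simpa only [abs_of_nonneg (h.nonneg hT _)] using this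
  -- If `lam j` were zero, the next eigenvalue would vanish too and the eigenspace would not be
  -- one-dimensional. Having `g ≤ lam j` also separates `lam j` from the kernel, which the `e k`
  -- need not span.
  have hjpos : 0 < lam j := by
    refine lt_of_le_of_ne (h.nonneg hT j) fun h0 => hne (j + 1) (by omega) ?_
    exact le_antisymm (hanti (by omega)) (h0 ▸ h.nonneg hT _)
  have hnext : lam (j + 1) < lam j := lt_of_le_of_ne (hanti (by omega)) (hne _ (by omega))
  have hgt : ∀ k, j < k → lam j - lam (j + 1) ≤ |lam k - lam j| := fun k hk => by
    have := hanti (show j + 1 ≤ k from hk)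
    rw [abs_sub_comm]
    exact le_trans (by linarith) (le_abs_self _)
  rcases Nat.eq_zero_or_pos j with h0 | h0
  · refine ⟨min (lam j) (lam j - lam (j + 1)), lt_min hjpos (by linarith), min_le_left _ _,
      fun k hk => (min_le_right _ _).trans (hgt k (by omega))⟩
  · have hprev : lam j < lam (j - 1) :=
      lt_of_le_of_ne (hanti (by omega)) (hne _ (by omega)).symm
    refine ⟨min (lam j) (min (lam j - lam (j + 1)) (lam (j - 1) - lam j)),
      lt_min hjpos (lt_min (by linarith) (by linarith)), min_le_left _ _, fun k hk => ?_⟩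
    refine (min_le_right _ _).trans ?_
    rcases lt_or_gt_of_ne hk with hlt | hlt
    · refine (min_le_right _ _).trans ?_
      have := hanti (show k ≤ j - 1 by omega)
      exact le_trans (by linarith) (le_abs_self _)
    · exact (min_le_left _ _).trans (hgt k hlt)

/-- On the complement of `e j`, the operator `T - lam j` multiplies the coefficient along `e k` by
`lam k - lam j`, and what is orthogonal to all `e k` by `-lam j`. All these factors have modulus at
least `g`. -/
theorem gap_mul_norm_le (h : IsEigendecomposition T lam e) {j : ℕ} {g : ℝ} (hg : 0 ≤ g)
    (hgj : g ≤ lam j) (hgap : ∀ k, k ≠ j → g ≤ |lam k - lam j|) (x : H) :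
    g * ‖x - ⟪e j, x⟫ • e j‖ ≤ ‖T x - lam j • x‖ := by
  set y := x - ⟪e j, x⟫ • e j with hy
  have hyj : ⟪e j, y⟫ = 0 := by
    rw [hy, inner_sub_right, inner_smul_right, real_inner_self_eq_norm_sq, h.1.1 j]; simp
  have hT : T x - lam j • x = T y - lam j • y := by
    rw [hy, map_sub, map_smul, h.apply_self, smul_sub, smul_comm (lam j)]
    abel
  rw [hT]
  have hsq : ‖T y - lam j • y‖ ^ 2 = ‖T y‖ ^ 2 - 2 * lam j * ⟪T y, y⟫ + lam j ^ 2 * ‖y‖ ^ 2 := by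
    rw [norm_sub_sq_real, inner_smul_right, norm_smul, mul_pow, Real.norm_eq_abs, sq_abs]; ring
  have h1 : HasSum (fun k => (lam k ^ 2 - 2 * lam j * lam k) * ⟪e k, y⟫ ^ 2)
      (‖T y‖ ^ 2 - 2 * lam j * ⟪T y, y⟫) := by
    have h0 := (h.hasSum_norm_sq y).sub ((h.hasSum_inner y y).mul_left (2 * lam j))
    have hfun : (fun k => (lam k ^ 2 - 2 * lam j * lam k) * ⟪e k, y⟫ ^ 2) = fun k =>
        lam k ^ 2 * ⟪e k, y⟫ ^ 2 - 2 * lam j * (lam k * ⟪e k, y⟫ * ⟪e k, y⟫) := by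
      funext k; ring
    rwa [hfun]
  -- The coefficient `g² - lam j²` is nonpositive, so Bessel's inequality lets `‖y‖²` replace the
  -- sum without completeness of the system `e`.
  have h2 : (g ^ 2 - lam j ^ 2) * ∑' k, ⟪e k, y⟫ ^ 2 ≤ ‖T y‖ ^ 2 - 2 * lam j * ⟪T y, y⟫ := by
    rw [← h1.tsum_eq, ← tsum_mul_left]
    refine Summable.tsum_le_tsum (fun k => ?_) ((h.1.summable_inner_sq y).mul_left _) h1.summable
    rcases eq_or_ne k j with rfl | hk
    · simp [hyj]
    · refine mul_le_mul_of_nonneg_right ?_ (sq_nonneg _)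
      have := pow_le_pow_left₀ hg (hgap k hk) 2
      rw [sq_abs] at this
      linarith
  have h3 := h.1.tsum_inner_sq_le y
  have h4 : g ^ 2 ≤ lam j ^ 2 := pow_le_pow_left₀ hg hgj 2
  have h5 : (g * ‖y‖) ^ 2 ≤ ‖T y - lam j • y‖ ^ 2 := by
    rw [hsq, mul_pow]
    nlinarith
  exact le_of_sq_le_sq h5 (norm_nonneg _)

/-- The vector `e' j` nearly solves the eigenvalue equation of `T` at `lam j`: the residual is at
most `η` from the operators plus `3η` from the eigenvalues. The gap bounds its component off `e j`
by `4η/g`, and passing to the normalized distance doubles the square, whence `32 = 2 · 4²`. -/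
theorem norm_sub_sign_sq_le (h : IsEigendecomposition T lam e)
    (h' : IsEigendecomposition T' lam' e') (hT : T.IsPositive) {j : ℕ} {g η : ℝ} (hg : 0 < g)
    (hgj : g ≤ lam j) (hgap : ∀ k, k ≠ j → g ≤ |lam k - lam j|)
    (hη : ∀ u, ‖u‖ = 1 → ‖T' u - T u‖ ≤ η) :
    ‖e' j - Real.sign ⟪e' j, e j⟫ • e j‖ ^ 2 ≤ 32 / g ^ 2 * η ^ 2 := by
  have hlj := h.nonneg hT j
  have hup : |lam' j| ≤ lam j + η := by
    obtain ⟨u, hu, h1, h2⟩ := h.exists_unit_vector h' j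
    rw [abs_of_nonneg hlj] at h2
    have h3 : ‖T' u‖ ≤ ‖T u‖ + ‖T' u - T u‖ := norm_le_insert' _ _
    linarith [hη u hu]
  have hlow : lam j ≤ |lam' j| + η := by
    obtain ⟨u, hu, h1, h2⟩ := h'.exists_unit_vector h j
    rw [abs_of_nonneg hlj] at h1
    have h3 : ‖T u‖ ≤ ‖T' u‖ + ‖T' u - T u‖ := norm_le_insert _ _
    linarith [hη u hu]
  have hneg : -η ≤ lam' j := by
    have h1 : ⟪T' (e' j) - T (e' j), e' j⟫ ≤ lam' j := by
      have h0 : 0 ≤ ⟪T (e' j), e' j⟫ := hT.2 (e' j)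
      rw [inner_sub_left, h'.apply_self, inner_smul_left, real_inner_self_eq_norm_sq, h'.1.1 j]
      simp [h0]
    have h2 := abs_real_inner_le_norm (T' (e' j) - T (e' j)) (e' j)
    rw [h'.1.1 j, mul_one] at h2
    linarith [(abs_le.1 h2).1, hη _ (h'.1.1 j)]
  -- Min-max controls only moduli. If `lam' j < 0`, positivity of `T` forces `|lam' j| ≤ η`, hence
  -- `lam j ≤ 2η`, and the difference is at most `3η`.
  have hlam : |lam' j - lam j| ≤ 3 * η := by
    have hη0 : 0 ≤ η := (norm_nonneg _).trans (hη _ (h'.1.1 j))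
    rcases le_or_gt 0 (lam' j) with h0 | h0
    · rw [abs_of_nonneg h0] at *
      rw [abs_le]; constructor <;> linarith
    · rw [abs_of_neg h0] at *
      rw [abs_le]; constructor <;> linarith
  have hmain : g * ‖e' j - ⟪e j, e' j⟫ • e j‖ ≤ 4 * η := by
    refine (h.gap_mul_norm_le hg.le hgj hgap (e' j)).trans ?_
    have heq : T (e' j) - lam j • e' j =
        -(T' (e' j) - T (e' j)) + (lam' j - lam j) • e' j := by
      rw [h'.apply_self, sub_smul]; abel
    rw [heq]
    refine (norm_add_le _ _).trans ?_
    rw [norm_neg, norm_smul, h'.1.1 j, mul_one, Real.norm_eq_abs]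
    linarith [hη _ (h'.1.1 j)]
  set c := ⟪e j, e' j⟫ with hc
  have hc1 : |c| ≤ 1 := by
    have := abs_real_inner_le_norm (e j) (e' j)
    rwa [h.1.1, h'.1.1, one_mul] at this
  have hn : ∀ r : ℝ, ‖e' j - r • e j‖ ^ 2 = 1 - 2 * r * c + r ^ 2 := fun r => by
    rw [norm_sub_sq_real, inner_smul_right, norm_smul, mul_pow, Real.norm_eq_abs, sq_abs, h.1.1,
      h'.1.1, real_inner_comm, ← hc]
    ring
  have hbound : (g * ‖e' j - c • e j‖) ^ 2 ≤ (4 * η) ^ 2 :=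
    pow_le_pow_left₀ (by positivity) hmain 2
  rw [mul_pow, hn] at hbound
  have hc2 : c ^ 2 ≤ 1 := by rw [← sq_abs]; exact pow_le_one₀ (abs_nonneg _) hc1
  -- For `c ≠ 0` the left side is `2(1 - |c|)`. For `c = 0` the sign is zero and the left side is
  -- `1`.
  have hsign : ‖e' j - Real.sign ⟪e' j, e j⟫ • e j‖ ^ 2 ≤ 2 * (1 - c ^ 2) := by
    rw [hn, real_inner_comm, ← hc]
    rw [abs_le] at hc1
    rcases lt_trichotomy c 0 with h0 | h0 | h0
    · rw [Real.sign_of_neg h0]; nlinarith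
    · rw [h0]; simp
    · rw [Real.sign_of_pos h0]; nlinarith
  refine hsign.trans ?_
  rw [div_mul_eq_mul_div, le_div_iff₀ (by positivity)]
  nlinarith

end IsEigendecomposition

end Eigen

/-! ### Hilbert–Schmidt norms -/

section HilbertSchmidt

variable {H : Type*} [NormedAddCommGroup H] [InnerProductSpace ℝ H]

theorem ofReal_norm_sq_le_hsNormSq [CompleteSpace H] (T : H →L[ℝ] H) {w : H} (hw : ‖w‖ = 1) :
    ENNReal.ofReal (‖T w‖ ^ 2) ≤ hsNormSq T := by
  have ho : Orthonormal ℝ (fun _ : Fin 1 => w) :=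
    ⟨fun _ => hw, fun i j hij => absurd (Subsingleton.elim i j) hij⟩
  refine le_trans ?_ (le_iSup_of_le 1 (le_iSup_of_le (fun _ : Fin 1 => w) (le_iSup_of_le ho le_rfl)))
  simp

theorem norm_apply_le_of_hsNormSq_le [CompleteSpace H] {T : H →L[ℝ] H} {s : ℝ}
    (h : hsNormSq T ≤ ENNReal.ofReal s) (hs : 0 ≤ s) {w : H} (hw : ‖w‖ = 1) :
    ‖T w‖ ≤ Real.sqrt s := by
  have := (ofReal_norm_sq_le_hsNormSq T hw).trans h
  rw [ENNReal.ofReal_le_ofReal_iff hs] at this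
  exact Real.le_sqrt_of_sq_le this

/-- The weights come from `(2x - y)² ≥ 0`; they are chosen so that a bias `t` of size `4/3 · L² /
K²` turns into exactly `2 L² / K²`. -/
theorem hsNormSq_add_le [CompleteSpace H] {S T : H →L[ℝ] H} {s t : ℝ}
    (hs : 0 ≤ s) (ht : 0 ≤ t)
    (hS : hsNormSq S ≤ ENNReal.ofReal s) (hT : hsNormSq T ≤ ENNReal.ofReal t) :
    hsNormSq (S + T) ≤ ENNReal.ofReal (3 * s + 3 / 2 * t) := by
  refine iSup_le fun n => iSup_le fun v => iSup_le fun hv => ?_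
  have h1 : ∀ {U : H →L[ℝ] H} {u : ℝ}, 0 ≤ u → hsNormSq U ≤ ENNReal.ofReal u →
      ∑ i, ‖U (v i)‖ ^ 2 ≤ u := by
    intro U u hu hU
    have : ∑ i, ENNReal.ofReal (‖U (v i)‖ ^ 2) ≤ hsNormSq U :=
      le_iSup_of_le n (le_iSup_of_le v (le_iSup_of_le hv le_rfl))
    have := this.trans hU
    rwa [← ENNReal.ofReal_sum_of_nonneg fun i _ => sq_nonneg _,
      ENNReal.ofReal_le_ofReal_iff hu] at this
  rw [← ENNReal.ofReal_sum_of_nonneg fun i _ => sq_nonneg _]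
  apply ENNReal.ofReal_le_ofReal
  calc ∑ i, ‖(S + T) (v i)‖ ^ 2 ≤ ∑ i, (3 * ‖S (v i)‖ ^ 2 + 3 / 2 * ‖T (v i)‖ ^ 2) := by
        refine Finset.sum_le_sum fun i _ => ?_
        have h2 : ‖(S + T) (v i)‖ ≤ ‖S (v i)‖ + ‖T (v i)‖ := norm_add_le _ _
        have h3 := norm_nonneg ((S + T) (v i))
        nlinarith [sq_nonneg (2 * ‖S (v i)‖ - ‖T (v i)‖)]
    _ ≤ _ := by
        rw [Finset.sum_add_distrib, ← Finset.mul_sum, ← Finset.mul_sum]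
        linarith [h1 hs hS, h1 ht hT]

end HilbertSchmidt

/-- For almost every `x` the numbers `T (v i) x` are the inner products of `v i` with the section `k
x`; Bessel's inequality holds pointwise in `x` and is then integrated. -/
theorem hsNormSq_le_integral_kernel {α : Type*} [MeasurableSpace α] {μ : Measure α} [SFinite μ]
    {T : Lp ℝ 2 μ →L[ℝ] Lp ℝ 2 μ} {k : α → α → ℝ} (h : HasKernel T k) :
    hsNormSq T ≤ ENNReal.ofReal (∫ z, k z.1 z.2 ^ 2 ∂(μ.prod μ)) := by
  refine iSup_le fun n => iSup_le fun v => iSup_le fun hv => ?_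
  rw [← ENNReal.ofReal_sum_of_nonneg fun i _ => sq_nonneg _]
  apply ENNReal.ofReal_le_ofReal
  have hint := h.1.integrable_sq
  have hsec : ∀ᵐ x ∂μ, MemLp (k x) 2 μ := by
    filter_upwards [hint.prod_right_ae, h.1.1.prodMk_left] with x h1 h2
    exact (memLp_two_iff_integrable_sq h2).2 h1
  have hnorm : ∀ i, ‖T (v i)‖ ^ 2 = ∫ x, (T (v i) x) ^ 2 ∂μ := fun i => by
    rw [← real_inner_self_eq_norm_sq, L2.inner_def]
    refine integral_congr_ae (Eventually.of_forall fun x => ?_)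
    simp [sq]
  simp_rw [hnorm]
  rw [← integral_finsetSum _ fun i _ => (Lp.memLp (T (v i))).integrable_sq, integral_prod _ hint]
  refine integral_mono_ae (integrable_finsetSum _ fun i _ => (Lp.memLp (T (v i))).integrable_sq)
    hint.integral_prod_left ?_
  have hall : ∀ᵐ x ∂μ, ∀ i, T (v i) x = ∫ y, k x y * v i y ∂μ := ae_all_iff.2 fun i => h.2 (v i)
  filter_upwards [hsec, hall] with x hx hTx
  have h1 : ∀ i, T (v i) x = ⟪v i, hx.toLp _⟫ := fun i => by
    rw [hTx, L2.inner_def]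
    refine integral_congr_ae ?_
    filter_upwards [hx.coeFn_toLp] with y hy
    simp [hy]
  have h2 : ‖hx.toLp _‖ ^ 2 = ∫ y, k x y ^ 2 ∂μ := by
    rw [← real_inner_self_eq_norm_sq, L2.inner_def]
    refine integral_congr_ae ?_
    filter_upwards [hx.coeFn_toLp] with y hy
    simp [hy, sq]
  simp only [h1, ← h2]
  simpa using hv.sum_inner_products_le (hx.toLp _) (s := Finset.univ)

/-! ### Perturbation of tensor products -/

theorem norm_tensorFun (x y : L2I) : ‖tensorFun x y‖ = ‖x‖ * ‖y‖ := by
  have h := inner_tensorFun x y x y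
  simp only [real_inner_self_eq_norm_sq] at h
  rw [← mul_pow] at h
  exact (pow_left_inj₀ (norm_nonneg _) (by positivity) two_ne_zero).1 h

section TensorPerturbation

variable {A₁ A₂ T₁ T₂ : L2I →L[ℝ] L2I} {A T : L2Q →L[ℝ] L2Q} {lam rho lam' rho' : ℕ → ℝ}
  {e f e' f' : ℕ → L2I}

/-- Both tensor operators are tested on `u ⊗ v`, where `u` and `v` are the min-max vectors of the
two factors. The products of eigenvalues never have to be ordered. -/
theorem IsTensorOp.abs_eigenvalue_mul_le (hA : IsTensorOp A₁ A₂ A) (hT : IsTensorOp T₁ T₂ T)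
    (h₁ : IsEigendecomposition A₁ lam e) (h₂ : IsEigendecomposition A₂ rho f)
    (h₁' : IsEigendecomposition T₁ lam' e') (h₂' : IsEigendecomposition T₂ rho' f')
    {η : ℝ} (hη : ∀ w, ‖w‖ = 1 → ‖T w - A w‖ ≤ η) (i j : ℕ) :
    |lam' i * rho' j| ≤ |lam i * rho j| + η := by
  obtain ⟨u, hu, hu1, hu2⟩ := h₁.exists_unit_vector h₁' i
  obtain ⟨v, hv, hv1, hv2⟩ := h₂.exists_unit_vector h₂' j
  have hw : ‖tensorFun u v‖ = 1 := by rw [norm_tensorFun, hu, hv, one_mul]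
  have h3 := hη _ hw
  have h4 : ‖T (tensorFun u v)‖ = ‖T₁ u‖ * ‖T₂ v‖ := by rw [hT, norm_tensorFun]
  have h5 : ‖A (tensorFun u v)‖ = ‖A₁ u‖ * ‖A₂ v‖ := by rw [hA, norm_tensorFun]
  have h6 := norm_le_insert' (T (tensorFun u v)) (A (tensorFun u v))
  have h7 : |lam' i * rho' j| ≤ ‖T₁ u‖ * ‖T₂ v‖ := by rw [abs_mul]; gcongr
  have h8 : ‖A₁ u‖ * ‖A₂ v‖ ≤ |lam i * rho j| := by rw [abs_mul]; gcongr
  linarith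

/-- The moduli of the two products differ by at most `s + b`. A negative estimated product is at
least `-s`, because the intermediate operator `AK` is nonnegative on product vectors. The bias `b`
thus keeps the coefficient one, on which the final constant depends. -/
theorem IsTensorOp.abs_eigenvalue_mul_sub_le (hA : IsTensorOp A₁ A₂ A) (hT : IsTensorOp T₁ T₂ T)
    (hA₁ : A₁.IsPositive) (hA₂ : A₂.IsPositive)
    (h₁ : IsEigendecomposition A₁ lam e) (h₂ : IsEigendecomposition A₂ rho f)
    (h₁' : IsEigendecomposition T₁ lam' e') (h₂' : IsEigendecomposition T₂ rho' f')
    {AK : L2Q →L[ℝ] L2Q} (hAK : ∀ x y, 0 ≤ ⟪AK (tensorFun x y), tensorFun x y⟫)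
    {s b : ℝ} (hs : ∀ w, ‖w‖ = 1 → ‖T w - AK w‖ ≤ s) (hb : ∀ w, ‖w‖ = 1 → ‖AK w - A w‖ ≤ b)
    (i j : ℕ) : |lam' i * rho' j - lam i * rho j| ≤ 3 * s + b := by
  have hη : ∀ w, ‖w‖ = 1 → ‖T w - A w‖ ≤ s + b := fun w hw => by
    have := norm_add_le (T w - AK w) (AK w - A w)
    rw [sub_add_sub_cancel] at this
    linarith [hs w hw, hb w hw]
  have hη' : ∀ w, ‖w‖ = 1 → ‖A w - T w‖ ≤ s + b := fun w hw => by
    rw [norm_sub_rev]; exact hη w hw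
  have hup := hA.abs_eigenvalue_mul_le hT h₁ h₂ h₁' h₂' hη i j
  have hlow := hT.abs_eigenvalue_mul_le hA h₁' h₂' h₁ h₂ hη' i j
  have hpos : 0 ≤ lam i * rho j := mul_nonneg (h₁.nonneg hA₁ i) (h₂.nonneg hA₂ j)
  set w := tensorFun (e' i) (f' j) with hw_def
  have hw : ‖w‖ = 1 := by rw [norm_tensorFun, h₁'.1.1, h₂'.1.1, one_mul]
  have hTw : T w = (lam' i * rho' j) • w := by
    rw [hw_def, hT, h₁'.apply_self, h₂'.apply_self, tensorFun_smul_left, tensorFun_smul_right,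
      smul_smul]
  have hneg : -s ≤ lam' i * rho' j := by
    have h1 : ⟪T w - AK w, w⟫ ≤ lam' i * rho' j := by
      rw [inner_sub_left, hTw, inner_smul_left, real_inner_self_eq_norm_sq, hw]
      simpa using hAK (e' i) (f' j)
    have h2 := abs_real_inner_le_norm (T w - AK w) w
    rw [hw, mul_one] at h2
    linarith [(abs_le.1 h2).1, hs w hw]
  have hs0 : 0 ≤ s := (norm_nonneg _).trans (hs w hw)
  rw [abs_of_nonneg hpos] at hup hlow
  rcases le_or_gt 0 (lam' i * rho' j) with h0 | h0
  · rw [abs_of_nonneg h0] at *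
    rw [abs_le]; constructor <;> linarith
  · rw [abs_of_neg h0] at *
    rw [abs_le]; constructor <;> linarith

/-- Pairing the difference on `u ⊗ x` with `w ⊗ x`, where `w` is the vector to be estimated,
evaluates the second factors at `x` and produces `‖w‖²`. -/
theorem IsTensorOp.norm_smul_sub_smul_le (hA : IsTensorOp A₁ A₂ A) (hT : IsTensorOp T₁ T₂ T)
    {η : ℝ} (hη : ∀ w, ‖w‖ = 1 → ‖T w - A w‖ ≤ η) {x u : L2I} (hx : ‖x‖ = 1) (hu : ‖u‖ = 1) :
    ‖⟪T₂ x, x⟫ • T₁ u - ⟪A₂ x, x⟫ • A₁ u‖ ≤ η := by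
  set w := ⟪T₂ x, x⟫ • T₁ u - ⟪A₂ x, x⟫ • A₁ u with hw
  have h1 : ⟪T (tensorFun u x) - A (tensorFun u x), tensorFun w x⟫ = ‖w‖ ^ 2 := by
    rw [inner_sub_left, hT, hA, inner_tensorFun, inner_tensorFun, ← real_inner_self_eq_norm_sq]
    conv_rhs => rw [hw, inner_sub_left, inner_smul_left, inner_smul_left, ← hw]
    simp; ring
  have h2 := real_inner_le_norm (T (tensorFun u x) - A (tensorFun u x)) (tensorFun w x)
  rw [h1, norm_tensorFun, hx, mul_one] at h2
  have h3 := hη (tensorFun u x) (by rw [norm_tensorFun, hu, hx, one_mul])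
  rcases (norm_nonneg w).eq_or_lt' with h0 | h0
  · rw [h0]; exact (norm_nonneg _).trans h3
  · nlinarith

/-- Rescaling an operator keeps its eigenvectors, so `rho 0 • A₁`, with gap `rho 0 * g`, may be
compared with `⟪T₂ (f 0), f 0⟫ • T₁`. The unknown scales of the estimated factors disappear. -/
theorem IsTensorOp.norm_eigenvector_sub_le (hA : IsTensorOp A₁ A₂ A) (hT : IsTensorOp T₁ T₂ T)
    (hA₁ : A₁.IsPositive) (hA₂ : A₂.IsPositive)
    (h₁ : IsEigendecomposition A₁ lam e) (h₂ : IsEigendecomposition A₂ rho f)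
    (h₁' : IsEigendecomposition T₁ lam' e') (hr : rho 0 ≠ 0) {j : ℕ} {g : ℝ}
    (hg : 0 < g) (hgj : g ≤ lam j) (hgap : ∀ k, k ≠ j → g ≤ |lam k - lam j|)
    {η : ℝ} (hη : ∀ w, ‖w‖ = 1 → ‖T w - A w‖ ≤ η) :
    ‖e' j - Real.sign ⟪e' j, e j⟫ • e j‖ ^ 2 ≤ 32 / (rho 0 * g) ^ 2 * η ^ 2 := by
  have hr0 : 0 < rho 0 := (h₂.nonneg hA₂ 0).lt_of_ne' hr
  have hf : ⟪A₂ (f 0), f 0⟫ = rho 0 := by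
    rw [h₂.apply_self, inner_smul_left, real_inner_self_eq_norm_sq, h₂.1.1]; simp
  refine (h₁.smul (rho 0)).norm_sub_sign_sq_le (h₁'.smul ⟪T₂ (f 0), f 0⟫) ?_ (by positivity)
    (mul_le_mul_of_nonneg_left hgj hr0.le) (fun k hk => ?_) fun u hu => ?_
  · exact hA₁.smul_of_nonneg hr0.le
  · rw [← mul_sub, abs_mul, abs_of_pos hr0]
    exact mul_le_mul_of_nonneg_left (hgap k hk) hr0.le
  · have := hA.norm_smul_sub_smul_le hT hη (h₂.1.1 0) hu
    rwa [hf] at this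

end TensorPerturbation

/-! ### Integral kernels -/

section Kernel

set_option linter.unusedSectionVars false

variable {α : Type*} [MeasurableSpace α] {μ : Measure α} [SFinite μ]
  {S T : Lp ℝ 2 μ →L[ℝ] Lp ℝ 2 μ} {k l : α → α → ℝ}

theorem HasKernel.ae_memLp (h : HasKernel T k) : ∀ᵐ x ∂μ, MemLp (k x) 2 μ := by
  filter_upwards [h.1.integrable_sq.prod_right_ae, h.1.1.prodMk_left] with x h1 h2
  exact (memLp_two_iff_integrable_sq h2).2 h1

theorem HasKernel.sub (hS : HasKernel S k) (hT : HasKernel T l) :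
    HasKernel (S - T) fun x y => k x y - l x y := by
  refine ⟨hS.1.sub hT.1, fun f => ?_⟩
  have h0 : (S - T) f = S f - T f := rfl
  rw [h0]
  filter_upwards [hS.2 f, hT.2 f, hS.ae_memLp, hT.ae_memLp, Lp.coeFn_sub (S f) (T f)]
    with x h1 h2 h3 h4 h5
  rw [h5, Pi.sub_apply, h1, h2, ← integral_sub]
  · simp only [sub_mul]
  · exact h3.integrable_mul (Lp.memLp f)
  · exact h4.integrable_mul (Lp.memLp f)

theorem HasKernel.add (hS : HasKernel S k) (hT : HasKernel T l) :
    HasKernel (S + T) fun x y => k x y + l x y := by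
  refine ⟨hS.1.add hT.1, fun f => ?_⟩
  have h0 : (S + T) f = S f + T f := rfl
  rw [h0]
  filter_upwards [hS.2 f, hT.2 f, hS.ae_memLp, hT.ae_memLp, Lp.coeFn_add (S f) (T f)]
    with x h1 h2 h3 h4 h5
  rw [h5, Pi.add_apply, h1, h2, ← integral_add]
  · simp only [add_mul]
  · exact h3.integrable_mul (Lp.memLp f)
  · exact h4.integrable_mul (Lp.memLp f)

theorem HasKernel.smul (hT : HasKernel T k) (c : ℝ) :
    HasKernel (c • T) fun x y => c * k x y := by
  refine ⟨hT.1.const_mul c, fun f => ?_⟩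
  have h0 : (c • T) f = c • T f := rfl
  rw [h0]
  filter_upwards [hT.2 f, Lp.coeFn_smul c (T f)] with x h1 h5
  rw [h5, Pi.smul_apply, h1, smul_eq_mul, ← integral_const_mul]
  simp only [mul_assoc]

theorem HasKernel.zero : HasKernel (0 : Lp ℝ 2 μ →L[ℝ] Lp ℝ 2 μ) fun _ _ => 0 := by
  refine ⟨MemLp.zero', fun f => ?_⟩
  filter_upwards [Lp.coeFn_zero ℝ 2 μ] with x hx
  simpa using hx

theorem HasKernel.sum {ι : Type*} (s : Finset ι) {T : ι → Lp ℝ 2 μ →L[ℝ] Lp ℝ 2 μ}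
    {k : ι → α → α → ℝ} (h : ∀ i, HasKernel (T i) (k i)) :
    HasKernel (∑ i ∈ s, T i) fun x y => ∑ i ∈ s, k i x y := by
  classical
  induction s using Finset.induction_on with
  | empty => simpa using HasKernel.zero
  | insert i s hi ih =>
    simp only [Finset.sum_insert hi]
    exact (h i).add ih

theorem HasKernel.rankOne {u w : Lp ℝ 2 μ} {u' w' : α → ℝ} (hu : u =ᵐ[μ] u') (hw : w =ᵐ[μ] w') :
    HasKernel (InnerProductSpace.rankOne ℝ u w) fun x y => u' x * w' y := by
  have hu2 : MemLp u' 2 μ := (memLp_congr_ae hu).1 (Lp.memLp u)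
  have hw2 : MemLp w' 2 μ := (memLp_congr_ae hw).1 (Lp.memLp w)
  constructor
  · have hm : AEStronglyMeasurable (fun p : α × α => u' p.1 * w' p.2) (μ.prod μ) :=
      hu2.1.comp_fst.mul hw2.1.comp_snd
    rw [memLp_two_iff_integrable_sq hm]
    simpa [mul_pow] using hu2.integrable_sq.mul_prod hw2.integrable_sq
  · intro f
    have h1 : ∫ y, w' y * f y ∂μ = ⟪w, f⟫ := by
      rw [L2.inner_def]
      refine integral_congr_ae ?_
      filter_upwards [hw] with y hy
      simp [hy, mul_comm]
    rw [InnerProductSpace.rankOne_apply]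
    filter_upwards [hu, Lp.coeFn_smul ⟪w, f⟫ u] with x hx hx2
    rw [hx2, Pi.smul_apply, hx, ← h1, smul_eq_mul, mul_comm, ← integral_const_mul]
    simp only [mul_assoc]

end Kernel

/-! ### The grid -/

section Grid

variable {K : ℕ}

theorem cell_subset_Icc (i : Fin K) : cell K i ⊆ Icc ((i : ℝ) / K) (((i : ℝ) + 1) / K) :=
  Ico_subset_Icc_self

theorem Icc_div_subset (i : Fin K) : Icc ((i : ℝ) / K) (((i : ℝ) + 1) / K) ⊆ Icc 0 1 := by
  have hK : (0 : ℝ) < K := by exact_mod_cast i.pos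
  have hi : ((i : ℝ) + 1) ≤ K := by exact_mod_cast i.2
  refine Icc_subset_Icc (by positivity) ((div_le_one hK).2 hi)

theorem eq_of_mem_cell {t : ℝ} {i j : Fin K} (hi : t ∈ cell K i) (hj : t ∈ cell K j) : i = j := by
  have hK : (0 : ℝ) < K := by exact_mod_cast i.pos
  obtain ⟨h1, h2⟩ := hi
  obtain ⟨h3, h4⟩ := hj
  rw [div_le_iff₀ hK] at h1 h3
  rw [lt_div_iff₀ hK] at h2 h4
  have h5 : ((i : ℕ) : ℝ) < (j : ℕ) + 1 := h1.trans_lt h4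
  have h6 : ((j : ℕ) : ℝ) < (i : ℕ) + 1 := h3.trans_lt h2
  norm_cast at h5 h6
  exact Fin.ext (by omega)

theorem exists_mem_cell (hK : 0 < K) {t : ℝ} (h0 : 0 ≤ t) (h1 : t < 1) :
    ∃ i, t ∈ cell K i := by
  have hK' : (0 : ℝ) < K := by exact_mod_cast hK
  have hlt : ⌊t * K⌋₊ < K := by
    rw [Nat.floor_lt (by positivity)]; nlinarith
  refine ⟨⟨⌊t * K⌋₊, hlt⟩, ?_, ?_⟩
  · rw [div_le_iff₀ hK']; exact Nat.floor_le (by positivity)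
  · rw [lt_div_iff₀ hK']; exact Nat.lt_floor_add_one _

theorem unitMeasure_restrict_cell (i : Fin K) :
    unitMeasure.restrict (cell K i) = volume.restrict (cell K i) := by
  rw [Measure.restrict_restrict (measurableSet_cell K i), inter_eq_left.2]
  exact (cell_subset_Icc i).trans (Icc_div_subset i)

/-- The pixel `Iᵢ × Iⱼ`. -/
def pixel (K : ℕ) (p : Fin K × Fin K) : Set (ℝ × ℝ) := cell K p.1 ×ˢ cell K p.2

theorem measurableSet_pixel (p : Fin K × Fin K) : MeasurableSet (pixel K p) :=
  (measurableSet_cell K p.1).prod (measurableSet_cell K p.2)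

theorem eq_of_mem_pixel {x : ℝ × ℝ} {p q : Fin K × Fin K} (hp : x ∈ pixel K p)
    (hq : x ∈ pixel K q) : p = q :=
  Prod.ext (eq_of_mem_cell hp.1 hq.1) (eq_of_mem_cell hp.2 hq.2)

theorem ae_exists_mem_pixel (hK : 0 < K) : ∀ᵐ x ∂squareMeasure, ∃ p, x ∈ pixel K p := by
  have h1 : ∀ᵐ t ∂unitMeasure, ∃ i, t ∈ cell K i := by
    have h2 : ∀ᵐ t ∂unitMeasure, t ≠ 1 :=
      Measure.ae_ne _ _
    filter_upwards [ae_restrict_mem measurableSet_Icc, h2] with t ht ht1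
    exact exists_mem_cell hK ht.1 (ht.2.lt_of_ne ht1)
  filter_upwards [Measure.quasiMeasurePreserving_fst (μ := unitMeasure) (ν := unitMeasure) |>.ae h1,
    Measure.quasiMeasurePreserving_snd (μ := unitMeasure) (ν := unitMeasure) |>.ae h1]
    with x ⟨i, hi⟩ ⟨j, hj⟩
  exact ⟨(i, j), hi, hj⟩

theorem integral_eq_sum_pixels (hK : 0 < K) {F : (ℝ × ℝ) × (ℝ × ℝ) → ℝ}
    (hF : Integrable F (squareMeasure.prod squareMeasure)) :
    ∫ z, F z ∂(squareMeasure.prod squareMeasure) = ∑ p : Fin K × Fin K, ∑ q : Fin K × Fin K,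
      ∫ z in pixel K p ×ˢ pixel K q, F z ∂(squareMeasure.prod squareMeasure) := by
  classical
  have hm : ∀ p q : Fin K × Fin K, MeasurableSet (pixel K p ×ˢ pixel K q) := fun p q =>
    (measurableSet_pixel p).prod (measurableSet_pixel q)
  have h1 : F =ᵐ[squareMeasure.prod squareMeasure] fun z => ∑ p : Fin K × Fin K,
      ∑ q : Fin K × Fin K, (pixel K p ×ˢ pixel K q).indicator F z := by
    filter_upwards [Measure.quasiMeasurePreserving_fst (μ := squareMeasure) (ν := squareMeasure)
      |>.ae (ae_exists_mem_pixel hK), Measure.quasiMeasurePreserving_snd (μ := squareMeasure)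
      (ν := squareMeasure) |>.ae (ae_exists_mem_pixel hK)] with z ⟨p, hp⟩ ⟨q, hq⟩
    rw [Finset.sum_eq_single p, Finset.sum_eq_single q]
    · rw [indicator_of_mem]; exact ⟨hp, hq⟩
    · intro q' _ hne
      exact indicator_of_notMem (fun h => hne (eq_of_mem_pixel h.2 hq)) _
    · simp
    · intro p' _ hne
      exact Finset.sum_eq_zero fun q' _ =>
        indicator_of_notMem (fun h => hne (eq_of_mem_pixel h.1 hp)) _
    · simp
  rw [integral_congr_ae h1, integral_finsetSum _ fun p _ => integrable_finsetSum _ fun q _ =>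
    hF.indicator (hm p q)]
  refine Finset.sum_congr rfl fun p _ => ?_
  rw [integral_finsetSum _ fun q _ => hF.indicator (hm p q)]
  exact Finset.sum_congr rfl fun q _ => integral_indicator (hm p q)

theorem restrict_pixel_prod (p q : Fin K × Fin K) :
    (squareMeasure.prod squareMeasure).restrict (pixel K p ×ˢ pixel K q) =
      ((volume.restrict (cell K p.1)).prod (volume.restrict (cell K p.2))).prod
        ((volume.restrict (cell K q.1)).prod (volume.restrict (cell K q.2))) := by
  simp only [← unitMeasure_restrict_cell, Measure.prod_restrict, pixel]

theorem volume_real_cell (i : Fin K) : (volume.restrict (cell K i)).real univ = 1 / K := by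
  have hK : (0 : ℝ) < K := by exact_mod_cast i.pos
  rw [measureReal_restrict_apply MeasurableSet.univ, univ_inter, cell, Real.volume_real_Ico_of_le]
  · ring
  · gcongr; linarith

/-- With `r` and `1/K - r` the distances from `y` to the end points, the integral is a third of the
sum of their cubes, largest when `y` is an end point. -/
theorem integral_cell_sq_sub_le (i : Fin K) {y : ℝ}
    (hy : y ∈ Icc ((i : ℝ) / K) (((i : ℝ) + 1) / K)) :
    ∫ t in cell K i, (t - y) ^ 2 ≤ 1 / (3 * K ^ 3) := by
  have hK : (0 : ℝ) < K := by exact_mod_cast i.pos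
  have hle : (i : ℝ) / K ≤ ((i : ℝ) + 1) / K := by gcongr; linarith
  rw [cell, ← integral_Icc_eq_integral_Ico, integral_Icc_eq_integral_Ioc,
    ← intervalIntegral.integral_of_le hle, intervalIntegral.integral_comp_sub_right (fun t => t ^ 2),
    integral_pow]
  obtain ⟨h1, h2⟩ := hy
  have h3 : ((i : ℝ) + 1) / K - y = 1 / K - (y - i / K) := by ring
  set r := y - i / K with hr
  have hr0 : 0 ≤ r := by linarith
  have hr1 : r ≤ 1 / K := by
    have : ((i : ℝ) + 1) / K = i / K + 1 / K := by ring
    linarith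
  have h4 : (i : ℝ) / K - y = -r := by ring
  rw [h3, h4]
  have h5 : (1 : ℝ) / (3 * K ^ 3) = (1 / K) ^ 3 / 3 := by field_simp
  rw [h5]
  set s : ℝ := 1 / K
  norm_num
  nlinarith [mul_nonneg hr0 (sub_nonneg.2 hr1), mul_nonneg (mul_nonneg hr0 (sub_nonneg.2 hr1)) (hr0.trans hr1)]

end Grid

/-! ### Piecewise constant operators -/

section Step

variable {K : ℕ}

/-- The closed pixel with index `p`. -/
def closedPixel (K : ℕ) (p : Fin K × Fin K) : Set (ℝ × ℝ) :=
  Icc ((p.1 : ℝ) / K) (((p.1 : ℝ) + 1) / K) ×ˢ Icc ((p.2 : ℝ) / K) (((p.2 : ℝ) + 1) / K)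

theorem closedPixel_subset (p : Fin K × Fin K) : closedPixel K p ⊆ unitSquare :=
  prod_mono (Icc_div_subset p.1) (Icc_div_subset p.2)

theorem pixel_subset_closedPixel (p : Fin K × Fin K) : pixel K p ⊆ closedPixel K p :=
  prod_mono (cell_subset_Icc p.1) (cell_subset_Icc p.2)

/-- The indicator of an interval, as an element of `L²[0,1]`. -/
def icoInd (u v : ℝ) : L2I :=
  indicatorConstLp 2 (measurableSet_Ico (a := u) (b := v)) (measure_ne_top unitMeasure _) (1 : ℝ)

theorem tensorFun_icoInd_ae (u v u' v' : ℝ) :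
    tensorFun (icoInd u v) (icoInd u' v') =ᵐ[squareMeasure]
      (Ico u v ×ˢ Ico u' v').indicator 1 := by
  have h1 : ∀ r r', icoInd r r' =ᵐ[unitMeasure] (Ico r r').indicator fun _ => (1 : ℝ) :=
    fun _ _ => indicatorConstLp_coeFn
  filter_upwards [coeFn_tensorFun (icoInd u v) (icoInd u' v'),
    Measure.quasiMeasurePreserving_fst (μ := unitMeasure) (ν := unitMeasure) |>.ae (h1 u v),
    Measure.quasiMeasurePreserving_snd (μ := unitMeasure) (ν := unitMeasure) |>.ae (h1 u' v')]
    with x h2 h3 h4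
  rw [h2, h3, h4]
  simp only [indicator, mem_prod]
  split_ifs <;> simp_all

theorem tensorFun_cellInd_ae (p : Fin K × Fin K) :
    tensorFun (cellInd K p.1) (cellInd K p.2) =ᵐ[squareMeasure] (pixel K p).indicator 1 :=
  tensorFun_icoInd_ae _ _ _ _

/-- The kernel of `contOpTensor`. -/
def stepKernel (M₁ M₂ : Fin K → Fin K → ℝ) (x y : ℝ × ℝ) : ℝ :=
  ∑ i, ∑ k, ∑ j, ∑ l, (M₁ i k * M₂ j l) *
    ((pixel K (i, j)).indicator 1 x * (pixel K (k, l)).indicator 1 y)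

theorem hasKernel_contOpTensor (M₁ M₂ : Fin K → Fin K → ℝ) :
    HasKernel (contOpTensor M₁ M₂) (stepKernel M₁ M₂) := by
  refine HasKernel.sum _ fun i => HasKernel.sum _ fun k => HasKernel.sum _ fun j =>
    HasKernel.sum _ fun l => HasKernel.smul (HasKernel.rankOne ?_ ?_) _
  · exact tensorFun_cellInd_ae (i, j)
  · exact tensorFun_cellInd_ae (k, l)

theorem stepKernel_apply (M₁ M₂ : Fin K → Fin K → ℝ) {p q : Fin K × Fin K} {x y : ℝ × ℝ}
    (hx : x ∈ pixel K p) (hy : y ∈ pixel K q) :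
    stepKernel M₁ M₂ x y = M₁ p.1 q.1 * M₂ p.2 q.2 := by
  have hx' : ∀ r, r ≠ p → (pixel K r).indicator (1 : ℝ × ℝ → ℝ) x = 0 := fun r hr =>
    indicator_of_notMem (fun h => hr (eq_of_mem_pixel h hx)) _
  have hy' : ∀ r, r ≠ q → (pixel K r).indicator (1 : ℝ × ℝ → ℝ) y = 0 := fun r hr =>
    indicator_of_notMem (fun h => hr (eq_of_mem_pixel h hy)) _
  obtain ⟨i, j⟩ := p
  obtain ⟨k, l⟩ := q
  rw [stepKernel, Finset.sum_eq_single i, Finset.sum_eq_single k, Finset.sum_eq_single j,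
    Finset.sum_eq_single l]
  · rw [indicator_of_mem hx, indicator_of_mem hy]; simp
  · intro l' _ h; rw [hy' (k, l') (by simpa using h)]; simp
  · simp
  · intro j' _ h; rw [hx' (i, j') (by simpa using h)]; simp
  · simp
  · intro k' _ h
    refine Finset.sum_eq_zero fun j' _ => Finset.sum_eq_zero fun l' _ => ?_
    rw [hy' (k', l') (by simp [h])]; simp
  · simp
  · intro i' _ h
    refine Finset.sum_eq_zero fun k' _ => Finset.sum_eq_zero fun j' _ =>
      Finset.sum_eq_zero fun l' _ => ?_
    rw [hx' (i', j') (by simp [h])]; simp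
  · simp

theorem volume_real_pixel_prod (p q : Fin K × Fin K) :
    ((squareMeasure.prod squareMeasure).restrict (pixel K p ×ˢ pixel K q)).real univ =
      1 / (K : ℝ) ^ 4 := by
  have hK : (K : ℝ) ≠ 0 := by exact_mod_cast p.1.pos.ne'
  rw [restrict_pixel_prod]
  simp only [← univ_prod_univ, measureReal_prod_prod, volume_real_cell]
  field_simp

theorem sum_pixels (F : Fin K → Fin K → Fin K → Fin K → ℝ) :
    ∑ p : Fin K × Fin K, ∑ q : Fin K × Fin K, F p.1 p.2 q.1 q.2 =
      ∑ i, ∑ j, ∑ k, ∑ l, F i j k l := by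
  simp only [Fintype.sum_prod_type]

theorem hsNormSq_contOpTensor_sub_le (hK : 0 < K) (M₁ M₂ N₁ N₂ : Fin K → Fin K → ℝ) :
    hsNormSq (contOpTensor M₁ M₂ - contOpTensor N₁ N₂) ≤ ENNReal.ofReal
      ((∑ i, ∑ j, ∑ k, ∑ l, (M₁ i k * M₂ j l - N₁ i k * N₂ j l) ^ 2) / (K : ℝ) ^ 4) := by
  have hker := (hasKernel_contOpTensor M₁ M₂).sub (hasKernel_contOpTensor N₁ N₂)
  refine (hsNormSq_le_integral_kernel hker).trans (ENNReal.ofReal_le_ofReal (le_of_eq ?_))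
  rw [integral_eq_sum_pixels hK hker.1.integrable_sq,
    ← sum_pixels fun i j k l => (M₁ i k * M₂ j l - N₁ i k * N₂ j l) ^ 2, Finset.sum_div]
  refine Finset.sum_congr rfl fun p _ => ?_
  rw [Finset.sum_div]
  refine Finset.sum_congr rfl fun q _ => ?_
  rw [setIntegral_congr_fun (g := fun _ => (M₁ p.1 q.1 * M₂ p.2 q.2 - N₁ p.1 q.1 * N₂ p.2 q.2) ^ 2)
    ((measurableSet_pixel p).prod (measurableSet_pixel q)) fun z hz => ?_]
  · rw [integral_const, volume_real_pixel_prod, smul_eq_mul]; ring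
  · simp only [stepKernel_apply _ _ hz.1 hz.2]

theorem integral_pixel_prod_sq_dist_le (p q : Fin K × Fin K) {y y' : ℝ × ℝ}
    (hy : y ∈ closedPixel K p) (hy' : y' ∈ closedPixel K q) :
    IntegrableOn (fun z : (ℝ × ℝ) × (ℝ × ℝ) => (z.1.1 - y.1) ^ 2 + (z.1.2 - y.2) ^ 2 +
      (z.2.1 - y'.1) ^ 2 + (z.2.2 - y'.2) ^ 2) (pixel K p ×ˢ pixel K q)
      (squareMeasure.prod squareMeasure) ∧
    ∫ z in pixel K p ×ˢ pixel K q, ((z.1.1 - y.1) ^ 2 + (z.1.2 - y.2) ^ 2 +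
      (z.2.1 - y'.1) ^ 2 + (z.2.2 - y'.2) ^ 2) ∂(squareMeasure.prod squareMeasure) ≤
      4 / (3 * (K : ℝ) ^ 6) := by
  have hK : (0 : ℝ) < K := by exact_mod_cast p.1.pos
  have hint : ∀ (i : Fin K) (r : ℝ), Integrable (fun t : ℝ => (t - r) ^ 2)
      (volume.restrict (cell K i)) := fun i r => by
    have : IntegrableOn (fun t : ℝ => (t - r) ^ 2) (Icc ((i : ℝ) / K) (((i : ℝ) + 1) / K)) :=
      (by fun_prop : Continuous fun t : ℝ => (t - r) ^ 2).continuousOn.integrableOn_Icc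
    exact this.mono_set (cell_subset_Icc i)
  have hfin : ∀ i : Fin K, IsFiniteMeasure (volume.restrict (cell K i)) := fun i => by
    rw [← unitMeasure_restrict_cell]; infer_instance
  have h1 := ((hint p.1 y.1).comp_fst (volume.restrict (cell K p.2))).comp_fst
    ((volume.restrict (cell K q.1)).prod (volume.restrict (cell K q.2)))
  have h2 := ((hint p.2 y.2).comp_snd (volume.restrict (cell K p.1))).comp_fst
    ((volume.restrict (cell K q.1)).prod (volume.restrict (cell K q.2)))
  have h3 := ((hint q.1 y'.1).comp_fst (volume.restrict (cell K q.2))).comp_snd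
    ((volume.restrict (cell K p.1)).prod (volume.restrict (cell K p.2)))
  have h4 := ((hint q.2 y'.2).comp_snd (volume.restrict (cell K q.1))).comp_snd
    ((volume.restrict (cell K p.1)).prod (volume.restrict (cell K p.2)))
  rw [IntegrableOn, restrict_pixel_prod]
  have h12 := h1.fun_add h2
  have h123 := h12.fun_add h3
  refine ⟨h123.fun_add h4, ?_⟩
  rw [integral_add h123 h4, integral_add h12 h3, integral_add h1 h2]
  rw [integral_fun_fst fun x : ℝ × ℝ => (x.1 - y.1) ^ 2, integral_fun_fst fun t => (t - y.1) ^ 2,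
    integral_fun_fst fun x : ℝ × ℝ => (x.2 - y.2) ^ 2, integral_fun_snd fun t => (t - y.2) ^ 2,
    integral_fun_snd fun x : ℝ × ℝ => (x.1 - y'.1) ^ 2, integral_fun_fst fun t => (t - y'.1) ^ 2,
    integral_fun_snd fun x : ℝ × ℝ => (x.2 - y'.2) ^ 2, integral_fun_snd fun t => (t - y'.2) ^ 2]
  simp only [← univ_prod_univ, measureReal_prod_prod, volume_real_cell, smul_eq_mul]
  have b1 := integral_cell_sq_sub_le p.1 hy.1
  have b2 := integral_cell_sq_sub_le p.2 hy.2
  have b3 := integral_cell_sq_sub_le q.1 hy'.1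
  have b4 := integral_cell_sq_sub_le q.2 hy'.2
  have e : (4 : ℝ) / (3 * (K : ℝ) ^ 6) = 1 / K * (1 / K) * (1 / K) * (4 * (1 / (3 * K ^ 3))) := by
    field_simp
  rw [e]
  have hc : (0 : ℝ) ≤ 1 / K * (1 / K) * (1 / K) := by positivity
  nlinarith [mul_le_mul_of_nonneg_left b1 hc, mul_le_mul_of_nonneg_left b2 hc,
    mul_le_mul_of_nonneg_left b3 hc, mul_le_mul_of_nonneg_left b4 hc]

/-- The discretization bias: on each of the `K⁴` pairs of pixels the squared error is at most `L²`
times the integrated squared distance `4 / (3 K⁶)`, one quarter from each coordinate. -/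
theorem hsNormSq_contOpTensor_sub_kernel_le (hK : 0 < K) {M₁ M₂ : Fin K → Fin K → ℝ}
    {A : L2Q →L[ℝ] L2Q} {a : ℝ × ℝ → ℝ × ℝ → ℝ} (ha : HasKernel A a) {L : ℝ}
    (hlip : LipschitzKernel L a)
    (h : ∀ p q : Fin K × Fin K, ∃ y ∈ closedPixel K p, ∃ y' ∈ closedPixel K q,
      M₁ p.1 q.1 * M₂ p.2 q.2 = a y y') :
    hsNormSq (contOpTensor M₁ M₂ - A) ≤ ENNReal.ofReal (4 / 3 * L ^ 2 / (K : ℝ) ^ 2) := by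
  have hK' : (0 : ℝ) < K := by exact_mod_cast hK
  have hker := (hasKernel_contOpTensor M₁ M₂).sub ha
  refine (hsNormSq_le_integral_kernel hker).trans (ENNReal.ofReal_le_ofReal ?_)
  rw [integral_eq_sum_pixels hK hker.1.integrable_sq]
  have hbox : ∀ p q : Fin K × Fin K, ∫ z in pixel K p ×ˢ pixel K q,
      (stepKernel M₁ M₂ z.1 z.2 - a z.1 z.2) ^ 2 ∂(squareMeasure.prod squareMeasure) ≤
      L ^ 2 * (4 / (3 * (K : ℝ) ^ 6)) := by
    intro p q
    obtain ⟨y, hy, y', hy', heq⟩ := h p q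
    obtain ⟨hi, hb⟩ := integral_pixel_prod_sq_dist_le p q hy hy'
    refine le_trans ?_ (mul_le_mul_of_nonneg_left hb (sq_nonneg L))
    rw [← integral_const_mul]
    refine integral_mono_of_nonneg (Eventually.of_forall fun z => sq_nonneg _)
      (hi.const_mul _) ?_
    filter_upwards [ae_restrict_mem ((measurableSet_pixel p).prod (measurableSet_pixel q))]
      with z hz
    rw [stepKernel_apply _ _ hz.1 hz.2, heq, ← sq_abs, abs_sub_comm]
    have h1 := hlip z.1 (closedPixel_subset p (pixel_subset_closedPixel p hz.1)) z.2
      (closedPixel_subset q (pixel_subset_closedPixel q hz.2)) y (closedPixel_subset p hy) y'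
      (closedPixel_subset q hy')
    have h2 := pow_le_pow_left₀ (abs_nonneg _) h1 2
    rwa [mul_pow, Real.sq_sqrt (by positivity)] at h2
  calc _ ≤ ∑ p : Fin K × Fin K, ∑ q : Fin K × Fin K, L ^ 2 * (4 / (3 * (K : ℝ) ^ 6)) :=
        Finset.sum_le_sum fun p _ => Finset.sum_le_sum fun q _ => hbox p q
    _ = 4 / 3 * L ^ 2 / (K : ℝ) ^ 2 := by
        simp
        field_simp

theorem inner_contOp (M : Fin K → Fin K → ℝ) (x : L2I) :
    ⟪contOp M x, x⟫ = ∑ i, ∑ k, M i k * ⟪cellInd K i, x⟫ * ⟪cellInd K k, x⟫ := by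
  simp only [contOp, sum_apply, smul_apply, InnerProductSpace.rankOne_apply, sum_inner,
    inner_smul_left]
  refine Finset.sum_congr rfl fun i _ => Finset.sum_congr rfl fun k _ => ?_
  simp; ring

theorem inner_contOpTensor_tensorFun (M₁ M₂ : Fin K → Fin K → ℝ) (x y : L2I) :
    ⟪contOpTensor M₁ M₂ (tensorFun x y), tensorFun x y⟫ =
      ∑ i, ∑ j, ∑ k, ∑ l, M₁ i k * M₂ j l * (⟪cellInd K i, x⟫ * ⟪cellInd K k, x⟫) *
        (⟪cellInd K j, y⟫ * ⟪cellInd K l, y⟫) := by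
  rw [isTensorOp_contOpTensor, inner_tensorFun, inner_contOp, inner_contOp, Finset.sum_mul_sum]
  refine Finset.sum_congr rfl fun i _ => Finset.sum_congr rfl fun j _ => ?_
  rw [Finset.sum_mul_sum]
  refine Finset.sum_congr rfl fun k _ => Finset.sum_congr rfl fun l _ => ?_
  ring

end Step

/-! ### Averages over rectangles -/

section Rectangles

/-- Mean value theorem in a form that asks only for monotone bounds on `I`, so that it applies to
iterated integrals known through almost-everywhere identities. -/
theorem exists_eq_mul_of_forall_bounds {X : Type*} [TopologicalSpace X] {s : Set X}
    (hc : IsCompact s) (hp : IsPreconnected s) (hne : s.Nonempty) {c : X → ℝ}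
    (hcont : ContinuousOn c s) {V I : ℝ} (hV : 0 < V)
    (hl : ∀ m, (∀ y ∈ s, m ≤ c y) → m * V ≤ I) (hu : ∀ m, (∀ y ∈ s, c y ≤ m) → I ≤ m * V) :
    ∃ y ∈ s, I = c y * V := by
  obtain ⟨x, hx, hmin⟩ := hc.exists_isMinOn hne hcont
  obtain ⟨z, hz, hmax⟩ := hc.exists_isMaxOn hne hcont
  have h1 := hl (c x) fun y hy => hmin hy
  have h2 := hu (c z) fun y hy => hmax hy
  obtain ⟨y, hy, hyI⟩ := hp.intermediate_value hx hz hcont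
    (show I / V ∈ Icc (c x) (c z) from ⟨(le_div_iff₀ hV).2 h1, (div_le_iff₀ hV).2 h2⟩)
  exact ⟨y, hy, by rw [hyI]; field_simp⟩

theorem mul_measureReal_le_setIntegral {α : Type*} [MeasurableSpace α] {μ : Measure α}
    [IsFiniteMeasure μ] {s : Set α} (hs : MeasurableSet s) {f : α → ℝ} (hf : IntegrableOn f s μ)
    {m : ℝ} (h : ∀ᵐ x ∂μ, x ∈ s → m ≤ f x) : m * μ.real s ≤ ∫ x in s, f x ∂μ := by
  have h1 := setIntegral_mono_on_ae (integrableOn_const (C := m) (measure_ne_top μ s)) hf hs h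
  simpa [mul_comm] using h1

theorem setIntegral_le_mul_measureReal {α : Type*} [MeasurableSpace α] {μ : Measure α}
    [IsFiniteMeasure μ] {s : Set α} (hs : MeasurableSet s) {f : α → ℝ} (hf : IntegrableOn f s μ)
    {m : ℝ} (h : ∀ᵐ x ∂μ, x ∈ s → f x ≤ m) : ∫ x in s, f x ∂μ ≤ m * μ.real s := by
  have h1 := setIntegral_mono_on_ae hf (integrableOn_const (C := m) (measure_ne_top μ s)) hs h
  simpa [mul_comm] using h1

theorem setIntegral_eq_inner_rect (u v u' v' : ℝ) (f : L2Q) :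
    ⟪tensorFun (icoInd u v) (icoInd u' v'), f⟫ =
      ∫ x in Ico u v ×ˢ Ico u' v', f x ∂squareMeasure := by
  rw [L2.inner_def, ← integral_indicator (measurableSet_Ico.prod measurableSet_Ico)]
  refine integral_congr_ae ?_
  filter_upwards [tensorFun_icoInd_ae u v u' v'] with x hx
  rw [hx]
  simp only [indicator]
  split_ifs <;> simp

theorem squareMeasure_real_rect {u v u' v' : ℝ} (hu : 0 ≤ u) (huv : u ≤ v) (hv : v ≤ 1)
    (hu' : 0 ≤ u') (huv' : u' ≤ v') (hv' : v' ≤ 1) :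
    squareMeasure.real (Ico u v ×ˢ Ico u' v') = (v - u) * (v' - u') := by
  have h : ∀ r r' : ℝ, 0 ≤ r → r ≤ r' → r' ≤ 1 → unitMeasure.real (Ico r r') = r' - r := by
    intro r r' h1 h2 h3
    rw [measureReal_restrict_apply measurableSet_Ico, inter_eq_left.2, Real.volume_real_Ico_of_le h2]
    exact Ico_subset_Icc_self.trans (Icc_subset_Icc h1 h3)
  rw [measureReal_prod_prod, h u v hu huv hv, h u' v' hu' huv' hv']

theorem LipschitzKernel.continuousOn {L : ℝ} {a : ℝ × ℝ → ℝ × ℝ → ℝ} (h : LipschitzKernel L a) :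
    ContinuousOn (fun z : (ℝ × ℝ) × (ℝ × ℝ) => a z.1 z.2) (unitSquare ×ˢ unitSquare) := by
  intro z hz
  rw [ContinuousWithinAt, tendsto_iff_dist_tendsto_zero]
  have hlim : Tendsto (fun w : (ℝ × ℝ) × (ℝ × ℝ) => L * Real.sqrt ((w.1.1 - z.1.1) ^ 2 +
      (w.1.2 - z.1.2) ^ 2 + (w.2.1 - z.2.1) ^ 2 + (w.2.2 - z.2.2) ^ 2))
      (𝓝[unitSquare ×ˢ unitSquare] z) (𝓝 0) := by
    have hcont : Continuous fun w : (ℝ × ℝ) × (ℝ × ℝ) => L * Real.sqrt ((w.1.1 - z.1.1) ^ 2 +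
      (w.1.2 - z.1.2) ^ 2 + (w.2.1 - z.2.1) ^ 2 + (w.2.2 - z.2.2) ^ 2) := by fun_prop
    have := hcont.tendsto z
    simp only [sub_self] at this
    norm_num at this
    exact this.mono_left nhdsWithin_le_nhds
  refine squeeze_zero' (Eventually.of_forall fun _ => dist_nonneg) ?_ hlim
  filter_upwards [self_mem_nhdsWithin] with w hw
  exact h w.1 hw.1 w.2 hw.2 z.1 hz.1 z.2 hz.2

theorem exists_inner_rect_eq {F : ℝ × ℝ → ℝ} (hF : ContinuousOn F unitSquare) {f : L2Q}
    (hf : f =ᵐ[squareMeasure] F) {u v u' v' : ℝ} (hu : 0 ≤ u) (huv : u < v) (hv : v ≤ 1)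
    (hu' : 0 ≤ u') (huv' : u' < v') (hv' : v' ≤ 1) :
    ∃ y ∈ Icc u v ×ˢ Icc u' v', ⟪tensorFun (icoInd u v) (icoInd u' v'), f⟫ =
      F y * ((v - u) * (v' - u')) := by
  have hsub : Icc u v ×ˢ Icc u' v' ⊆ unitSquare :=
    prod_mono (Icc_subset_Icc hu hv) (Icc_subset_Icc hu' hv')
  have hmem : ∀ x ∈ Ico u v ×ˢ Ico u' v', x ∈ Icc u v ×ˢ Icc u' v' := fun x hx =>
    prod_mono Ico_subset_Icc_self Ico_subset_Icc_self hx
  have hR : MeasurableSet (Ico u v ×ˢ Ico u' v') := measurableSet_Ico.prod measurableSet_Ico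
  have hint : Integrable f squareMeasure := (Lp.memLp f).integrable (by norm_num)
  refine exists_eq_mul_of_forall_bounds (isCompact_Icc.prod isCompact_Icc)
    (isPreconnected_Icc.prod isPreconnected_Icc)
    ((nonempty_Icc.2 huv.le).prod (nonempty_Icc.2 huv'.le)) (hF.mono hsub)
    (mul_pos (sub_pos.2 huv) (sub_pos.2 huv')) (fun m hm => ?_) fun m hm => ?_
  · rw [setIntegral_eq_inner_rect, ← squareMeasure_real_rect hu huv.le hv hu' huv'.le hv']
    refine mul_measureReal_le_setIntegral hR hint.integrableOn ?_
    filter_upwards [hf] with x hx hxR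
    rw [hx]; exact hm x (hmem x hxR)
  · rw [setIntegral_eq_inner_rect, ← squareMeasure_real_rect hu huv.le hv hu' huv'.le hv']
    refine setIntegral_le_mul_measureReal hR hint.integrableOn ?_
    filter_upwards [hf] with x hx hxR
    rw [hx]; exact hm x (hmem x hxR)

theorem HasKernel.apply_rect_ae {A : L2Q →L[ℝ] L2Q} {a : ℝ × ℝ → ℝ × ℝ → ℝ}
    (ha : HasKernel A a) (w z w' z' : ℝ) :
    ∀ᵐ x ∂squareMeasure, MemLp (a x) 2 squareMeasure ∧
      A (tensorFun (icoInd w z) (icoInd w' z')) x =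
        ∫ y in Ico w z ×ˢ Ico w' z', a x y ∂squareMeasure := by
  filter_upwards [ha.2 (tensorFun (icoInd w z) (icoInd w' z')), ha.ae_memLp] with x hx hx2
  refine ⟨hx2, ?_⟩
  rw [hx, ← integral_indicator (measurableSet_Ico.prod measurableSet_Ico)]
  refine integral_congr_ae ?_
  filter_upwards [tensorFun_icoInd_ae w z w' z'] with y hy
  rw [hy]
  simp only [indicator]
  split_ifs <;> simp

/-- Averaging the continuous kernel over a product of rectangles gives one of its values, by
bounding the inner and then the outer integral. The sampled covariances of the separable part
thereby become kernel values. -/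
theorem HasKernel.exists_inner_rect_eq {A : L2Q →L[ℝ] L2Q} {a : ℝ × ℝ → ℝ × ℝ → ℝ}
    (ha : HasKernel A a)
    (hcont : ContinuousOn (fun z : (ℝ × ℝ) × (ℝ × ℝ) => a z.1 z.2) (unitSquare ×ˢ unitSquare))
    {u v u' v' w z w' z' : ℝ} (hu : 0 ≤ u) (huv : u < v) (hv : v ≤ 1)
    (hu' : 0 ≤ u') (huv' : u' < v') (hv' : v' ≤ 1) (hw : 0 ≤ w) (hwz : w < z) (hz : z ≤ 1)
    (hw' : 0 ≤ w') (hwz' : w' < z') (hz' : z' ≤ 1) :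
    ∃ y ∈ Icc u v ×ˢ Icc u' v', ∃ y' ∈ Icc w z ×ˢ Icc w' z',
      ⟪tensorFun (icoInd u v) (icoInd u' v'), A (tensorFun (icoInd w z) (icoInd w' z'))⟫ =
        a y y' * (((v - u) * (v' - u')) * ((z - w) * (z' - w'))) := by
  set R := Icc u v ×ˢ Icc u' v' with hRdef
  set R' := Icc w z ×ˢ Icc w' z' with hRdef'
  have hsub : R ⊆ unitSquare := prod_mono (Icc_subset_Icc hu hv) (Icc_subset_Icc hu' hv')
  have hsub' : R' ⊆ unitSquare := prod_mono (Icc_subset_Icc hw hz) (Icc_subset_Icc hw' hz')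
  have hmem : ∀ x ∈ Ico u v ×ˢ Ico u' v', x ∈ R := fun x hx =>
    prod_mono Ico_subset_Icc_self Ico_subset_Icc_self hx
  have hmem' : ∀ x ∈ Ico w z ×ˢ Ico w' z', x ∈ R' := fun x hx =>
    prod_mono Ico_subset_Icc_self Ico_subset_Icc_self hx
  have hR : MeasurableSet (Ico u v ×ˢ Ico u' v') := measurableSet_Ico.prod measurableSet_Ico
  have hR' : MeasurableSet (Ico w z ×ˢ Ico w' z') := measurableSet_Ico.prod measurableSet_Ico
  set g := A (tensorFun (icoInd w z) (icoInd w' z')) with hg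
  have hint : Integrable g squareMeasure := (Lp.memLp g).integrable (by norm_num)
  have hap := ha.apply_rect_ae w z w' z'
  have key := exists_eq_mul_of_forall_bounds (s := R ×ˢ R')
    (c := fun z : (ℝ × ℝ) × (ℝ × ℝ) => a z.1 z.2)
    (V := ((v - u) * (v' - u')) * ((z - w) * (z' - w')))
    (I := ⟪tensorFun (icoInd u v) (icoInd u' v'), g⟫)
    ((isCompact_Icc.prod isCompact_Icc).prod (isCompact_Icc.prod isCompact_Icc))
    ((isPreconnected_Icc.prod isPreconnected_Icc).prod (isPreconnected_Icc.prod isPreconnected_Icc))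
    (((nonempty_Icc.2 huv.le).prod (nonempty_Icc.2 huv'.le)).prod
      ((nonempty_Icc.2 hwz.le).prod (nonempty_Icc.2 hwz'.le)))
    (hcont.mono (prod_mono hsub hsub'))
    (mul_pos (mul_pos (sub_pos.2 huv) (sub_pos.2 huv'))
      (mul_pos (sub_pos.2 hwz) (sub_pos.2 hwz'))) (fun m hm => ?_) fun m hm => ?_
  · obtain ⟨y, hy, heq⟩ := key
    exact ⟨y.1, hy.1, y.2, hy.2, heq⟩
  · rw [setIntegral_eq_inner_rect, ← squareMeasure_real_rect hu huv.le hv hu' huv'.le hv',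
      ← squareMeasure_real_rect hw hwz.le hz hw' hwz'.le hz',
      mul_comm (squareMeasure.real (Ico u v ×ˢ Ico u' v')), ← mul_assoc]
    refine mul_measureReal_le_setIntegral hR hint.integrableOn ?_
    filter_upwards [hap] with x ⟨h1, h2⟩ hxR
    rw [h2]
    exact mul_measureReal_le_setIntegral hR' (h1.integrable (by norm_num)).integrableOn
      (Eventually.of_forall fun y hy => hm (x, y) ⟨hmem x hxR, hmem' y hy⟩)
  · rw [setIntegral_eq_inner_rect, ← squareMeasure_real_rect hu huv.le hv hu' huv'.le hv',
      ← squareMeasure_real_rect hw hwz.le hz hw' hwz'.le hz',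
      mul_comm (squareMeasure.real (Ico u v ×ˢ Ico u' v')), ← mul_assoc]
    refine setIntegral_le_mul_measureReal hR hint.integrableOn ?_
    filter_upwards [hap] with x ⟨h1, h2⟩ hxR
    rw [h2]
    exact setIntegral_le_mul_measureReal hR' (h1.integrable (by norm_num)).integrableOn
      (Eventually.of_forall fun y hy => hm (x, y) ⟨hmem x hxR, hmem' y hy⟩)

/-- The kernel vanishes only almost everywhere, so the band condition is usable on averages over
rectangles but not at points. -/
theorem IsBanded.inner_rect_eq_zero {B : L2Q →L[ℝ] L2Q} {δ : ℝ} (hB : IsBanded B δ)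
    {u v u' v' w z w' z' : ℝ}
    (h : ∀ x ∈ Ico u v ×ˢ Ico u' v', ∀ y ∈ Ico w z ×ˢ Ico w' z',
      δ ≤ max |x.1 - y.1| |x.2 - y.2|) :
    ⟪tensorFun (icoInd u v) (icoInd u' v'), B (tensorFun (icoInd w z) (icoInd w' z'))⟫ = 0 := by
  obtain ⟨b, hb, hb0⟩ := hB
  rw [setIntegral_eq_inner_rect]
  refine setIntegral_eq_zero_of_ae_eq_zero ?_
  filter_upwards [hb.apply_rect_ae w z w' z', Measure.ae_ae_of_ae_prod hb0] with x ⟨_, h2⟩ h3 hx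
  rw [h2]
  refine setIntegral_eq_zero_of_ae_eq_zero ?_
  filter_upwards [h3] with y hy hyR
  exact hy (h x hx y hyR)

end Rectangles

/-! ### Local averages -/

section LocalAverages

/-- The image of `l` under the contraction by the factor `θ` towards `τ`. -/
def shrink (l τ θ : ℝ) : ℝ := τ + θ * (l - τ)

/-- The normalized indicator of the interval `[l, r)`, contracted by the factor `θ` towards `τ`. -/
def localInd (l r τ θ : ℝ) : L2I :=
  (θ * (r - l))⁻¹ • icoInd (shrink l τ θ) (shrink r τ θ)

variable {l r τ θ l' r' τ' : ℝ}

theorem shrink_sub_shrink (l r τ θ : ℝ) : shrink r τ θ - shrink l τ θ = θ * (r - l) := by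
  simp only [shrink]; ring

theorem shrink_lt_shrink (hlr : l < r) (hθ : 0 < θ) : shrink l τ θ < shrink r τ θ := by
  have := shrink_sub_shrink l r τ θ
  nlinarith [mul_pos hθ (sub_pos.2 hlr)]

theorem le_shrink (hτ : τ ∈ Icc l r) (hθ1 : θ ≤ 1) : l ≤ shrink l τ θ := by
  simp only [shrink]
  nlinarith [mul_nonneg (sub_nonneg.2 hθ1) (sub_nonneg.2 hτ.1)]

theorem shrink_le (hτ : τ ∈ Icc l r) (hθ1 : θ ≤ 1) : shrink r τ θ ≤ r := by
  simp only [shrink]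
  nlinarith [mul_nonneg (sub_nonneg.2 hθ1) (sub_nonneg.2 hτ.2)]

theorem Icc_shrink_subset (hτ : τ ∈ Icc l r) (hθ1 : θ ≤ 1) :
    Icc (shrink l τ θ) (shrink r τ θ) ⊆ Icc l r :=
  Icc_subset_Icc (le_shrink hτ hθ1) (shrink_le hτ hθ1)

theorem abs_sub_le_of_mem_shrink (hτ : τ ∈ Icc l r) (hθ : 0 < θ) {y : ℝ}
    (hy : y ∈ Icc (shrink l τ θ) (shrink r τ θ)) : |y - τ| ≤ θ * (r - l) := by
  obtain ⟨h1, h2⟩ := hy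
  simp only [shrink] at h1 h2
  rw [abs_le]
  constructor <;> nlinarith [hτ.1, hτ.2, mul_nonneg hθ.le (sub_nonneg.2 hτ.1),
    mul_nonneg hθ.le (sub_nonneg.2 hτ.2)]

/-- The normalized indicator of the rectangle `[l, r) × [l', r')`, contracted towards `τ`. -/
def localRect (l r l' r' : ℝ) (τ : ℝ × ℝ) (θ : ℝ) : L2Q :=
  tensorFun (localInd l r τ.1 θ) (localInd l' r' τ.2 θ)

theorem localRect_eq (l r l' r' : ℝ) (τ : ℝ × ℝ) (θ : ℝ) :
    localRect l r l' r' τ θ = ((θ * (r - l))⁻¹ * (θ * (r' - l'))⁻¹) •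
      tensorFun (icoInd (shrink l τ.1 θ) (shrink r τ.1 θ))
        (icoInd (shrink l' τ.2 θ) (shrink r' τ.2 θ)) := by
  rw [localRect, localInd, localInd, tensorFun_smul_left, tensorFun_smul_right, smul_smul]

/-- The closed rectangle on which `localRect` lives. -/
def shrinkRect (l r l' r' : ℝ) (τ : ℝ × ℝ) (θ : ℝ) : Set (ℝ × ℝ) :=
  Icc (shrink l τ.1 θ) (shrink r τ.1 θ) ×ˢ Icc (shrink l' τ.2 θ) (shrink r' τ.2 θ)

theorem exists_inner_localRect_eq {F : ℝ × ℝ → ℝ} (hF : ContinuousOn F unitSquare) {f : L2Q}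
    (hf : f =ᵐ[squareMeasure] F) {τ : ℝ × ℝ} (hl : 0 ≤ l) (hlr : l < r) (hr : r ≤ 1)
    (hl' : 0 ≤ l') (hlr' : l' < r') (hr' : r' ≤ 1) (hτ : τ.1 ∈ Icc l r) (hτ' : τ.2 ∈ Icc l' r')
    (hθ : 0 < θ) (hθ1 : θ ≤ 1) :
    ∃ y ∈ shrinkRect l r l' r' τ θ, ⟪localRect l r l' r' τ θ, f⟫ = F y := by
  obtain ⟨y, hy, heq⟩ := exists_inner_rect_eq hF hf (hl.trans (le_shrink hτ hθ1))
    (shrink_lt_shrink hlr hθ) ((shrink_le hτ hθ1).trans hr) (hl'.trans (le_shrink hτ' hθ1))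
    (shrink_lt_shrink hlr' hθ) ((shrink_le hτ' hθ1).trans hr')
  refine ⟨y, hy, ?_⟩
  rw [localRect_eq, inner_smul_left, heq, shrink_sub_shrink, shrink_sub_shrink]
  have h1 := sub_pos.2 hlr
  have h2 := sub_pos.2 hlr'
  simp only [conj_trivial]
  field_simp

theorem HasKernel.exists_inner_localRect_eq {A : L2Q →L[ℝ] L2Q} {a : ℝ × ℝ → ℝ × ℝ → ℝ}
    (ha : HasKernel A a)
    (hcont : ContinuousOn (fun z : (ℝ × ℝ) × (ℝ × ℝ) => a z.1 z.2) (unitSquare ×ˢ unitSquare))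
    {m q m' q' : ℝ} {τ σ : ℝ × ℝ} (hl : 0 ≤ l) (hlr : l < r) (hr : r ≤ 1)
    (hl' : 0 ≤ l') (hlr' : l' < r') (hr' : r' ≤ 1) (hτ : τ.1 ∈ Icc l r) (hτ' : τ.2 ∈ Icc l' r')
    (hm : 0 ≤ m) (hmq : m < q) (hq : q ≤ 1)
    (hm' : 0 ≤ m') (hmq' : m' < q') (hq' : q' ≤ 1) (hσ : σ.1 ∈ Icc m q) (hσ' : σ.2 ∈ Icc m' q')
    (hθ : 0 < θ) (hθ1 : θ ≤ 1) :
    ∃ y ∈ shrinkRect l r l' r' τ θ, ∃ y' ∈ shrinkRect m q m' q' σ θ,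
      ⟪localRect l r l' r' τ θ, A (localRect m q m' q' σ θ)⟫ = a y y' := by
  obtain ⟨y, hy, y', hy', heq⟩ := ha.exists_inner_rect_eq hcont (hl.trans (le_shrink hτ hθ1))
    (shrink_lt_shrink hlr hθ) ((shrink_le hτ hθ1).trans hr) (hl'.trans (le_shrink hτ' hθ1))
    (shrink_lt_shrink hlr' hθ) ((shrink_le hτ' hθ1).trans hr') (hm.trans (le_shrink hσ hθ1))
    (shrink_lt_shrink hmq hθ) ((shrink_le hσ hθ1).trans hq) (hm'.trans (le_shrink hσ' hθ1))
    (shrink_lt_shrink hmq' hθ) ((shrink_le hσ' hθ1).trans hq')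
  refine ⟨y, hy, y', hy', ?_⟩
  rw [localRect_eq, localRect_eq, map_smul, inner_smul_left, inner_smul_right, heq,
    shrink_sub_shrink, shrink_sub_shrink, shrink_sub_shrink, shrink_sub_shrink]
  have h1 := sub_pos.2 hlr
  have h2 := sub_pos.2 hlr'
  have h3 := sub_pos.2 hmq
  have h4 := sub_pos.2 hmq'
  simp only [conj_trivial]
  field_simp

theorem IsBanded.inner_localRect_eq_zero {B : L2Q →L[ℝ] L2Q} {δ : ℝ} (hB : IsBanded B δ)
    {m q m' q' : ℝ} {τ σ : ℝ × ℝ} (hτ : τ.1 ∈ Icc l r) (hτ' : τ.2 ∈ Icc l' r')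
    (hσ : σ.1 ∈ Icc m q) (hσ' : σ.2 ∈ Icc m' q') (hθ1 : θ ≤ 1)
    (h : r + δ ≤ m ∨ r' + δ ≤ m') :
    ⟪localRect l r l' r' τ θ, B (localRect m q m' q' σ θ)⟫ = 0 := by
  rw [localRect_eq, localRect_eq, map_smul, inner_smul_left, inner_smul_right,
    hB.inner_rect_eq_zero, mul_zero, mul_zero]
  intro x hx y hy
  rcases h with h | h
  · refine le_max_of_le_left ?_
    have h1 := hx.1.2.le.trans (shrink_le hτ hθ1)
    have h2 := (le_shrink hσ hθ1).trans hy.1.1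
    rw [abs_sub_comm]
    exact le_trans (by linarith) (le_abs_self _)
  · refine le_max_of_le_right ?_
    have h1 := hx.2.2.le.trans (shrink_le hτ' hθ1)
    have h2 := (le_shrink hσ' hθ1).trans hy.2.1
    rw [abs_sub_comm]
    exact le_trans (by linarith) (le_abs_self _)

/-- The contraction factors `1 / (m + 1)`. -/
def contraction (m : ℕ) : ℝ := 1 / ((m : ℝ) + 1)

theorem contraction_pos (m : ℕ) : 0 < contraction m := Nat.one_div_pos_of_nat

theorem contraction_le_one (m : ℕ) : contraction m ≤ 1 := by
  rw [contraction, div_le_one (by positivity)]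
  linarith [Nat.cast_nonneg (α := ℝ) m]

theorem tendsto_of_mem_shrinkRect {τ : ℝ × ℝ} (hτ : τ.1 ∈ Icc l r) (hτ' : τ.2 ∈ Icc l' r')
    {y : ℕ → ℝ × ℝ} (hy : ∀ m, y m ∈ shrinkRect l r l' r' τ (contraction m)) :
    Tendsto y atTop (𝓝 τ) := by
  have hlim : ∀ c : ℝ, Tendsto (fun m => contraction m * c) atTop (𝓝 0) := fun c => by
    have := (tendsto_one_div_add_atTop_nhds_zero_nat (𝕜 := ℝ)).mul_const c
    rwa [zero_mul] at this
  rw [nhds_prod_eq]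
  refine Tendsto.prodMk ?_ ?_ |>.congr fun m => Prod.mk.eta
  · rw [tendsto_iff_dist_tendsto_zero]
    exact squeeze_zero (fun m => dist_nonneg)
      (fun m => abs_sub_le_of_mem_shrink hτ (contraction_pos m) (hy m).1) (hlim _)
  · rw [tendsto_iff_dist_tendsto_zero]
    exact squeeze_zero (fun m => dist_nonneg)
      (fun m => abs_sub_le_of_mem_shrink hτ' (contraction_pos m) (hy m).2) (hlim _)

theorem shrinkRect_subset {τ : ℝ × ℝ} (hl : 0 ≤ l) (hr : r ≤ 1) (hl' : 0 ≤ l') (hr' : r' ≤ 1)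
    (hτ : τ.1 ∈ Icc l r) (hτ' : τ.2 ∈ Icc l' r') (hθ1 : θ ≤ 1) :
    shrinkRect l r l' r' τ θ ⊆ unitSquare :=
  prod_mono ((Icc_shrink_subset hτ hθ1).trans (Icc_subset_Icc hl hr))
    ((Icc_shrink_subset hτ' hθ1).trans (Icc_subset_Icc hl' hr'))

/-- Point evaluation is not a functional on `L²`. It is recovered as a limit of averages over
rectangles contracting to the sampling point; these never leave the original pixel, so separation
from the band survives. -/
theorem tendsto_inner_localRect {F : ℝ × ℝ → ℝ} (hF : ContinuousOn F unitSquare) {f : L2Q}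
    (hf : f =ᵐ[squareMeasure] F) {τ : ℝ × ℝ} (hl : 0 ≤ l) (hlr : l < r) (hr : r ≤ 1)
    (hl' : 0 ≤ l') (hlr' : l' < r') (hr' : r' ≤ 1) (hτ : τ.1 ∈ Icc l r) (hτ' : τ.2 ∈ Icc l' r') :
    Tendsto (fun m => ⟪localRect l r l' r' τ (contraction m), f⟫) atTop (𝓝 (F τ)) := by
  choose y hy heq using fun m => exists_inner_localRect_eq hF hf hl hlr hr hl' hlr' hr' hτ hτ'
    (contraction_pos m) (contraction_le_one m)
  simp only [heq]
  have hτs : τ ∈ unitSquare := ⟨Icc_subset_Icc hl hr hτ, Icc_subset_Icc hl' hr' hτ'⟩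
  refine (hF τ hτs).tendsto.comp (tendsto_nhdsWithin_iff.2
    ⟨tendsto_of_mem_shrinkRect hτ hτ' hy, Eventually.of_forall fun m => ?_⟩)
  exact shrinkRect_subset hl hr hl' hr' hτ hτ' (contraction_le_one m) (hy m)

end LocalAverages

/-! ### Uniform integrability -/

/-- Vitali's theorem with bounded second moments: `|h n - h₀|` is at most its truncation at `R` plus
`|h n - h₀|² / R`. Dominated convergence handles the first part, and the second is uniformly of
order `1/R`. -/
theorem tendsto_integral_of_sq_le {Ω : Type*} [MeasurableSpace Ω] {P : Measure Ω}
    [IsProbabilityMeasure P] {h : ℕ → Ω → ℝ} {h₀ : Ω → ℝ} {S : ℝ} (hm : ∀ n, MemLp (h n) 2 P)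
    (hm₀ : MemLp h₀ 2 P) (hS : ∀ n, ∫ ω, h n ω ^ 2 ∂P ≤ S)
    (hlim : ∀ᵐ ω ∂P, Tendsto (fun n => h n ω) atTop (𝓝 (h₀ ω))) :
    Tendsto (fun n => ∫ ω, h n ω ∂P) atTop (𝓝 (∫ ω, h₀ ω ∂P)) := by
  set C := 2 * S + 2 * ∫ ω, h₀ ω ^ 2 ∂P with hC
  have hi : ∀ n, Integrable (h n) P := fun n => (hm n).integrable (by norm_num)
  have hi₀ : Integrable h₀ P := hm₀.integrable (by norm_num)
  have htrunc : ∀ R : ℝ, 0 < R →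
      Tendsto (fun n => ∫ ω, min |h n ω - h₀ ω| R ∂P) atTop (𝓝 0) := by
    intro R hR
    have : Tendsto (fun n => ∫ ω, min |h n ω - h₀ ω| R ∂P) atTop (𝓝 (∫ _, (0 : ℝ) ∂P)) := by
      refine tendsto_integral_of_dominated_convergence (fun _ => R)
        (fun n => ?_) (integrable_const R) (fun n => ?_) ?_
      · exact (((hi n).sub hi₀).abs.1.inf aestronglyMeasurable_const)
      · refine Eventually.of_forall fun ω => ?_
        rw [Real.norm_eq_abs, abs_of_nonneg (le_min (abs_nonneg _) hR.le)]
        exact min_le_right _ _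
      · filter_upwards [hlim] with ω hω
        have h1 : Tendsto (fun n => |h n ω - h₀ ω|) atTop (𝓝 0) := by
          have := (hω.sub_const (h₀ ω)).abs
          simpa using this
        have := h1.min (tendsto_const_nhds (x := R))
        rwa [min_eq_left hR.le] at this
    simpa using this
  have hbound : ∀ R : ℝ, 0 < R → ∀ n,
      |∫ ω, h n ω ∂P - ∫ ω, h₀ ω ∂P| ≤ ∫ ω, min |h n ω - h₀ ω| R ∂P + C / R := by
    intro R hR n
    rw [← integral_sub (hi n) hi₀]
    refine abs_integral_le_integral_abs.trans ?_
    have hmin : Integrable (fun ω => min |h n ω - h₀ ω| R) P :=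
      ((hi n).sub hi₀).abs.inf (integrable_const R)
    have hsq : Integrable (fun ω => (2 * h n ω ^ 2 + 2 * h₀ ω ^ 2) / R) P :=
      (((hm n).integrable_sq.const_mul 2).add (hm₀.integrable_sq.const_mul 2)).div_const R
    calc ∫ ω, |h n ω - h₀ ω| ∂P
        ≤ ∫ ω, (min |h n ω - h₀ ω| R + (2 * h n ω ^ 2 + 2 * h₀ ω ^ 2) / R) ∂P := by
          refine integral_mono ((hi n).sub hi₀).abs (hmin.add hsq) fun ω => ?_
          simp only
          rcases le_total |h n ω - h₀ ω| R with h1 | h1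
          · rw [min_eq_left h1]
            have : 0 ≤ (2 * h n ω ^ 2 + 2 * h₀ ω ^ 2) / R := by positivity
            linarith
          · rw [min_eq_right h1]
            have h2 : |h n ω - h₀ ω| ≤ (2 * h n ω ^ 2 + 2 * h₀ ω ^ 2) / R := by
              rw [le_div_iff₀ hR]
              have h3 := sq_abs (h n ω - h₀ ω)
              nlinarith [sq_nonneg (h n ω + h₀ ω), abs_nonneg (h n ω - h₀ ω)]
            linarith
      _ = ∫ ω, min |h n ω - h₀ ω| R ∂P +
          (2 * ∫ ω, h n ω ^ 2 ∂P + 2 * ∫ ω, h₀ ω ^ 2 ∂P) / R := by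
          rw [integral_add hmin hsq, integral_div, integral_add ((hm n).integrable_sq.const_mul 2)
            (hm₀.integrable_sq.const_mul 2), integral_const_mul, integral_const_mul]
      _ ≤ _ := by
          rw [hC]
          gcongr
          exact hS n
  rw [Metric.tendsto_atTop]
  intro ε hε
  have hC0 : 0 ≤ C := by
    have h1 : 0 ≤ ∫ ω, h 0 ω ^ 2 ∂P := integral_nonneg fun _ => sq_nonneg _
    have h2 : 0 ≤ ∫ ω, h₀ ω ^ 2 ∂P := integral_nonneg fun _ => sq_nonneg _
    linarith [hS 0]
  set R := 2 * C / ε + 1 with hR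
  have hRpos : 0 < R := by positivity
  have hCR : C / R < ε / 2 := by
    rw [div_lt_iff₀ hRpos, hR]
    field_simp
    linarith
  obtain ⟨N, hN⟩ := (Metric.tendsto_atTop.1 (htrunc R hRpos)) (ε / 2) (by positivity)
  refine ⟨N, fun n hn => ?_⟩
  rw [Real.dist_eq]
  have h1 := hN n hn
  rw [Real.dist_eq, sub_zero] at h1
  linarith [hbound R hRpos n, le_abs_self (∫ ω, min |h n ω - h₀ ω| R ∂P)]

/-! ### Moments of local averages -/

section Moments

set_option linter.unusedSectionVars false

variable {Ω : Type*} [MeasurableSpace Ω] {P : Measure Ω} [IsProbabilityMeasure P]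

theorem integrable_pow_four_of_memLp {E : Type*} [NormedAddCommGroup E] {f : Ω → E}
    (hf : MemLp f 4 P) : Integrable (fun ω => ‖f ω‖ ^ 4) P := by
  simpa using hf.integrable_norm_pow (p := 4) (by norm_num)

theorem integrable_inner_pow_four {X : Ω → L2Q} (hX : MemLp X 4 P) (f : L2Q) :
    Integrable (fun ω => ⟪f, X ω⟫ ^ 4) P := by
  have h := integrable_pow_four_of_memLp ((innerSL ℝ f).comp_memLp' hX)
  refine h.congr (Eventually.of_forall fun ω => ?_)
  simp [(by decide : Even 4).pow_abs]

theorem memLp_two_mul_of_pow_four {u v : Ω → ℝ} (hu : AEStronglyMeasurable u P)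
    (hv : AEStronglyMeasurable v P) (hu4 : Integrable (fun ω => u ω ^ 4) P)
    (hv4 : Integrable (fun ω => v ω ^ 4) P) : MemLp (fun ω => u ω * v ω) 2 P := by
  refine (memLp_two_iff_integrable_sq (hu.mul hv)).2 ?_
  refine (hu4.add hv4).mono' ((hu.mul hv).pow 2) (Eventually.of_forall fun ω => ?_)
  simp only [Real.norm_eq_abs, Pi.add_apply, Pi.mul_apply]
  rw [abs_of_nonneg (sq_nonneg _)]
  nlinarith [sq_nonneg (u ω ^ 2 - v ω ^ 2), sq_nonneg (u ω ^ 2 + v ω ^ 2)]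

theorem integral_mul_sq_le_of_pow_four {u v : Ω → ℝ} (hu : AEStronglyMeasurable u P)
    (hv : AEStronglyMeasurable v P) (hu4 : Integrable (fun ω => u ω ^ 4) P)
    (hv4 : Integrable (fun ω => v ω ^ 4) P) {S : ℝ} (huS : ∫ ω, u ω ^ 4 ∂P ≤ S)
    (hvS : ∫ ω, v ω ^ 4 ∂P ≤ S) : ∫ ω, (u ω * v ω) ^ 2 ∂P ≤ S := by
  have h1 : ∫ ω, (u ω * v ω) ^ 2 ∂P ≤ ∫ ω, (u ω ^ 4 + v ω ^ 4) / 2 ∂P := by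
    refine integral_mono (memLp_two_mul_of_pow_four hu hv hu4 hv4).integrable_sq
      ((hu4.add hv4).div_const 2) fun ω => ?_
    simp only
    nlinarith [sq_nonneg (u ω ^ 2 - v ω ^ 2)]
  rw [integral_div, integral_add hu4 hv4] at h1
  linarith

/-- Jensen's inequality moves the fourth power inside the spatial average, and Fubini's theorem then
reduces the claim to the pointwise fourth moments. -/
theorem integral_inner_localRect_pow_four_le {Y : Ω → ℝ × ℝ → ℝ} {f : Ω → L2Q}
    (hfm : Measurable f) (hY : ∀ ω, ContinuousOn (Y ω) unitSquare)
    (hf : ∀ ω, f ω =ᵐ[squareMeasure] Y ω) (hYm : ∀ x ∈ unitSquare, Measurable fun ω => Y ω x)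
    {S : ℝ} (hS : ∀ x ∈ unitSquare, Integrable (fun ω => Y ω x ^ 4) P ∧ ∫ ω, Y ω x ^ 4 ∂P ≤ S)
    {l r l' r' θ : ℝ} {τ : ℝ × ℝ} (hl : 0 ≤ l) (hlr : l < r) (hr : r ≤ 1)
    (hl' : 0 ≤ l') (hlr' : l' < r') (hr' : r' ≤ 1) (hτ : τ.1 ∈ Icc l r) (hτ' : τ.2 ∈ Icc l' r')
    (hθ : 0 < θ) (hθ1 : θ ≤ 1) :
    Integrable (fun ω => ⟪localRect l r l' r' τ θ, f ω⟫ ^ 4) P ∧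
      ∫ ω, ⟪localRect l r l' r' τ θ, f ω⟫ ^ 4 ∂P ≤ S := by
  -- Composing with the projection onto the square extends every realization continuously to the
  -- plane, which yields joint measurability in space and outcome.
  set proj : ℝ × ℝ → ℝ × ℝ := fun x =>
    ((projIcc (0 : ℝ) 1 zero_le_one x.1 : ℝ), (projIcc (0 : ℝ) 1 zero_le_one x.2 : ℝ)) with hproj
  have hprojc : Continuous proj := by fun_prop
  have hprojm : ∀ x, proj x ∈ unitSquare := fun x =>
    ⟨(projIcc (0 : ℝ) 1 zero_le_one x.1).2, (projIcc (0 : ℝ) 1 zero_le_one x.2).2⟩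
  have hprojid : ∀ x ∈ unitSquare, proj x = x := fun x hx => by
    simp only [hproj]
    rw [projIcc_of_mem _ hx.1, projIcc_of_mem _ hx.2]
  set Z : ℝ × ℝ → Ω → ℝ := fun x ω => Y ω (proj x) with hZ
  have hZc : ∀ ω, Continuous fun x => Z x ω := fun ω =>
    (hY ω).comp_continuous hprojc hprojm
  have hZm : Measurable (Function.uncurry Z) :=
    measurable_uncurry_of_continuous_of_measurable hZc fun x => hYm _ (hprojm x)
  set R := Ico (shrink l τ.1 θ) (shrink r τ.1 θ) ×ˢ Ico (shrink l' τ.2 θ) (shrink r' τ.2 θ) with hR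
  have hRm : MeasurableSet R := measurableSet_Ico.prod measurableSet_Ico
  have hRreal : squareMeasure.real R = (θ * (r - l)) * (θ * (r' - l')) := by
    rw [hR, squareMeasure_real_rect (hl.trans (le_shrink hτ hθ1)) (shrink_lt_shrink hlr hθ).le
      ((shrink_le hτ hθ1).trans hr) (hl'.trans (le_shrink hτ' hθ1))
      (shrink_lt_shrink hlr' hθ).le ((shrink_le hτ' hθ1).trans hr'), shrink_sub_shrink,
      shrink_sub_shrink]
  have hRpos : 0 < squareMeasure.real R := by
    rw [hRreal]
    have h1 := sub_pos.2 hlr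
    have h2 := sub_pos.2 hlr'
    positivity
  have hR0 : squareMeasure R ≠ 0 := by
    intro h; rw [measureReal_def, h] at hRpos; simp at hRpos
  have hsupp : ∀ᵐ x ∂squareMeasure, x ∈ unitSquare := by
    rw [squareMeasure, Measure.prod_restrict]
    exact ae_restrict_mem (measurableSet_Icc.prod measurableSet_Icc)
  have hbdd : ∀ ω, ∃ c, ∀ x, |Z x ω| ≤ c := fun ω => by
    obtain ⟨c, hc⟩ := (isCompact_Icc.prod isCompact_Icc).exists_bound_of_continuousOn (hY ω)
    exact ⟨c, fun x => hc _ (hprojm x)⟩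
  have hZi : ∀ ω, Integrable (fun x => Z x ω) squareMeasure := fun ω => by
    obtain ⟨c, hc⟩ := hbdd ω
    exact Integrable.of_bound (hZc ω).aestronglyMeasurable c (Eventually.of_forall fun x => hc x)
  have hZi4 : ∀ ω, Integrable (fun x => Z x ω ^ 4) squareMeasure := fun ω => by
    obtain ⟨c, hc⟩ := hbdd ω
    refine Integrable.of_bound ((hZc ω).pow 4).aestronglyMeasurable (c ^ 4)
      (Eventually.of_forall fun x => ?_)
    rw [norm_pow, Real.norm_eq_abs]
    exact pow_le_pow_left₀ (abs_nonneg _) (hc x) 4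
  have havg : ∀ ω, ⟪localRect l r l' r' τ θ, f ω⟫ = ⨍ x in R, Z x ω ∂squareMeasure := fun ω => by
    rw [localRect_eq, inner_smul_left, setIntegral_eq_inner_rect, setAverage_eq, hRreal, smul_eq_mul,
      conj_trivial, ← mul_inv]
    congr 1
    refine setIntegral_congr_ae hRm ?_
    filter_upwards [hf ω, hsupp] with x hx hxs _
    rw [hx, hZ]
    simp only
    rw [hprojid x hxs]
  have hjensen : ∀ ω, ⟪localRect l r l' r' τ θ, f ω⟫ ^ 4 ≤
      ⨍ x in R, Z x ω ^ 4 ∂squareMeasure := fun ω => by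
    rw [havg]
    exact ((by decide : Even 4).convexOn_pow (𝕜 := ℝ)).map_set_average_le
      (continuous_pow 4).continuousOn isClosed_univ hR0 (measure_ne_top _ _)
      (Eventually.of_forall fun _ => mem_univ _) (hZi ω).integrableOn (hZi4 ω).integrableOn
  have hmeas : AEStronglyMeasurable (fun z : (ℝ × ℝ) × Ω => Z z.1 z.2 ^ 4)
      ((squareMeasure.restrict R).prod P) := (hZm.pow_const 4).aestronglyMeasurable
  have hinner : ∀ x, Integrable (fun ω => Z x ω ^ 4) P ∧ ∫ ω, Z x ω ^ 4 ∂P ≤ S := fun x =>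
    hS _ (hprojm x)
  have hprod : Integrable (fun z : (ℝ × ℝ) × Ω => Z z.1 z.2 ^ 4)
      ((squareMeasure.restrict R).prod P) := by
    rw [integrable_prod_iff hmeas]
    refine ⟨Eventually.of_forall fun x => (hinner x).1, ?_⟩
    refine Integrable.of_bound (hmeas.norm.integral_prod_right') S (Eventually.of_forall fun x => ?_)
    rw [Real.norm_eq_abs, abs_of_nonneg (integral_nonneg fun _ => norm_nonneg _)]
    refine le_of_eq_of_le (integral_congr_ae (Eventually.of_forall fun ω => ?_)) (hinner x).2
    simp only [norm_pow, Real.norm_eq_abs, (by decide : Even 4).pow_abs]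
  have hG : Integrable (fun ω => ⨍ x in R, Z x ω ^ 4 ∂squareMeasure) P := by
    simp only [setAverage_eq]
    exact hprod.integral_prod_right.const_mul _
  have hint : Integrable (fun ω => ⟪localRect l r l' r' τ θ, f ω⟫ ^ 4) P := by
    refine hG.mono' ?_ (Eventually.of_forall fun ω => ?_)
    · exact (((innerSL ℝ (localRect l r l' r' τ θ)).continuous.measurable.comp
        hfm).pow_const 4).aestronglyMeasurable
    · rw [Real.norm_eq_abs, abs_of_nonneg ((by decide : Even 4).pow_nonneg _)]
      exact hjensen ω
  refine ⟨hint, (integral_mono hint hG hjensen).trans ?_⟩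
  simp only [setAverage_eq, smul_eq_mul]
  rw [integral_const_mul, ← integral_integral_swap (f := fun x ω => Z x ω ^ 4) hprod, inv_mul_le_iff₀ hRpos, mul_comm]
  have h1 := setIntegral_le_mul_measureReal (μ := squareMeasure) hRm
    (f := fun x => ∫ ω, Z x ω ^ 4 ∂P) (m := S) hprod.integral_prod_left
    (Eventually.of_forall fun x _ => (hinner x).2)
  exact h1

end Moments

/-! ### Separable tensors -/

/-- The tensor is, up to limits, a product `u i k * v j l` of symmetric positive semi-definite
matrices. -/
structure IsSeparableTensor {K : ℕ} (α : Fin K → Fin K → Fin K → Fin K → ℝ) : Prop where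
  mul_comm' : ∀ i j k l i' j' k' l', α i j k l * α i' j' k' l' = α i j' k l' * α i' j k' l
  symm_left : ∀ i j k l, α i j k l = α k j i l
  symm_right : ∀ i j k l, α i j k l = α i l k j
  nonneg : ∀ x y : Fin K → ℝ,
    0 ≤ ∑ i, ∑ j, ∑ k, ∑ l, α i j k l * (x i * x k) * (y j * y l)

namespace IsSeparableTensor

variable {K : ℕ}

theorem of_mul {u v : Fin K → Fin K → ℝ} (hu : ∀ i k, u i k = u k i) (hv : ∀ j l, v j l = v l j)
    (hu0 : ∀ x : Fin K → ℝ, 0 ≤ ∑ i, ∑ k, u i k * (x i * x k))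
    (hv0 : ∀ x : Fin K → ℝ, 0 ≤ ∑ i, ∑ k, v i k * (x i * x k)) :
    IsSeparableTensor fun i j k l => u i k * v j l where
  mul_comm' i j k l i' j' k' l' := by ring
  symm_left i j k l := by rw [hu]
  symm_right i j k l := by rw [hv]
  nonneg x y := by
    have h := mul_nonneg (hu0 x) (hv0 y)
    rw [Finset.sum_mul_sum] at h
    refine h.trans_eq (Finset.sum_congr rfl fun i _ => Finset.sum_congr rfl fun j _ => ?_)
    rw [Finset.sum_mul_sum]
    refine Finset.sum_congr rfl fun k _ => Finset.sum_congr rfl fun l _ => ?_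
    ring

/-- The factors of the approximating products need not converge separately; the exchange identity,
the symmetries and the nonnegativity are closed conditions on the product alone. -/
theorem of_tendsto {α : ℕ → Fin K → Fin K → Fin K → Fin K → ℝ}
    {β : Fin K → Fin K → Fin K → Fin K → ℝ} (h : ∀ m, IsSeparableTensor (α m))
    (hlim : ∀ i j k l, Tendsto (fun m => α m i j k l) atTop (𝓝 (β i j k l))) :
    IsSeparableTensor β where
  mul_comm' i j k l i' j' k' l' := by
    refine tendsto_nhds_unique ((hlim i j k l).mul (hlim i' j' k' l')) ?_
    simp only [(h _).mul_comm' i j k l i' j' k' l']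
    exact (hlim i j' k l').mul (hlim i' j k' l)
  symm_left i j k l := by
    refine tendsto_nhds_unique (hlim i j k l) ?_
    simp only [(h _).symm_left i j k l]
    exact hlim k j i l
  symm_right i j k l := by
    refine tendsto_nhds_unique (hlim i j k l) ?_
    simp only [(h _).symm_right i j k l]
    exact hlim i l k j
  nonneg x y := by
    refine ge_of_tendsto' (x := atTop) (f := fun m =>
      ∑ i, ∑ j, ∑ k, ∑ l, α m i j k l * (x i * x k) * (y j * y l)) ?_ fun m => (h m).nonneg x y
    refine tendsto_finsetSum _ fun i _ => tendsto_finsetSum _ fun j _ =>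
      tendsto_finsetSum _ fun k _ => tendsto_finsetSum _ fun l _ => ?_
    exact ((hlim i j k l).mul_const _).mul_const _

end IsSeparableTensor

/-! ### Sampling -/

section Sampling

set_option linter.unusedSectionVars false

variable {K : ℕ}

/-- The normalized indicator of the `i`-th cell, contracted towards `τ`. -/
def localCell (K : ℕ) (i : Fin K) (τ θ : ℝ) : L2I :=
  localInd ((i : ℝ) / K) (((i : ℝ) + 1) / K) τ θ

/-- The normalized indicator of the pixel `p`, contracted towards the sampling point. -/
def localPixel (t s : Fin K → ℝ) (θ : ℝ) (p : Fin K × Fin K) : L2Q :=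
  localRect ((p.1 : ℝ) / K) (((p.1 : ℝ) + 1) / K) ((p.2 : ℝ) / K) (((p.2 : ℝ) + 1) / K)
    (t p.1, s p.2) θ

theorem div_lt_succ_div (i : Fin K) : (i : ℝ) / K < ((i : ℝ) + 1) / K := by
  have hK : (0 : ℝ) < K := by exact_mod_cast i.pos
  gcongr; linarith

theorem zero_le_cell (i : Fin K) : (0 : ℝ) ≤ (i : ℝ) / K := by positivity

theorem cell_le_one (i : Fin K) : ((i : ℝ) + 1) / K ≤ 1 :=
  (Icc_div_subset i (right_mem_Icc.2 (div_lt_succ_div i).le)).2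

variable {A₁ A₂ : L2I →L[ℝ] L2I} {A B : L2Q →L[ℝ] L2Q} {a : ℝ × ℝ → ℝ × ℝ → ℝ} {t s : Fin K → ℝ}
  {θ : ℝ}

theorem IsTensorOp.inner_localPixel (hA : IsTensorOp A₁ A₂ A) (p q : Fin K × Fin K) :
    ⟪localPixel t s θ p, A (localPixel t s θ q)⟫ =
      ⟪localCell K p.1 (t p.1) θ, A₁ (localCell K q.1 (t q.1) θ)⟫ *
        ⟪localCell K p.2 (s p.2) θ, A₂ (localCell K q.2 (s q.2) θ)⟫ := by
  simp only [localPixel, localRect, localCell]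
  rw [hA, inner_tensorFun]

/-- The covariances of local averages split into Gram matrices of the positive operators `A₁` and
`A₂`. -/
theorem IsTensorOp.isSeparableTensor_localPixel (hA : IsTensorOp A₁ A₂ A) (hA₁ : A₁.IsPositive)
    (hA₂ : A₂.IsPositive) (t s : Fin K → ℝ) (θ : ℝ) :
    IsSeparableTensor fun i j k l =>
      ⟪localPixel t s θ (i, j), A (localPixel t s θ (k, l))⟫ := by
  simp only [hA.inner_localPixel]
  have hsymm : ∀ {T : L2I →L[ℝ] L2I}, T.IsPositive → ∀ x y : L2I, ⟪x, T y⟫ = ⟪y, T x⟫ :=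
    fun hT x y => (real_inner_comm _ _).trans (hT.1 y x)
  have hpos : ∀ {T : L2I →L[ℝ] L2I}, T.IsPositive → ∀ (w : Fin K → L2I) (x : Fin K → ℝ),
      0 ≤ ∑ i, ∑ k, ⟪w i, T (w k)⟫ * (x i * x k) := fun {T} hT w x => by
    have h : 0 ≤ ⟪T (∑ i, x i • w i), ∑ i, x i • w i⟫ := hT.2 _
    rw [real_inner_comm, map_sum, sum_inner] at h
    refine h.trans_eq (Finset.sum_congr rfl fun i _ => ?_)
    rw [inner_sum]
    refine Finset.sum_congr rfl fun k _ => ?_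
    rw [map_smul, inner_smul_left, inner_smul_right, conj_trivial]
    ring
  exact IsSeparableTensor.of_mul
    (u := fun i k => ⟪localCell K i (t i) θ, A₁ (localCell K k (t k) θ)⟫)
    (v := fun j l => ⟪localCell K j (s j) θ, A₂ (localCell K l (s l) θ)⟫)
    (fun _ _ => hsymm hA₁ _ _) (fun _ _ => hsymm hA₂ _ _) (hpos hA₁ _) (hpos hA₂ _)

theorem HasKernel.exists_inner_localPixel_eq (ha : HasKernel A a)
    (hcont : ContinuousOn (fun z : (ℝ × ℝ) × (ℝ × ℝ) => a z.1 z.2) (unitSquare ×ˢ unitSquare))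
    (ht : ∀ i : Fin K, t i ∈ Icc ((i : ℝ) / K) (((i : ℝ) + 1) / K))
    (hs : ∀ i : Fin K, s i ∈ Icc ((i : ℝ) / K) (((i : ℝ) + 1) / K)) (hθ : 0 < θ) (hθ1 : θ ≤ 1)
    (p q : Fin K × Fin K) :
    ∃ y ∈ shrinkRect ((p.1 : ℝ) / K) (((p.1 : ℝ) + 1) / K) ((p.2 : ℝ) / K) (((p.2 : ℝ) + 1) / K)
        (t p.1, s p.2) θ,
      ∃ y' ∈ shrinkRect ((q.1 : ℝ) / K) (((q.1 : ℝ) + 1) / K) ((q.2 : ℝ) / K)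
          (((q.2 : ℝ) + 1) / K) (t q.1, s q.2) θ,
        ⟪localPixel t s θ p, A (localPixel t s θ q)⟫ = a y y' :=
  ha.exists_inner_localRect_eq hcont (zero_le_cell _) (div_lt_succ_div _) (cell_le_one _)
    (zero_le_cell _) (div_lt_succ_div _) (cell_le_one _) (ht _) (hs _)
    (zero_le_cell _) (div_lt_succ_div _) (cell_le_one _)
    (zero_le_cell _) (div_lt_succ_div _) (cell_le_one _) (ht _) (hs _) hθ hθ1

theorem shrinkRect_subset_closedPixel
    (ht : ∀ i : Fin K, t i ∈ Icc ((i : ℝ) / K) (((i : ℝ) + 1) / K))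
    (hs : ∀ i : Fin K, s i ∈ Icc ((i : ℝ) / K) (((i : ℝ) + 1) / K)) (hθ1 : θ ≤ 1)
    (p : Fin K × Fin K) :
    shrinkRect ((p.1 : ℝ) / K) (((p.1 : ℝ) + 1) / K) ((p.2 : ℝ) / K) (((p.2 : ℝ) + 1) / K)
        (t p.1, s p.2) θ ⊆ closedPixel K p :=
  prod_mono (Icc_shrink_subset (ht _) hθ1) (Icc_shrink_subset (hs _) hθ1)

theorem IsBanded.inner_localPixel_eq_zero {δ : ℝ} (hB : IsBanded B δ)
    (ht : ∀ i : Fin K, t i ∈ Icc ((i : ℝ) / K) (((i : ℝ) + 1) / K))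
    (hs : ∀ i : Fin K, s i ∈ Icc ((i : ℝ) / K) (((i : ℝ) + 1) / K)) (hθ1 : θ ≤ 1)
    {d : ℕ} (hd : δ * K + 1 ≤ d) {p q : Fin K × Fin K}
    (h : (p.1 : ℕ) + d ≤ q.1 ∨ (p.2 : ℕ) + d ≤ q.2) :
    ⟪localPixel t s θ p, B (localPixel t s θ q)⟫ = 0 := by
  have hK : (0 : ℝ) < K := by exact_mod_cast p.1.pos
  -- The extra one in `d ≥ δK + 1` absorbs the width of a cell: the gap runs from the right end of
  -- one cell to the left end of the other.
  have key : ∀ i k : Fin K, (i : ℕ) + d ≤ k → ((i : ℝ) + 1) / K + δ ≤ (k : ℝ) / K := by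
    intro i k hik
    have h1 : ((i : ℕ) : ℝ) + d ≤ (k : ℕ) := by exact_mod_cast hik
    rw [div_add' _ _ _ hK.ne', div_le_div_iff_of_pos_right hK]
    linarith
  exact hB.inner_localRect_eq_zero (ht _) (hs _) (ht _) (hs _) hθ1 (h.imp (key _ _) (key _ _))

variable {Ω : Type*} [MeasurableSpace Ω] {P : Measure Ω} [IsProbabilityMeasure P]

theorem IsCovariance.integral_inner_mul_inner {Y : Ω → L2Q} {C : L2Q →L[ℝ] L2Q}
    (hC : IsCovariance P Y C) (hmean : ∫ ω, Y ω ∂P = 0) (f g : L2Q) :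
    ∫ ω, ⟪f, Y ω⟫ * ⟪g, Y ω⟫ ∂P = ⟪f, C g⟫ := by
  have h := hC g f
  rw [hmean] at h
  simp only [sub_zero] at h
  rw [real_inner_comm, ← h]
  refine integral_congr_ae (Eventually.of_forall fun ω => ?_)
  simp only [real_inner_comm (Y ω)]
  ring

theorem integral_inner_localPixel {Y : Ω → L2Q} (hC : IsCovariance P Y (A + B))
    (hmean : ∫ ω, Y ω ∂P = 0) {δ : ℝ} (hB : IsBanded B δ)
    (ht : ∀ i : Fin K, t i ∈ Icc ((i : ℝ) / K) (((i : ℝ) + 1) / K))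
    (hs : ∀ i : Fin K, s i ∈ Icc ((i : ℝ) / K) (((i : ℝ) + 1) / K)) (hθ1 : θ ≤ 1)
    {d : ℕ} (hd : δ * K + 1 ≤ d) {p q : Fin K × Fin K}
    (h : (p.1 : ℕ) + d ≤ q.1 ∨ (p.2 : ℕ) + d ≤ q.2) :
    ∫ ω, ⟪localPixel t s θ p, Y ω⟫ * ⟪localPixel t s θ q, Y ω⟫ ∂P =
      ⟪localPixel t s θ p, A (localPixel t s θ q)⟫ := by
  rw [hC.integral_inner_mul_inner hmean, add_apply, inner_add_right,
    hB.inner_localPixel_eq_zero ht hs hθ1 hd h, add_zero]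

/-- Pixel averages are the case of contraction factor one, where the centres `t`, `s` are
irrelevant; both sampling schemes can share the local averages. -/
theorem PixelSampled.eq_inner {X : ℕ → Ω → L2Q} {D : (K : ℕ) → ℕ → Ω → Fin K → Fin K → ℝ}
    (h : PixelSampled X D) (n : ℕ) (ω : Ω) (t s : Fin K → ℝ) (i j : Fin K) :
    D K n ω i j = ⟪localPixel t s 1 (i, j), X n ω⟫ := by
  have hK : (K : ℝ) ≠ 0 := by exact_mod_cast i.pos.ne'
  have hlen : ∀ i : Fin K, (((i : ℝ) + 1) / K - (i : ℝ) / K)⁻¹ = K := fun i => by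
    rw [← sub_div, add_sub_cancel_left, one_div, inv_inv]
  have hsh : ∀ l τ : ℝ, shrink l τ 1 = l := fun l τ => by simp [shrink]
  rw [h, localPixel, localRect_eq, inner_smul_left, conj_trivial]
  simp only [hsh, one_mul, hlen]
  rw [setIntegral_eq_inner_rect, sq]
  rfl

theorem PointSampled.measurable_eval {X : ℕ → Ω → L2Q} {Y : ℕ → Ω → ℝ × ℝ → ℝ}
    (hXm : ∀ n, Measurable (X n)) (hYc : ∀ n ω, ContinuousOn (Y n ω) unitSquare)
    (hXY : ∀ n ω, X n ω =ᵐ[squareMeasure] Y n ω) (n : ℕ) {x : ℝ × ℝ} (hx : x ∈ unitSquare) :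
    Measurable fun ω => Y n ω x := by
  refine measurable_of_tendsto_metrizable (f := fun m ω =>
    ⟪localRect 0 1 0 1 x (contraction m), X n ω⟫) (fun m => ?_) (tendsto_pi_nhds.2 fun ω => ?_)
  · exact (innerSL ℝ (localRect 0 1 0 1 x (contraction m))).continuous.measurable.comp (hXm n)
  · exact tendsto_inner_localRect (hYc n ω) (hXY n ω) le_rfl one_pos le_rfl le_rfl one_pos le_rfl
      hx.1 hx.2

/-- The noiseless observations are a measurable function of the surface. -/
theorem exists_measurable_sampling {X : ℕ → Ω → L2Q}
    {D : (K : ℕ) → ℕ → Ω → Fin K → Fin K → ℝ} (h : PointSampled P X D ∨ PixelSampled X D) (K : ℕ) :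
    ∃ g : L2Q → Fin K → Fin K → ℝ, Measurable g ∧ ∀ n ω, D K n ω = g (X n ω) := by
  rcases h with ⟨Y, t, s, hYc, hXY, -, ht, hs, hD⟩ | h
  · refine ⟨fun x i j => limsup (fun m => ⟪localPixel (t K) (s K) (contraction m) (i, j), x⟫) atTop,
      measurable_pi_lambda _ fun i => measurable_pi_lambda _ fun j => Measurable.limsup fun m => ?_,
      fun n ω => ?_⟩
    · exact (innerSL ℝ (localPixel (t K) (s K) (contraction m) (i, j))).continuous.measurable
    · ext i j
      rw [hD]
      refine (Tendsto.limsup_eq ?_).symm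
      exact tendsto_inner_localRect (hYc n ω) (hXY n ω) (zero_le_cell _) (div_lt_succ_div _)
        (cell_le_one _) (zero_le_cell _) (div_lt_succ_div _) (cell_le_one _) (ht K i) (hs K j)
  · refine ⟨fun x i j => ⟪localPixel (fun _ => 0) (fun _ => 0) 1 (i, j), x⟫,
      measurable_pi_lambda _ fun i => measurable_pi_lambda _ fun j => ?_, fun n ω => ?_⟩
    · exact (innerSL ℝ (localPixel (fun _ => 0) (fun _ => 0) 1 (i, j))).continuous.measurable
    · ext i j
      exact h.eq_inner n ω _ _ i j

/-- Covariances of local averages are quadratic forms of `A + B`, and beyond the shift only `A` is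
left. For pixel sampling this is already the claim. For point sampling both sides pass to the limit:
the kernel by continuity, the covariances by uniform integrability. -/
theorem exists_sampled_tensor {X : ℕ → Ω → L2Q} {D : (K : ℕ) → ℕ → Ω → Fin K → Fin K → ℝ}
    (hXm : ∀ n, Measurable (X n)) (hmean : ∫ ω, X 0 ω ∂P = 0)
    (hA₁ : A₁.IsPositive) (hA₂ : A₂.IsPositive) (hA : IsTensorOp A₁ A₂ A)
    (hC : IsCovariance P (X 0) (A + B)) (ha : HasKernel A a)
    (hcont : ContinuousOn (fun z : (ℝ × ℝ) × (ℝ × ℝ) => a z.1 z.2) (unitSquare ×ˢ unitSquare))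
    {δ : ℝ} (hB : IsBanded B δ) (h : PointSampled P X D ∨ PixelSampled X D)
    (K : ℕ) {d : ℕ} (hd : δ * K + 1 ≤ d) :
    ∃ α : Fin K → Fin K → Fin K → Fin K → ℝ, IsSeparableTensor α ∧
      (∀ p q : Fin K × Fin K, ∃ y ∈ closedPixel K p, ∃ y' ∈ closedPixel K q,
        α p.1 p.2 q.1 q.2 = a y y') ∧
      ∀ p q : Fin K × Fin K, ((p.1 : ℕ) + d ≤ q.1 ∨ (p.2 : ℕ) + d ≤ q.2) →
        ∫ ω, D K 0 ω p.1 p.2 * D K 0 ω q.1 q.2 ∂P = α p.1 p.2 q.1 q.2 := by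
  rcases h with ⟨Y, t, s, hYc, hXY, ⟨S, hS⟩, ht, hs, hD⟩ | h
  · have hmem : ∀ p : Fin K × Fin K, (t K p.1, s K p.2) ∈ closedPixel K p := fun p =>
      ⟨ht K p.1, hs K p.2⟩
    have hlim : ∀ p q : Fin K × Fin K, Tendsto (fun m =>
        ⟪localPixel (t K) (s K) (contraction m) p, A (localPixel (t K) (s K) (contraction m) q)⟫)
        atTop (𝓝 (a (t K p.1, s K p.2) (t K q.1, s K q.2))) := by
      intro p q
      choose y hy y' hy' heq using fun m => ha.exists_inner_localPixel_eq hcont (ht K) (hs K)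
        (contraction_pos m) (contraction_le_one m) p q
      simp only [heq]
      have h1 := tendsto_of_mem_shrinkRect (ht K p.1) (hs K p.2) hy
      have h2 := tendsto_of_mem_shrinkRect (ht K q.1) (hs K q.2) hy'
      refine (hcont ((t K p.1, s K p.2), (t K q.1, s K q.2))
        ⟨closedPixel_subset p (hmem p), closedPixel_subset q (hmem q)⟩).tendsto.comp
        (f := fun m => (y m, y' m)) (tendsto_nhdsWithin_iff.2 ⟨h1.prodMk_nhds h2,
          Eventually.of_forall fun m => ⟨?_, ?_⟩⟩)
      · exact closedPixel_subset p
          (shrinkRect_subset_closedPixel (ht K) (hs K) (contraction_le_one m) p (hy m))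
      · exact closedPixel_subset q
          (shrinkRect_subset_closedPixel (ht K) (hs K) (contraction_le_one m) q (hy' m))
    refine ⟨fun i j k l => a (t K i, s K j) (t K k, s K l), ?_, ?_, ?_⟩
    · exact IsSeparableTensor.of_tendsto
        (fun m => hA.isSeparableTensor_localPixel hA₁ hA₂ (t K) (s K) (contraction m))
        fun i j k l => hlim (i, j) (k, l)
    · exact fun p q => ⟨_, hmem p, _, hmem q, rfl⟩
    · intro p q hpq
      simp only [hD]
      have hmeas : ∀ p : Fin K × Fin K, Measurable fun ω => Y 0 ω (t K p.1, s K p.2) := fun p =>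
        PointSampled.measurable_eval hXm hYc hXY 0 (closedPixel_subset p (hmem p))
      have hm : ∀ (m : ℕ) (p : Fin K × Fin K), Measurable fun ω =>
          ⟪localPixel (t K) (s K) (contraction m) p, X 0 ω⟫ := fun m p =>
        (innerSL ℝ (localPixel (t K) (s K) (contraction m) p)).continuous.measurable.comp (hXm 0)
      have h4 : ∀ (m : ℕ) (p : Fin K × Fin K),
          Integrable (fun ω => ⟪localPixel (t K) (s K) (contraction m) p, X 0 ω⟫ ^ 4) P ∧
          ∫ ω, ⟪localPixel (t K) (s K) (contraction m) p, X 0 ω⟫ ^ 4 ∂P ≤ S := fun m p =>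
        integral_inner_localRect_pow_four_le (hXm 0) (hYc 0) (hXY 0)
          (fun x hx => PointSampled.measurable_eval hXm hYc hXY 0 hx) (hS 0) (zero_le_cell _)
          (div_lt_succ_div _) (cell_le_one _) (zero_le_cell _) (div_lt_succ_div _) (cell_le_one _)
          (ht K p.1) (hs K p.2) (contraction_pos m) (contraction_le_one m)
      have hY4 : ∀ p : Fin K × Fin K, Integrable (fun ω => Y 0 ω (t K p.1, s K p.2) ^ 4) P :=
        fun p => (hS 0 _ (closedPixel_subset p (hmem p))).1
      -- Bounded fourth moments of the local averages bound the second moments of their products.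
      have hto := tendsto_integral_of_sq_le (P := P) (S := S)
        (fun m => memLp_two_mul_of_pow_four (hm m p).aestronglyMeasurable
          (hm m q).aestronglyMeasurable (h4 m p).1 (h4 m q).1)
        (memLp_two_mul_of_pow_four (hmeas p).aestronglyMeasurable
          (hmeas q).aestronglyMeasurable (hY4 p) (hY4 q))
        (fun m => integral_mul_sq_le_of_pow_four (hm m p).aestronglyMeasurable
          (hm m q).aestronglyMeasurable (h4 m p).1 (h4 m q).1 (h4 m p).2 (h4 m q).2)
        (Eventually.of_forall fun ω => (tendsto_inner_localRect (hYc 0 ω) (hXY 0 ω)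
          (zero_le_cell p.1) (div_lt_succ_div _) (cell_le_one _) (zero_le_cell p.2)
          (div_lt_succ_div _) (cell_le_one _) (ht K p.1) (hs K p.2)).mul
          (tendsto_inner_localRect (hYc 0 ω) (hXY 0 ω) (zero_le_cell q.1) (div_lt_succ_div _)
          (cell_le_one _) (zero_le_cell q.2) (div_lt_succ_div _) (cell_le_one _) (ht K q.1)
          (hs K q.2)))
      refine tendsto_nhds_unique hto ?_
      simp only [integral_inner_localPixel hC hmean hB (ht K) (hs K) (contraction_le_one _) hd hpq]
      exact hlim p q
  -- With contraction factor one any centres in the cells would do; left end points are taken.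
  · set t : Fin K → ℝ := fun i => (i : ℝ) / K with ht_def
    have ht : ∀ i : Fin K, t i ∈ Icc ((i : ℝ) / K) (((i : ℝ) + 1) / K) := fun i =>
      left_mem_Icc.2 (div_lt_succ_div i).le
    refine ⟨fun i j k l => ⟪localPixel t t 1 (i, j), A (localPixel t t 1 (k, l))⟫,
      hA.isSeparableTensor_localPixel hA₁ hA₂ t t 1, fun p q => ?_, fun p q hpq => ?_⟩
    · obtain ⟨y, hy, y', hy', heq⟩ := ha.exists_inner_localPixel_eq hcont ht ht one_pos le_rfl p q
      exact ⟨y, shrinkRect_subset_closedPixel ht ht le_rfl p hy, y',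
        shrinkRect_subset_closedPixel ht ht le_rfl q hy', heq⟩
    · simp only [h.eq_inner 0 _ t t]
      exact integral_inner_localPixel hC hmean hB ht ht le_rfl hd hpq

end Sampling

/-! ### Fourth moments of the observations -/

section ObservationMoments

variable {K : ℕ}

theorem inner_cellInd (i k : Fin K) : ⟪cellInd K i, cellInd K k⟫ = if i = k then 1 / (K : ℝ) else 0 := by
  rw [cellInd, L2.inner_indicatorConstLp_one]
  have h1 : ∫ x in cell K i, cellInd K k x ∂unitMeasure =
      ∫ x in cell K i, (cell K k).indicator (fun _ => (1 : ℝ)) x ∂unitMeasure := by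
    refine setIntegral_congr_ae (measurableSet_cell K i) ?_
    have h2 : cellInd K k =ᵐ[unitMeasure] (cell K k).indicator fun _ => (1 : ℝ) :=
      indicatorConstLp_coeFn
    filter_upwards [h2] with x hx _
    exact hx
  rw [h1]
  split_ifs with hik
  · subst hik
    rw [setIntegral_congr_fun (g := fun _ => (1 : ℝ)) (measurableSet_cell K i) fun x hx =>
      indicator_of_mem hx _, unitMeasure_restrict_cell, integral_const, volume_real_cell]
    simp
  · rw [setIntegral_congr_fun (g := fun _ => (0 : ℝ)) (measurableSet_cell K i) fun x hx =>
      indicator_of_notMem (fun h => hik (eq_of_mem_cell hx h)) _]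
    simp

theorem orthonormal_pixels (hK : 0 < K) : Orthonormal ℝ fun p : Fin K × Fin K =>
    (K : ℝ) • tensorFun (cellInd K p.1) (cellInd K p.2) := by
  have hK' : (K : ℝ) ≠ 0 := by exact_mod_cast hK.ne'
  rw [orthonormal_iff_ite]
  intro p q
  rw [inner_smul_left, inner_smul_right, inner_tensorFun, inner_cellInd, inner_cellInd]
  by_cases h1 : p.1 = q.1 <;> by_cases h2 : p.2 = q.2 <;> simp [h1, h2, Prod.ext_iff]
  field_simp

/-- Bessel's inequality for the pixel indicators, which are orthonormal after multiplication by `K`.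
-/
theorem PixelSampled.sum_sq_le {Ω : Type*} {X : ℕ → Ω → L2Q}
    {D : (K : ℕ) → ℕ → Ω → Fin K → Fin K → ℝ} (h : PixelSampled X D) (n : ℕ) (ω : Ω) :
    ∑ p : Fin K × Fin K, D K n ω p.1 p.2 ^ 2 ≤ (K : ℝ) ^ 2 * ‖X n ω‖ ^ 2 := by
  rcases Nat.eq_zero_or_pos K with rfl | hK
  · simp
  have h1 := (orthonormal_pixels hK).sum_inner_products_le (X n ω) (s := Finset.univ)
  refine le_trans (le_of_eq ?_) (mul_le_mul_of_nonneg_left h1 (sq_nonneg (K : ℝ)))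
  rw [Finset.mul_sum]
  refine Finset.sum_congr rfl fun p _ => ?_
  have h2 : D K n ω p.1 p.2 = (K : ℝ) * ⟪(K : ℝ) • tensorFun (cellInd K p.1) (cellInd K p.2), X n ω⟫ := by
    rw [h, inner_smul_left, conj_trivial, ← mul_assoc, ← sq]
    congr 1
    exact (setIntegral_eq_inner_rect _ _ _ _ _).symm
  rw [h2, mul_pow, Real.norm_eq_abs, sq_abs]

/-- The total energy of one noiseless observation is of order `K²` in mean square. Point sampling
uses Cauchy–Schwarz over the `K²` pixels and the uniform fourth moments, pixel sampling uses
Bessel's inequality and `𝔼‖X‖⁴`. -/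
theorem exists_moment_bound {Ω : Type*} [MeasurableSpace Ω] {P : Measure Ω} [IsProbabilityMeasure P]
    {X : ℕ → Ω → L2Q} {D : (K : ℕ) → ℕ → Ω → Fin K → Fin K → ℝ}
    (hX4 : MemLp (X 0) 4 P)
    (h : PointSampled P X D ∨ PixelSampled X D) :
    ∃ κ : ℝ, ∀ K, (∀ p : Fin K × Fin K, Integrable (fun ω => D K 0 ω p.1 p.2 ^ 4) P) ∧
      ∫ ω, (∑ p : Fin K × Fin K, D K 0 ω p.1 p.2 ^ 2) ^ 2 ∂P ≤ κ * (K : ℝ) ^ 4 := by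
  rcases h with ⟨Y, t, s, hYc, hXY, ⟨S, hS⟩, ht, hs, hD⟩ | h
  · refine ⟨S, fun K => ?_⟩
    have hmem : ∀ p : Fin K × Fin K, (t K p.1, s K p.2) ∈ unitSquare := fun p =>
      closedPixel_subset p ⟨ht K p.1, hs K p.2⟩
    have h4 : ∀ p : Fin K × Fin K, Integrable (fun ω => D K 0 ω p.1 p.2 ^ 4) P ∧
        ∫ ω, D K 0 ω p.1 p.2 ^ 4 ∂P ≤ S := fun p => by
      simp only [hD]
      exact hS 0 _ (hmem p)
    refine ⟨fun p => (h4 p).1, ?_⟩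
    have h5 : ∀ ω, (∑ p : Fin K × Fin K, D K 0 ω p.1 p.2 ^ 2) ^ 2 ≤
        (K : ℝ) ^ 2 * ∑ p : Fin K × Fin K, D K 0 ω p.1 p.2 ^ 4 := fun ω => by
      have := sq_sum_le_card_mul_sum_sq (s := Finset.univ)
        (f := fun p : Fin K × Fin K => D K 0 ω p.1 p.2 ^ 2)
      simp only [Finset.card_univ, Fintype.card_prod, Fintype.card_fin, ← pow_mul] at this
      push_cast at this
      rwa [← sq] at this
    calc _ ≤ ∫ ω, (K : ℝ) ^ 2 * ∑ p : Fin K × Fin K, D K 0 ω p.1 p.2 ^ 4 ∂P :=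
          integral_mono_of_nonneg (Eventually.of_forall fun ω => sq_nonneg _)
            ((integrable_finsetSum _ fun p _ => (h4 p).1).const_mul _)
            (Eventually.of_forall h5)
      _ = (K : ℝ) ^ 2 * ∑ p : Fin K × Fin K, ∫ ω, D K 0 ω p.1 p.2 ^ 4 ∂P := by
          rw [integral_const_mul, integral_finsetSum _ fun p _ => (h4 p).1]
      _ ≤ (K : ℝ) ^ 2 * ∑ p : Fin K × Fin K, S := by
          gcongr with p
          exact (h4 p).2
      _ = S * (K : ℝ) ^ 4 := by simp; ring
  · have hi := integrable_pow_four_of_memLp hX4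
    refine ⟨∫ ω, ‖X 0 ω‖ ^ 4 ∂P, fun K => ⟨fun p => ?_, ?_⟩⟩
    · simp only [h.eq_inner 0 _ (fun _ => 0) (fun _ => 0)]
      exact integrable_inner_pow_four hX4 _
    · calc _ ≤ ∫ ω, ‖X 0 ω‖ ^ 4 * (K : ℝ) ^ 4 ∂P := by
            refine integral_mono_of_nonneg (Eventually.of_forall fun ω => sq_nonneg _)
              (hi.mul_const _) (Eventually.of_forall fun ω => ?_)
            have := pow_le_pow_left₀ (Finset.sum_nonneg fun p _ => sq_nonneg _)
              (h.sum_sq_le (K := K) 0 ω) 2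
            refine this.trans_eq ?_
            simp only
            ring
        _ = _ := integral_mul_const _ _

end ObservationMoments

/-! ### Convergence of the shifted traces -/

section ShiftedTrace

theorem LipschitzKernel.exists_bound {L : ℝ} {a : ℝ × ℝ → ℝ × ℝ → ℝ} (h : LipschitzKernel L a) :
    ∃ m, 0 ≤ m ∧ ∀ x ∈ unitSquare, ∀ y ∈ unitSquare, |a x y| ≤ m := by
  obtain ⟨c, hc⟩ := ((isCompact_Icc.prod isCompact_Icc).prod
    (isCompact_Icc.prod isCompact_Icc)).exists_bound_of_continuousOn h.continuousOn
  exact ⟨|c|, abs_nonneg c, fun x hx y hy => (hc (x, y) ⟨hx, hy⟩).trans (le_abs_self c)⟩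

theorem squareMeasure_real_pixel {K : ℕ} (p : Fin K × Fin K) :
    squareMeasure.real (pixel K p) = 1 / (K : ℝ) ^ 2 := by
  have hK : (K : ℝ) ≠ 0 := by exact_mod_cast p.1.pos.ne'
  rw [pixel, cell, cell, squareMeasure_real_rect (zero_le_cell _) (div_lt_succ_div _).le
    (cell_le_one _) (zero_le_cell _) (div_lt_succ_div _).le (cell_le_one _)]
  field_simp
  ring

/-- The piecewise constant function with the values `F`. -/
def stepFun {K : ℕ} (F : Fin K → Fin K → ℝ) (x : ℝ × ℝ) : ℝ :=
  ∑ i, ∑ j, (pixel K (i, j)).indicator (fun _ => F i j) x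

theorem stepFun_apply {K : ℕ} (F : Fin K → Fin K → ℝ) {p : Fin K × Fin K} {x : ℝ × ℝ}
    (hx : x ∈ pixel K p) : stepFun F x = F p.1 p.2 := by
  rw [stepFun, Finset.sum_eq_single p.1, Finset.sum_eq_single p.2]
  · exact indicator_of_mem hx _
  · intro j _ h
    exact indicator_of_notMem (fun h' => h (congrArg Prod.snd (eq_of_mem_pixel h' hx))) _
  · simp
  · intro i _ h
    exact Finset.sum_eq_zero fun j _ =>
      indicator_of_notMem (fun h' => h (congrArg Prod.fst (eq_of_mem_pixel h' hx))) _
  · simp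

theorem measurable_stepFun {K : ℕ} (F : Fin K → Fin K → ℝ) : Measurable (stepFun F) :=
  Finset.measurable_sum _ fun _ _ => Finset.measurable_sum _ fun _ _ =>
    measurable_const.indicator (measurableSet_pixel _)

theorem integral_stepFun {K : ℕ} (F : Fin K → Fin K → ℝ) :
    ∫ x, stepFun F x ∂squareMeasure = (∑ i, ∑ j, F i j) / (K : ℝ) ^ 2 := by
  have hi : ∀ i j, Integrable ((pixel K (i, j)).indicator fun _ => F i j) squareMeasure :=
    fun i j => (integrable_const _).indicator (measurableSet_pixel _)
  simp only [stepFun]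
  rw [integral_finsetSum _ fun i _ => integrable_finsetSum _ fun j _ => hi i j, Finset.sum_div]
  refine Finset.sum_congr rfl fun i _ => ?_
  rw [integral_finsetSum _ fun j _ => hi i j, Finset.sum_div]
  refine Finset.sum_congr rfl fun j _ => ?_
  rw [integral_indicator (measurableSet_pixel _), setIntegral_const, squareMeasure_real_pixel,
    smul_eq_mul]
  ring

theorem le_discBandwidth {δ : ℝ} (K : ℕ) : δ * K + 1 ≤ discBandwidth δ K := by
  have := Nat.le_ceil (δ * K)
  rw [discBandwidth]
  push_cast
  linarith

theorem discBandwidth_lt {δ : ℝ} (hδ : 0 ≤ δ) (K : ℕ) : (discBandwidth δ K : ℝ) < δ * K + 2 := by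
  have := Nat.ceil_lt_add_one (show 0 ≤ δ * K by positivity)
  rw [discBandwidth]
  push_cast
  linarith

theorem setIntegral_square_eq {c : ℝ} (hc0 : 0 ≤ c) (hc1 : c ≤ 1) {F : ℝ × ℝ → ℝ}
    (hF : ContinuousOn F (Icc 0 c ×ˢ Icc 0 c)) :
    ∫ x in Ico 0 c ×ˢ Ico 0 c, F x ∂squareMeasure =
      ∫ t in (0 : ℝ)..c, ∫ s in (0 : ℝ)..c, F (t, s) := by
  have hres : unitMeasure.restrict (Ico 0 c) = volume.restrict (Ico 0 c) := by
    rw [Measure.restrict_restrict measurableSet_Ico, inter_eq_left.2]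
    exact Ico_subset_Icc_self.trans (Icc_subset_Icc_right hc1)
  have hint : IntegrableOn F (Ico 0 c ×ˢ Ico 0 c) (volume.prod volume) :=
    (hF.integrableOn_compact (isCompact_Icc.prod isCompact_Icc)).mono_set
      (prod_mono Ico_subset_Icc_self Ico_subset_Icc_self)
  rw [← Measure.prod_restrict, hres, Measure.prod_restrict, setIntegral_prod _ hint,
    intervalIntegral.integral_of_le hc0, ← integral_Icc_eq_integral_Ico,
    integral_Icc_eq_integral_Ioc]
  refine setIntegral_congr_fun measurableSet_Ioc fun t _ => ?_
  rw [intervalIntegral.integral_of_le hc0, ← integral_Icc_eq_integral_Ico,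
    integral_Icc_eq_integral_Ioc]

/-- The normalized discrete trace is the integral of a step function. Off the null lines where a
coordinate is `1` or `1 - δ`, these step functions converge to `a (t, s) (t + δ, s + δ)` inside `[0,
1 - δ)²` and to zero outside, boundedly. -/
theorem tendsto_discTr {L : ℝ} {a : ℝ × ℝ → ℝ × ℝ → ℝ} (ha : LipschitzKernel L a) (hL : 0 ≤ L)
    {δ : ℝ} (hδ : δ ∈ Ico (0 : ℝ) 1) {α : (K : ℕ) → Fin K → Fin K → Fin K → Fin K → ℝ}
    (hα : ∀ (K : ℕ) (p q : Fin K × Fin K), ∃ y ∈ closedPixel K p, ∃ y' ∈ closedPixel K q,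
      α K p.1 p.2 q.1 q.2 = a y y') :
    Tendsto (fun K : ℕ => discTr (discBandwidth δ K) (α K) / (K : ℝ) ^ 2) atTop
      (𝓝 (shiftedTrace δ a)) := by
  obtain ⟨m, hm0, hm⟩ := ha.exists_bound
  obtain ⟨hδ0, hδ1⟩ := hδ
  set F : (K : ℕ) → Fin K → Fin K → ℝ := fun K i j =>
    if h : (i : ℕ) + discBandwidth δ K < K ∧ (j : ℕ) + discBandwidth δ K < K then
      α K i j ⟨i + discBandwidth δ K, h.1⟩ ⟨j + discBandwidth δ K, h.2⟩ else 0 with hF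
  have hFb : ∀ K i j, |F K i j| ≤ m := fun K i j => by
    simp only [hF]
    split_ifs with h
    · obtain ⟨y, hy, y', hy', heq⟩ := hα K (i, j) (⟨i + discBandwidth δ K, h.1⟩,
        ⟨j + discBandwidth δ K, h.2⟩)
      rw [heq]
      exact hm _ (closedPixel_subset _ hy) _ (closedPixel_subset _ hy')
    · simpa using hm0
  set G : ℝ × ℝ → ℝ := fun x => a x (x.1 + δ, x.2 + δ) with hG
  have hGc : ContinuousOn G (Icc 0 (1 - δ) ×ˢ Icc 0 (1 - δ)) := by
    refine ha.continuousOn.comp (f := fun x : ℝ × ℝ => (x, (x.1 + δ, x.2 + δ)))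
      (by fun_prop) fun x hx => ?_
    obtain ⟨⟨h1, h2⟩, h3, h4⟩ := hx
    refine ⟨⟨⟨h1, by linarith⟩, ⟨h3, by linarith⟩⟩, ⟨⟨?_, ?_⟩, ⟨?_, ?_⟩⟩⟩ <;> simp only <;> linarith
  have hlim : Tendsto (fun K : ℕ => ∫ x, stepFun (F K) x ∂squareMeasure) atTop
      (𝓝 (∫ x, (Ico 0 (1 - δ) ×ˢ Ico 0 (1 - δ)).indicator G x ∂squareMeasure)) := by
    refine tendsto_integral_filter_of_dominated_convergence (fun _ => m)
      (Eventually.of_forall fun K => (measurable_stepFun _).aestronglyMeasurable) ?_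
      (integrable_const _) ?_
    · filter_upwards [eventually_gt_atTop 0] with K hK
      filter_upwards [ae_exists_mem_pixel hK] with x ⟨p, hp⟩
      rw [stepFun_apply _ hp]
      exact hFb _ _ _
    · have hne : ∀ᵐ t ∂unitMeasure, 0 ≤ t ∧ t < 1 ∧ t ≠ 1 - δ := by
        have h1 : ∀ᵐ t ∂unitMeasure, t ≠ 1 := Measure.ae_ne _ _
        have h2 : ∀ᵐ t ∂unitMeasure, t ≠ 1 - δ := Measure.ae_ne _ _
        filter_upwards [ae_restrict_mem measurableSet_Icc, h1, h2] with t ht h1 h2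
        exact ⟨ht.1, ht.2.lt_of_ne h1, h2⟩
      filter_upwards [Measure.quasiMeasurePreserving_fst (μ := unitMeasure) (ν := unitMeasure)
        |>.ae hne, Measure.quasiMeasurePreserving_snd (μ := unitMeasure) (ν := unitMeasure)
        |>.ae hne] with x ⟨h10, h11, h1d⟩ ⟨h20, h21, h2d⟩
      have hpix : ∀ K : ℕ, 0 < K → ∃ p, x ∈ pixel K p := fun K hK => by
        obtain ⟨i, hi⟩ := exists_mem_cell hK h10 h11
        obtain ⟨j, hj⟩ := exists_mem_cell hK h20 h21
        exact ⟨(i, j), hi, hj⟩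
      have hout : ∀ (K : ℕ) (u : ℝ) (i : Fin K), u ∈ cell K i → 1 - δ < u →
          ¬ (i : ℕ) + discBandwidth δ K < K := fun K u i hu hlt h => by
        have hK : (0 : ℝ) < K := by exact_mod_cast i.pos
        have h1 := hu.2
        rw [lt_div_iff₀ hK] at h1
        have h2 : ((i : ℕ) : ℝ) + discBandwidth δ K < K := by exact_mod_cast h
        have h3 := le_discBandwidth (δ := δ) K
        nlinarith
      by_cases hin : x.1 < 1 - δ ∧ x.2 < 1 - δ
      · rw [indicator_of_mem (show x ∈ Ico 0 (1 - δ) ×ˢ Ico 0 (1 - δ) from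
          ⟨⟨h10, hin.1⟩, ⟨h20, hin.2⟩⟩)]
        rw [tendsto_iff_dist_tendsto_zero]
        -- The sampling points miss `x` by at most `1/K` and `x + δ` by at most `3/K` per
        -- coordinate, and `1 + 1 + 9 + 9 ≤ 5²`.
        have hz : Tendsto (fun K : ℕ => L * 5 / (K : ℝ)) atTop (𝓝 0) :=
          tendsto_const_div_atTop_nhds_zero_nat _
        refine squeeze_zero' (Eventually.of_forall fun _ => dist_nonneg) ?_ hz
        filter_upwards [eventually_gt_atTop 0,
          tendsto_natCast_atTop_atTop.eventually_ge_atTop (2 / (1 - δ - x.1)),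
          tendsto_natCast_atTop_atTop.eventually_ge_atTop (2 / (1 - δ - x.2))] with K hK hK1 hK2
        have hK' : (0 : ℝ) < K := by exact_mod_cast hK
        obtain ⟨p, hp⟩ := hpix K hK
        have hd1 := le_discBandwidth (δ := δ) K
        have hd2 := discBandwidth_lt hδ0 K
        -- Since `i ≤ uK` and `d < δK + 2`, the condition `K (1 - δ - u) ≥ 2` keeps the shifted
        -- index on the grid.
        have hcell : ∀ (u : ℝ) (i : Fin K), u ∈ cell K i → u < 1 - δ →
            2 / (1 - δ - u) ≤ K → (i : ℕ) + discBandwidth δ K < K := fun u i hu hlt hKu => by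
          rw [div_le_iff₀ (by linarith)] at hKu
          have h1 := hu.1
          rw [div_le_iff₀ hK'] at h1
          have h2 : ((i : ℕ) : ℝ) + discBandwidth δ K < K := by nlinarith
          exact_mod_cast h2
        have hc : (p.1 : ℕ) + discBandwidth δ K < K ∧ (p.2 : ℕ) + discBandwidth δ K < K :=
          ⟨hcell _ _ hp.1 hin.1 hK1, hcell _ _ hp.2 hin.2 hK2⟩
        rw [stepFun_apply _ hp]
        simp only [hF]
        rw [dif_pos hc]
        obtain ⟨y, hy, y', hy', heq⟩ := hα K p (⟨p.1 + discBandwidth δ K, hc.1⟩,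
          ⟨p.2 + discBandwidth δ K, hc.2⟩)
        simp only at heq
        rw [heq, hG, Real.dist_eq]
        have hxs : x ∈ unitSquare := ⟨⟨h10, h11.le⟩, ⟨h20, h21.le⟩⟩
        have hxs' : (x.1 + δ, x.2 + δ) ∈ unitSquare :=
          ⟨⟨by simp only; linarith, by simp only; linarith⟩,
            ⟨by simp only; linarith, by simp only; linarith⟩⟩
        refine (ha y (closedPixel_subset _ hy) y' (closedPixel_subset _ hy') x hxs _ hxs').trans ?_
        rw [mul_div_assoc]
        refine mul_le_mul_of_nonneg_left ?_ hL
        have hclose : ∀ (u v : ℝ) (i : Fin K), u ∈ cell K i →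
            v ∈ Icc ((i : ℝ) / K) (((i : ℝ) + 1) / K) → (v - u) ^ 2 ≤ (1 / K) ^ 2 := by
          intro u v i hu hv
          have e : ((i : ℝ) + 1) / K = i / K + 1 / K := by ring
          obtain ⟨hu1, hu2⟩ := hu
          obtain ⟨hv1, hv2⟩ := hv
          rw [e] at hu2 hv2
          refine sq_le_sq' ?_ ?_ <;> linarith
        have hfar : ∀ (u v : ℝ) (i k : Fin K), (k : ℕ) = i + discBandwidth δ K → u ∈ cell K i →
            v ∈ Icc ((k : ℝ) / K) (((k : ℝ) + 1) / K) → (v - (u + δ)) ^ 2 ≤ (3 / K) ^ 2 := by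
          intro u v i k hk hu hv
          have hk' : ((k : ℕ) : ℝ) = i + discBandwidth δ K := by exact_mod_cast hk
          obtain ⟨hu1, hu2⟩ := hu
          obtain ⟨hv1, hv2⟩ := hv
          rw [hk'] at hv1 hv2
          rw [div_le_iff₀ hK'] at hu1 hv1
          rw [lt_div_iff₀ hK'] at hu2
          rw [le_div_iff₀ hK'] at hv2
          have e3 : (3 : ℝ) / K * K = 3 := by field_simp
          refine sq_le_sq' ?_ ?_
          · refine le_of_mul_le_mul_right ?_ hK'
            rw [neg_mul, e3]; nlinarith
          · refine le_of_mul_le_mul_right ?_ hK'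
            rw [e3]; nlinarith
        have b1 := hclose _ _ _ hp.1 hy.1
        have b2 := hclose _ _ _ hp.2 hy.2
        have b3 := hfar _ _ _ _ rfl hp.1 hy'.1
        have b4 := hfar _ _ _ _ rfl hp.2 hy'.2
        refine Real.sqrt_le_iff.2 ⟨by positivity, ?_⟩
        have e1 : (3 / (K : ℝ)) ^ 2 = 9 * (1 / K) ^ 2 := by ring
        have e2 : (5 / (K : ℝ)) ^ 2 = 25 * (1 / K) ^ 2 := by ring
        rw [e1] at b3 b4
        rw [e2]
        nlinarith [sq_nonneg (1 / (K : ℝ))]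
      · rw [indicator_of_notMem (fun h => hin ⟨h.1.2, h.2.2⟩)]
        refine tendsto_const_nhds.congr' ?_
        filter_upwards [eventually_gt_atTop 0] with K hK
        obtain ⟨p, hp⟩ := hpix K hK
        rw [stepFun_apply _ hp]
        simp only [hF]
        rw [dif_neg]
        intro hc
        refine hin ⟨?_, ?_⟩
        · by_contra hge
          exact hout K x.1 p.1 hp.1 (lt_of_le_of_ne (not_lt.1 hge) (Ne.symm h1d)) hc.1
        · by_contra hge
          exact hout K x.2 p.2 hp.2 (lt_of_le_of_ne (not_lt.1 hge) (Ne.symm h2d)) hc.2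
  rw [integral_indicator (measurableSet_Ico.prod measurableSet_Ico),
    setIntegral_square_eq (by linarith) (by linarith) hGc] at hlim
  refine hlim.congr fun K => ?_
  rw [integral_stepFun]
  rfl

theorem exists_discTr_bound {L : ℝ} {a : ℝ × ℝ → ℝ × ℝ → ℝ} (ha : LipschitzKernel L a) (hL : 0 ≤ L)
    {δ : ℝ} (hδ : δ ∈ Ico (0 : ℝ) 1) (htr : shiftedTrace δ a ≠ 0)
    {α : (K : ℕ) → Fin K → Fin K → Fin K → Fin K → ℝ}
    (hα : ∀ (K : ℕ) (p q : Fin K × Fin K), ∃ y ∈ closedPixel K p, ∃ y' ∈ closedPixel K q,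
      α K p.1 p.2 q.1 q.2 = a y y') :
    ∃ c : ℝ, 0 < c ∧ ∀ᶠ K : ℕ in atTop,
      c * (K : ℝ) ^ 2 ≤ |discTr (discBandwidth δ K) (α K)| := by
  have h0 : 0 < |shiftedTrace δ a| := abs_pos.2 htr
  refine ⟨|shiftedTrace δ a| / 2, by positivity, ?_⟩
  have h := (tendsto_discTr ha hL hδ hα).abs
  filter_upwards [h.eventually_const_le (show |shiftedTrace δ a| / 2 < |shiftedTrace δ a| by linarith),
    eventually_gt_atTop 0] with K hK hK0
  have hK' : (0 : ℝ) < K := by exact_mod_cast hK0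
  rwa [abs_div, abs_of_pos (by positivity : (0 : ℝ) < (K : ℝ) ^ 2), le_div_iff₀ (by positivity)] at hK

end ShiftedTrace

/-! ### Stability of the normalized product of partial traces -/

section Ratio

variable {K : ℕ} {α : Fin K → Fin K → Fin K → Fin K → ℝ}

/-- The exchange identity applied to each term of the double sum; it identifies the normalized
product of partial traces without naming the factors. -/
theorem IsSeparableTensor.discTr1_mul_discTr2 (h : IsSeparableTensor α) (d : ℕ) (i j k l : Fin K) :
    discTr1 d α i k * discTr2 d α j l = α i j k l * discTr d α := by
  rw [discTr1, discTr2, Finset.sum_mul_sum, discTr, Finset.mul_sum, Finset.sum_comm]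
  refine Finset.sum_congr rfl fun i' _ => ?_
  rw [Finset.mul_sum]
  refine Finset.sum_congr rfl fun j' _ => ?_
  by_cases h1 : (j' : ℕ) + d < K
  · by_cases h2 : (i' : ℕ) + d < K
    · rw [dif_pos h1, dif_pos h2, dif_pos ⟨h2, h1⟩]
      exact (h.mul_comm' _ _ _ _ _ _ _ _)
    · rw [dif_neg h2, dif_neg (show ¬((i' : ℕ) + d < K ∧ (j' : ℕ) + d < K) from fun h => h2 h.1)]
      simp
  · rw [dif_neg h1, dif_neg (show ¬((i' : ℕ) + d < K ∧ (j' : ℕ) + d < K) from fun h => h1 h.2)]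
    simp

theorem IsSeparableTensor.discTr1_symm (h : IsSeparableTensor α) (d : ℕ) (i k : Fin K) :
    discTr1 d α i k = discTr1 d α k i := by
  refine Finset.sum_congr rfl fun j _ => ?_
  split_ifs
  · exact h.symm_left _ _ _ _
  · rfl

theorem IsSeparableTensor.discTr2_symm (h : IsSeparableTensor α) (d : ℕ) (j l : Fin K) :
    discTr2 d α j l = discTr2 d α l j := by
  refine Finset.sum_congr rfl fun i _ => ?_
  split_ifs
  · exact h.symm_right _ _ _ _
  · rfl

theorem abs_discTr1_le {m : ℝ} (hm : 0 ≤ m) (hα : ∀ i j k l, |α i j k l| ≤ m) (d : ℕ) (i k : Fin K) :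
    |discTr1 d α i k| ≤ K * m := by
  refine (Finset.abs_sum_le_sum_abs _ _).trans ?_
  refine (Finset.sum_le_sum (g := fun _ => m) fun j _ => ?_).trans (by simp)
  split_ifs
  · exact hα _ _ _ _
  · simpa using hm

theorem abs_discTr2_le {m : ℝ} (hm : 0 ≤ m) (hα : ∀ i j k l, |α i j k l| ≤ m) (d : ℕ) (j l : Fin K) :
    |discTr2 d α j l| ≤ K * m := by
  refine (Finset.abs_sum_le_sum_abs _ _).trans ?_
  refine (Finset.sum_le_sum (g := fun _ => m) fun j _ => ?_).trans (by simp)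
  split_ifs
  · exact hα _ _ _ _
  · simpa using hm

/-- Symmetrization is an orthogonal projection fixing the symmetric target, so it cannot increase
the Frobenius distance. This treats both choices of the estimators at once. -/
theorem sum_symmetrize_sub_sq_le (symm : Bool) (M N : Fin K → Fin K → ℝ) (hN : ∀ i k, N i k = N k i) :
    ∑ i, ∑ k, (symmetrize symm M i k - N i k) ^ 2 ≤ ∑ i, ∑ k, (M i k - N i k) ^ 2 := by
  cases symm
  · simp [symmetrize]
  · have h1 : ∀ i k, (symmetrize true M i k - N i k) ^ 2 ≤
        ((M i k - N i k) ^ 2 + (M k i - N k i) ^ 2) / 2 := fun i k => by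
      simp only [symmetrize, if_true]
      rw [hN k i]
      nlinarith [sq_nonneg (M i k - M k i)]
    refine (Finset.sum_le_sum fun i _ => Finset.sum_le_sum fun k _ => h1 i k).trans (le_of_eq ?_)
    simp only [← Finset.sum_div, Finset.sum_add_distrib]
    rw [Finset.sum_comm (f := fun i k => (M k i - N k i) ^ 2)]
    ring

theorem symmetrize_div (symm : Bool) (M : Fin K → Fin K → ℝ) (c : ℝ) (i k : Fin K) :
    symmetrize symm (fun i k => M i k / c) i k = symmetrize symm M i k / c := by
  cases symm
  · simp [symmetrize]
  · simp only [symmetrize, if_true]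
    ring

theorem sum_mul_sum_four (f g : Fin K → Fin K → ℝ) :
    ∑ i, ∑ j, ∑ k, ∑ l, f i k * g j l = (∑ i, ∑ k, f i k) * ∑ j, ∑ l, g j l := by
  rw [Finset.sum_mul_sum]
  refine Finset.sum_congr rfl fun i _ => Finset.sum_congr rfl fun j _ => ?_
  rw [Finset.sum_mul_sum]

/-- Perturbation of the quotient `PQ/R` around `pq/r = α`. The bound `η ≤ c/2` keeps `R` away from
zero, and `η ≤ 1` keeps `Q` of the order of `q`. -/
theorem sum_sq_ratio_sub_le {p q P Q : Fin K → Fin K → ℝ} {r R c m η : ℝ}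
    (hα : ∀ i j k l, |α i j k l| ≤ m) (hpq : ∀ i j k l, p i k * q j l = α i j k l * r)
    (hp : ∀ i k, |p i k| ≤ K * m) (hq : ∀ j l, |q j l| ≤ K * m) (hc : 0 < c)
    (hr : c * (K : ℝ) ^ 2 ≤ |r|) (hK : 0 < K) (hη0 : 0 ≤ η) (hη : η ≤ 1) (hηc : η ≤ c / 2)
    (hP : ∑ i, ∑ k, (P i k - p i k) ^ 2 ≤ η ^ 2 * (K : ℝ) ^ 4)
    (hQ : ∑ j, ∑ l, (Q j l - q j l) ^ 2 ≤ η ^ 2 * (K : ℝ) ^ 4) (hR : |R - r| ≤ η * (K : ℝ) ^ 2) :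
    R ≠ 0 ∧ ∑ i, ∑ j, ∑ k, ∑ l, (P i k * (Q j l / R) - α i j k l) ^ 2 ≤
      12 / c ^ 2 * (4 * m ^ 2 + 2) * η ^ 2 * (K : ℝ) ^ 4 := by
  have hK' : (0 : ℝ) < K := by exact_mod_cast hK
  have hRl : c / 2 * (K : ℝ) ^ 2 ≤ |R| := by
    have h1 : |r| - |R - r| ≤ |R| := by
      have := abs_sub_abs_le_abs_sub r R
      rw [abs_sub_comm r R] at this
      linarith
    have h2 : η * (K : ℝ) ^ 2 ≤ c / 2 * (K : ℝ) ^ 2 := by gcongr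
    linarith
  have hR0 : R ≠ 0 := by
    intro h0
    rw [h0, abs_zero] at hRl
    have : 0 < c / 2 * (K : ℝ) ^ 2 := by positivity
    linarith
  refine ⟨hR0, ?_⟩
  have hRsq : c ^ 2 / 4 * (K : ℝ) ^ 4 ≤ R ^ 2 := by
    have := pow_le_pow_left₀ (by positivity) hRl 2
    rw [sq_abs] at this
    refine le_of_eq_of_le ?_ this
    ring
  -- The error telescopes as `((P - p) Q + p (Q - q) + α (r - R)) / R`. The constant is `12 = 3 ·
  -- 4`, from a square of three terms and `|R| ≥ c K² / 2`.
  have hpt : ∀ i j k l, (P i k * (Q j l / R) - α i j k l) ^ 2 ≤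
      12 / (c ^ 2 * (K : ℝ) ^ 4) * ((P i k - p i k) ^ 2 * Q j l ^ 2 + p i k ^ 2 * (Q j l - q j l) ^ 2 +
        α i j k l ^ 2 * (R - r) ^ 2) := by
    intro i j k l
    have e : P i k * (Q j l / R) - α i j k l =
        ((P i k - p i k) * Q j l + p i k * (Q j l - q j l) + α i j k l * (r - R)) / R := by
      field_simp
      linear_combination hpq i j k l
    rw [e, div_pow]
    set x := (P i k - p i k) * Q j l
    set y := p i k * (Q j l - q j l)
    set z := α i j k l * (r - R)
    have e2 : (P i k - p i k) ^ 2 * Q j l ^ 2 + p i k ^ 2 * (Q j l - q j l) ^ 2 +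
        α i j k l ^ 2 * (R - r) ^ 2 = x ^ 2 + y ^ 2 + z ^ 2 := by simp only [x, y, z]; ring
    rw [e2]
    have h3 : (x + y + z) ^ 2 ≤ 3 * (x ^ 2 + y ^ 2 + z ^ 2) := by
      nlinarith [sq_nonneg (x - y), sq_nonneg (y - z), sq_nonneg (x - z)]
    calc (x + y + z) ^ 2 / R ^ 2 ≤ 3 * (x ^ 2 + y ^ 2 + z ^ 2) / (c ^ 2 / 4 * (K : ℝ) ^ 4) := by
          gcongr
      _ = _ := by field_simp; ring
  have hsqle : ∀ {x : ℝ}, |x| ≤ K * m → x ^ 2 ≤ (K : ℝ) ^ 2 * m ^ 2 := fun {x} hx => by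
    have := pow_le_pow_left₀ (abs_nonneg x) hx 2
    rwa [sq_abs, mul_pow] at this
  have hsum2 : ∀ {f : Fin K → Fin K → ℝ}, (∀ i k, |f i k| ≤ K * m) →
      ∑ i, ∑ k, f i k ^ 2 ≤ m ^ 2 * (K : ℝ) ^ 4 := fun {f} hf => by
    refine (Finset.sum_le_sum fun i _ => Finset.sum_le_sum fun k _ => hsqle (hf i k)).trans
      (le_of_eq ?_)
    simp; ring
  have hQ2 : ∑ j, ∑ l, Q j l ^ 2 ≤ (2 * m ^ 2 + 2) * (K : ℝ) ^ 4 := by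
    have h1 : ∀ j l, Q j l ^ 2 ≤ 2 * q j l ^ 2 + 2 * (Q j l - q j l) ^ 2 := fun j l => by
      nlinarith [sq_nonneg (Q j l - 2 * q j l)]
    refine (Finset.sum_le_sum fun i _ => Finset.sum_le_sum fun k _ => h1 i k).trans ?_
    simp only [Finset.sum_add_distrib, ← Finset.mul_sum]
    have h2 := hsum2 hq
    have h3 : η ^ 2 * (K : ℝ) ^ 4 ≤ 1 * (K : ℝ) ^ 4 := by
      gcongr
      exact pow_le_one₀ hη0 hη
    nlinarith
  have hα2 : ∑ i, ∑ j, ∑ k, ∑ l, α i j k l ^ 2 ≤ m ^ 2 * (K : ℝ) ^ 4 := by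
    have h1 : ∀ i j k l, α i j k l ^ 2 ≤ m ^ 2 := fun i j k l => by
      have := pow_le_pow_left₀ (abs_nonneg _) (hα i j k l) 2
      rwa [sq_abs] at this
    refine (Finset.sum_le_sum fun i _ => Finset.sum_le_sum fun j _ => Finset.sum_le_sum fun k _ =>
      Finset.sum_le_sum fun l _ => h1 i j k l).trans (le_of_eq ?_)
    simp; ring
  have hRr : (R - r) ^ 2 ≤ η ^ 2 * (K : ℝ) ^ 4 := by
    have := pow_le_pow_left₀ (abs_nonneg _) hR 2
    rw [sq_abs] at this
    refine this.trans_eq ?_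
    ring
  calc _ ≤ ∑ i, ∑ j, ∑ k, ∑ l, 12 / (c ^ 2 * (K : ℝ) ^ 4) * ((P i k - p i k) ^ 2 * Q j l ^ 2 +
        p i k ^ 2 * (Q j l - q j l) ^ 2 + α i j k l ^ 2 * (R - r) ^ 2) :=
        Finset.sum_le_sum fun i _ => Finset.sum_le_sum fun j _ => Finset.sum_le_sum fun k _ =>
          Finset.sum_le_sum fun l _ => hpt i j k l
    _ = 12 / (c ^ 2 * (K : ℝ) ^ 4) * ((∑ i, ∑ k, (P i k - p i k) ^ 2) * (∑ j, ∑ l, Q j l ^ 2) +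
        (∑ i, ∑ k, p i k ^ 2) * (∑ j, ∑ l, (Q j l - q j l) ^ 2) +
        (∑ i, ∑ j, ∑ k, ∑ l, α i j k l ^ 2) * (R - r) ^ 2) := by
        rw [← sum_mul_sum_four, ← sum_mul_sum_four]
        simp only [← Finset.mul_sum, Finset.sum_add_distrib, ← Finset.sum_mul]
    _ ≤ 12 / (c ^ 2 * (K : ℝ) ^ 4) * ((η ^ 2 * (K : ℝ) ^ 4) * ((2 * m ^ 2 + 2) * (K : ℝ) ^ 4) +
        (m ^ 2 * (K : ℝ) ^ 4) * (η ^ 2 * (K : ℝ) ^ 4) +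
        (m ^ 2 * (K : ℝ) ^ 4) * (η ^ 2 * (K : ℝ) ^ 4)) := by
        have := hsum2 hp
        gcongr
    _ = _ := by field_simp; ring

/-- Stability of the estimators: the partial traces of the tensor `C` are compared with those of
the separable tensor `α`. -/
theorem IsSeparableTensor.sum_sq_estimator_sub_le (h : IsSeparableTensor α) (symm : Bool) (d : ℕ)
    {C : Fin K → Fin K → Fin K → Fin K → ℝ} {c m η : ℝ}
    (hα : ∀ i j k l, |α i j k l| ≤ m) (hm : 0 ≤ m) (hc : 0 < c)
    (hr : c * (K : ℝ) ^ 2 ≤ |discTr d α|) (hK : 0 < K) (hη0 : 0 ≤ η) (hη : η ≤ 1) (hηc : η ≤ c / 2)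
    (h1 : ∑ i, ∑ k, (discTr1 d C i k - discTr1 d α i k) ^ 2 ≤ η ^ 2 * (K : ℝ) ^ 4)
    (h2 : ∑ j, ∑ l, (discTr2 d C j l - discTr2 d α j l) ^ 2 ≤ η ^ 2 * (K : ℝ) ^ 4)
    (h3 : (discTr d C - discTr d α) ^ 2 ≤ η ^ 2 * (K : ℝ) ^ 4) :
    discTr d C ≠ 0 ∧ ∑ i, ∑ j, ∑ k, ∑ l, (symmetrize symm (discTr1 d C) i k *
      symmetrize symm (fun j l => discTr2 d C j l / discTr d C) j l - α i j k l) ^ 2 ≤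
      12 / c ^ 2 * (4 * m ^ 2 + 2) * η ^ 2 * (K : ℝ) ^ 4 := by
  simp only [symmetrize_div]
  refine sum_sq_ratio_sub_le hα (h.discTr1_mul_discTr2 d) (abs_discTr1_le hm hα d)
    (abs_discTr2_le hm hα d) hc hr hK hη0 hη hηc
    ((sum_symmetrize_sub_sq_le symm _ _ (h.discTr1_symm d)).trans h1)
    ((sum_symmetrize_sub_sq_le symm _ _ (h.discTr2_symm d)).trans h2) ?_
  refine abs_le_of_sq_le_sq ?_ (by positivity)
  refine h3.trans_eq ?_
  ring

end Ratio

/-! ### Second moments of partial traces -/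

section PartialTraces

set_option linter.unusedSectionVars false

theorem sum_comp_le_of_injective {X Y : Type*} [Fintype X] [Fintype Y] {f : X → Y}
    (hf : Function.Injective f) {g : Y → ℝ} (hg : ∀ y, 0 ≤ g y) : ∑ x, g (f x) ≤ ∑ y, g y := by
  classical
  rw [← Finset.sum_image (s := Finset.univ) (g := f) (f := g) fun x _ y _ h => hf h]
  exact Finset.sum_le_univ_sum_of_nonneg hg

variable {K : ℕ} {O S : Type*} [Fintype O] [Fintype S]

/-- The partial trace `∑ₛ M[p(o,s), q(o,s)]`. -/
def partialTrace (p q : O → S → Fin K × Fin K) (M : Fin K → Fin K → Fin K → Fin K → ℝ) (o : O) : ℝ :=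
  ∑ s, M (p o s).1 (p o s).2 (q o s).1 (q o s).2

/-- The pairs of pixels `(p(o,s), q(o,s))` are those of a `d`-shifted partial trace. -/
structure IsShiftFamily (d : ℕ) (p q : O → S → Fin K × Fin K) : Prop where
  injective : Function.Injective fun x : O × S × S => (p x.1 x.2.1, q x.1 x.2.2)
  exists_left : ∃ e : O → S → Fin K, Function.Injective fun x : O × S => (p x.1 x.2, e x.1 x.2)
  exists_right : ∃ e : O → S → Fin K, Function.Injective fun x : O × S => (q x.1 x.2, e x.1 x.2)
  shift : (∀ o s, ((p o s).1 : ℕ) + d ≤ (q o s).1) ∨ (∀ o s, ((p o s).2 : ℕ) + d ≤ (q o s).2)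

namespace IsShiftFamily

variable {d : ℕ} {p q : O → S → Fin K × Fin K}

theorem left_injective (h : IsShiftFamily d p q) (o : O) : Function.Injective (p o) := by
  intro s s' hs
  have := h.injective (a₁ := (o, s, s)) (a₂ := (o, s', s)) (by simp [hs])
  simpa using this

theorem right_injective (h : IsShiftFamily d p q) (o : O) : Function.Injective (q o) := by
  intro s s' hs
  have := h.injective (a₁ := (o, s, s)) (a₂ := (o, s, s')) (by simp [hs])
  simpa using this

theorem ne (h : IsShiftFamily d p q) (hd : 0 < d) (o : O) (s : S) : p o s ≠ q o s := by
  intro heq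
  rcases h.shift with h1 | h1
  · have := h1 o s; rw [heq] at this; omega
  · have := h1 o s; rw [heq] at this; omega

/-- A swap would make one coordinate grow by `d` in both directions. This rules out the second
exceptional case of `IsNoise.fourth_uncorr`. -/
theorem not_swap (h : IsShiftFamily d p q) (hd : 0 < d) (o : O) (s s' : S) :
    ¬ (p o s = q o s' ∧ q o s = p o s') := by
  rintro ⟨h1, h2⟩
  rcases h.shift with h3 | h3
  · have h4 := h3 o s; have h5 := h3 o s'; rw [h1, h2] at h4; omega
  · have h4 := h3 o s; have h5 := h3 o s'; rw [h1, h2] at h4; omega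

/-- The auxiliary index `e` shows that each pixel occurs as `p o s` at most `K` times. -/
theorem sum_left_le (h : IsShiftFamily d p q) {g : Fin K × Fin K → ℝ} (hg : ∀ x, 0 ≤ g x) :
    ∑ o, ∑ s, g (p o s) ≤ K * ∑ x, g x := by
  obtain ⟨e, he⟩ := h.exists_left
  have := sum_comp_le_of_injective he (g := fun y : (Fin K × Fin K) × Fin K => g y.1) fun y => hg _
  simp only [Fintype.sum_prod_type (α₁ := O), Fintype.sum_prod_type (α₂ := Fin K)] at this
  refine this.trans_eq ?_
  simp [Finset.mul_sum, Fintype.sum_prod_type]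

theorem sum_right_le (h : IsShiftFamily d p q) {g : Fin K × Fin K → ℝ} (hg : ∀ x, 0 ≤ g x) :
    ∑ o, ∑ s, g (q o s) ≤ K * ∑ x, g x := by
  obtain ⟨e, he⟩ := h.exists_right
  have := sum_comp_le_of_injective he (g := fun y : (Fin K × Fin K) × Fin K => g y.1) fun y => hg _
  simp only [Fintype.sum_prod_type (α₁ := O), Fintype.sum_prod_type (α₂ := Fin K)] at this
  refine this.trans_eq ?_
  simp [Finset.mul_sum, Fintype.sum_prod_type]

/-- After Cauchy–Schwarz in `s`, the triples `(o, s, s')` index distinct pairs of pixels, so the sum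
is part of the full double sum. -/
theorem sum_sq_le (h : IsShiftFamily d p q) (g : Fin K × Fin K → ℝ) :
    ∑ o, (∑ s, g (p o s) * g (q o s)) ^ 2 ≤ (∑ x, g x ^ 2) ^ 2 := by
  calc ∑ o, (∑ s, g (p o s) * g (q o s)) ^ 2
      ≤ ∑ o, (∑ s, g (p o s) ^ 2) * ∑ s, g (q o s) ^ 2 :=
        Finset.sum_le_sum fun o _ => Finset.sum_mul_sq_le_sq_mul_sq _ _ _
    _ = ∑ x : O × S × S, g (p x.1 x.2.1) ^ 2 * g (q x.1 x.2.2) ^ 2 := by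
        simp only [Fintype.sum_prod_type, Finset.sum_mul_sum]
    _ ≤ ∑ y : (Fin K × Fin K) × (Fin K × Fin K), g y.1 ^ 2 * g y.2 ^ 2 :=
        sum_comp_le_of_injective h.injective
          (g := fun y : (Fin K × Fin K) × (Fin K × Fin K) => g y.1 ^ 2 * g y.2 ^ 2)
          fun y => by positivity
    _ = (∑ x, g x ^ 2) ^ 2 := by
        rw [sq, Finset.sum_mul_sum, Fintype.sum_prod_type]

end IsShiftFamily

variable {Ω : Type*} [MeasurableSpace Ω] {P : Measure Ω} [IsProbabilityMeasure P]

theorem integral_sum_sum_sq_le {U : O → S → Ω → ℝ} (hU : ∀ o s, MemLp (U o s) 2 P)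
    (h0 : ∀ o s s', s ≠ s' → ∫ ω, U o s ω * U o s' ω ∂P = 0) {b : O → S → ℝ}
    (hb : ∀ o s, ∫ ω, U o s ω * U o s ω ∂P ≤ b o s) :
    ∫ ω, ∑ o, (∑ s, U o s ω) ^ 2 ∂P ≤ ∑ o, ∑ s, b o s := by
  have hint : ∀ o s s', Integrable (fun ω => U o s ω * U o s' ω) P := fun o s s' =>
    (hU o s).integrable_mul (hU o s')
  simp only [sq, Finset.sum_mul_sum]
  rw [integral_finsetSum _ fun o _ => integrable_finsetSum _ fun s _ =>
    integrable_finsetSum _ fun s' _ => hint o s s']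
  refine Finset.sum_le_sum fun o _ => ?_
  rw [integral_finsetSum _ fun s _ => integrable_finsetSum _ fun s' _ => hint o s s']
  refine Finset.sum_le_sum fun s _ => ?_
  rw [integral_finsetSum _ fun s' _ => hint o s s', Finset.sum_eq_single s]
  · exact hb o s
  · intro s' _ hne
    exact h0 o s s' hne.symm
  · simp

/-- The noisy observation. -/
def noisy (D E : Ω → Fin K → Fin K → ℝ) (ω : Ω) (i j : Fin K) : ℝ := D ω i j + E ω i j

/-- The tensor product of a matrix with itself. -/
def tensorSquare (Z : Fin K → Fin K → ℝ) (i j k l : Fin K) : ℝ := Z i j * Z k l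

/-! ### Signal and noise in the partial traces of one observation -/

section Noise

variable {D E : Ω → Fin K → Fin K → ℝ} {v : ℝ}

theorem IsNoise.memLp_mul_signal (h : IsNoise P D E v)
    (hD : ∀ x : Fin K × Fin K, AEStronglyMeasurable (fun ω => D ω x.1 x.2) P)
    (x y : Fin K × Fin K) : MemLp (fun ω => E ω x.1 x.2 * D ω y.1 y.2) 2 P := by
  have hm := (h.memLp x).1.mul (hD y)
  refine (memLp_two_iff_integrable_sq hm).2 ((h.mixed_integrable x x y y).congr
    (Eventually.of_forall fun ω => ?_))
  simp only [Pi.mul_apply]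
  ring

theorem IsNoise.memLp_mul_self (h : IsNoise P D E v) {x y : Fin K × Fin K} (hxy : x ≠ y) :
    MemLp (fun ω => E ω x.1 x.2 * E ω y.1 y.2) 2 P := by
  have hm := (h.memLp x).1.mul (h.memLp y).1
  refine (memLp_two_iff_integrable_sq hm).2 ((h.fourth_integrable x y hxy).congr
    (Eventually.of_forall fun ω => ?_))
  simp only [Pi.mul_apply]
  ring

theorem IsNoise.integral_mul_signal_sq (h : IsNoise P D E v) (x x' y y' : Fin K × Fin K) :
    ∫ ω, (E ω x.1 x.2 * D ω y.1 y.2) * (E ω x'.1 x'.2 * D ω y'.1 y'.2) ∂P =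
      (∫ ω, E ω x.1 x.2 * E ω x'.1 x'.2 ∂P) * ∫ ω, D ω y.1 y.2 * D ω y'.1 y'.2 ∂P := by
  rw [← h.mixed x x' y y']
  refine integral_congr_ae (Eventually.of_forall fun ω => ?_)
  simp only
  ring

theorem memLp_two_of_pow_four {u : Ω → ℝ} (hu : AEStronglyMeasurable u P)
    (hu4 : Integrable (fun ω => u ω ^ 4) P) : MemLp u 2 P := by
  refine (memLp_two_iff_integrable_sq hu).2 ((hu4.add (integrable_const 1)).mono' (hu.pow 2)
    (Eventually.of_forall fun ω => ?_))
  simp only [Pi.add_apply, Real.norm_eq_abs]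
  rw [abs_of_nonneg (sq_nonneg _)]
  nlinarith [sq_nonneg (u ω ^ 2 - 1), sq_nonneg (u ω ^ 2)]

theorem IsNoise.memLp_noisy_mul (h : IsNoise P D E v)
    (hD : ∀ x : Fin K × Fin K, AEStronglyMeasurable (fun ω => D ω x.1 x.2) P)
    (hD4 : ∀ x : Fin K × Fin K, Integrable (fun ω => D ω x.1 x.2 ^ 4) P)
    {x y : Fin K × Fin K} (hxy : x ≠ y) :
    MemLp (fun ω => noisy D E ω x.1 x.2 * noisy D E ω y.1 y.2) 2 P := by
  have h1 := (((memLp_two_mul_of_pow_four (hD x) (hD y) (hD4 x) (hD4 y)).add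
    (h.memLp_mul_signal hD x y)).add (h.memLp_mul_signal hD y x)).add (h.memLp_mul_self hxy)
  refine h1.ae_eq (Eventually.of_forall fun ω => ?_)
  simp only [noisy, Pi.add_apply]
  ring

theorem IsNoise.integral_noisy_mul (h : IsNoise P D E v)
    (hD : ∀ x : Fin K × Fin K, AEStronglyMeasurable (fun ω => D ω x.1 x.2) P)
    (hD4 : ∀ x : Fin K × Fin K, Integrable (fun ω => D ω x.1 x.2 ^ 4) P)
    {x y : Fin K × Fin K} (hxy : x ≠ y) :
    ∫ ω, noisy D E ω x.1 x.2 * noisy D E ω y.1 y.2 ∂P = ∫ ω, D ω x.1 x.2 * D ω y.1 y.2 ∂P := by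
  have hD2 : ∀ x : Fin K × Fin K, MemLp (fun ω => D ω x.1 x.2) 2 P := fun x =>
    memLp_two_of_pow_four (hD x) (hD4 x)
  have i1 : Integrable (fun ω => D ω x.1 x.2 * D ω y.1 y.2) P := (hD2 x).integrable_mul (hD2 y)
  have i2 : Integrable (fun ω => E ω x.1 x.2 * D ω y.1 y.2) P := (h.memLp x).integrable_mul (hD2 y)
  have i3 : Integrable (fun ω => E ω y.1 y.2 * D ω x.1 x.2) P := (h.memLp y).integrable_mul (hD2 x)
  have i4 : Integrable (fun ω => E ω x.1 x.2 * E ω y.1 y.2) P :=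
    (h.memLp x).integrable_mul (h.memLp y)
  have e : ∀ ω, noisy D E ω x.1 x.2 * noisy D E ω y.1 y.2 =
      D ω x.1 x.2 * D ω y.1 y.2 + E ω x.1 x.2 * D ω y.1 y.2 + E ω y.1 y.2 * D ω x.1 x.2 +
        E ω x.1 x.2 * E ω y.1 y.2 := fun ω => by simp only [noisy]; ring
  simp only [e]
  have i12 := i1.fun_add i2
  have i123 := i12.fun_add i3
  rw [integral_add i123 i4, integral_add i12 i3, integral_add i1 i2, h.uncorr_signal,
    h.uncorr_signal, h.uncorr x y hxy]
  ring

/-- Expanding `(D + E) ⊗ (D + E)` gives four sums, whence the factor `4`. The signal sum is bounded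
outcome by outcome. In the three sums with noise the summands are orthogonal in `s`, so only
diagonal terms count; a shift `d > 0` ensures that no squared error appears in the trace itself. -/
theorem IsNoise.integral_sum_partialTrace_sq_le (h : IsNoise P D E v) (hK : 0 < K)
    (hD : ∀ x : Fin K × Fin K, AEStronglyMeasurable (fun ω => D ω x.1 x.2) P)
    (hD4 : ∀ x : Fin K × Fin K, Integrable (fun ω => D ω x.1 x.2 ^ 4) P)
    {d : ℕ} (hd : 0 < d) {p q : O → S → Fin K × Fin K} (hpq : IsShiftFamily d p q) :
    ∫ ω, ∑ o, partialTrace p q (tensorSquare (noisy D E ω)) o ^ 2 ∂P ≤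
      4 * (∫ ω, (∑ x : Fin K × Fin K, D ω x.1 x.2 ^ 2) ^ 2 ∂P +
        2 * (v * (K * ∫ ω, ∑ x : Fin K × Fin K, D ω x.1 x.2 ^ 2 ∂P)) + v ^ 2 * (K : ℝ) ^ 3) := by
  have hD2 : ∀ x : Fin K × Fin K, MemLp (fun ω => D ω x.1 x.2) 2 P := fun x =>
    memLp_two_of_pow_four (hD x) (hD4 x)
  have hv : 0 ≤ v := (integral_nonneg fun _ => sq_nonneg _).trans
    (h.var_le (⟨0, hK⟩, ⟨0, hK⟩))
  have m1 : ∀ o s, MemLp (fun ω => D ω (p o s).1 (p o s).2 * D ω (q o s).1 (q o s).2) 2 P :=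
    fun o s => memLp_two_mul_of_pow_four (hD _) (hD _) (hD4 _) (hD4 _)
  have m2 : ∀ o s, MemLp (fun ω => E ω (p o s).1 (p o s).2 * D ω (q o s).1 (q o s).2) 2 P :=
    fun o s => h.memLp_mul_signal hD _ _
  have m3 : ∀ o s, MemLp (fun ω => E ω (q o s).1 (q o s).2 * D ω (p o s).1 (p o s).2) 2 P :=
    fun o s => h.memLp_mul_signal hD _ _
  have m4 : ∀ o s, MemLp (fun ω => E ω (p o s).1 (p o s).2 * E ω (q o s).1 (q o s).2) 2 P :=
    fun o s => h.memLp_mul_self (hpq.ne hd o s)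
  have hSi : ∀ {U : O → S → Ω → ℝ}, (∀ o s, MemLp (U o s) 2 P) →
      Integrable (fun ω => ∑ o, (∑ s, U o s ω) ^ 2) P := fun {U} hU =>
    integrable_finsetSum _ fun o _ => (memLp_finsetSum _ fun s _ => hU o s).integrable_sq
  have hsumD : ∫ ω, ∑ x : Fin K × Fin K, D ω x.1 x.2 ^ 2 ∂P =
      ∑ x : Fin K × Fin K, ∫ ω, D ω x.1 x.2 * D ω x.1 x.2 ∂P := by
    rw [integral_finsetSum _ fun x _ => (hD2 x).integrable_sq]
    simp only [sq]
  have hDnn : ∀ x : Fin K × Fin K, 0 ≤ ∫ ω, D ω x.1 x.2 * D ω x.1 x.2 ∂P := fun x =>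
    integral_nonneg fun ω => mul_self_nonneg _
  have hvar : ∀ x : Fin K × Fin K, ∫ ω, E ω x.1 x.2 * E ω x.1 x.2 ∂P ≤ v := fun x => by
    have := h.var_le x
    simpa only [sq] using this
  have b1 : ∫ ω, ∑ o, (∑ s, D ω (p o s).1 (p o s).2 * D ω (q o s).1 (q o s).2) ^ 2 ∂P ≤
      ∫ ω, (∑ x : Fin K × Fin K, D ω x.1 x.2 ^ 2) ^ 2 ∂P := by
    refine integral_mono (hSi m1) (MemLp.integrable_sq (memLp_finsetSum _ fun x _ => ?_)) fun ω =>
      hpq.sum_sq_le fun x => D ω x.1 x.2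
    simpa only [sq] using memLp_two_mul_of_pow_four (hD x) (hD x) (hD4 x) (hD4 x)
  have b2 : ∫ ω, ∑ o, (∑ s, E ω (p o s).1 (p o s).2 * D ω (q o s).1 (q o s).2) ^ 2 ∂P ≤
      v * (K * ∫ ω, ∑ x : Fin K × Fin K, D ω x.1 x.2 ^ 2 ∂P) := by
    refine (integral_sum_sum_sq_le m2 (b := fun o s =>
      v * ∫ ω, D ω (q o s).1 (q o s).2 * D ω (q o s).1 (q o s).2 ∂P) (fun o s s' hne => ?_)
      fun o s => ?_).trans ?_
    · rw [h.integral_mul_signal_sq, h.uncorr _ _ fun he => hne (hpq.left_injective o he), zero_mul]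
    · rw [h.integral_mul_signal_sq]
      exact mul_le_mul_of_nonneg_right (hvar _) (hDnn _)
    · simp only [← Finset.mul_sum]
      rw [hsumD]
      exact mul_le_mul_of_nonneg_left (hpq.sum_right_le hDnn) hv
  have b3 : ∫ ω, ∑ o, (∑ s, E ω (q o s).1 (q o s).2 * D ω (p o s).1 (p o s).2) ^ 2 ∂P ≤
      v * (K * ∫ ω, ∑ x : Fin K × Fin K, D ω x.1 x.2 ^ 2 ∂P) := by
    refine (integral_sum_sum_sq_le m3 (b := fun o s =>
      v * ∫ ω, D ω (p o s).1 (p o s).2 * D ω (p o s).1 (p o s).2 ∂P) (fun o s s' hne => ?_)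
      fun o s => ?_).trans ?_
    · rw [h.integral_mul_signal_sq, h.uncorr _ _ fun he => hne (hpq.right_injective o he), zero_mul]
    · rw [h.integral_mul_signal_sq]
      exact mul_le_mul_of_nonneg_right (hvar _) (hDnn _)
    · simp only [← Finset.mul_sum]
      rw [hsumD]
      exact mul_le_mul_of_nonneg_left (hpq.sum_left_le hDnn) hv
  have b4 : ∫ ω, ∑ o, (∑ s, E ω (p o s).1 (p o s).2 * E ω (q o s).1 (q o s).2) ^ 2 ∂P ≤
      v ^ 2 * (K : ℝ) ^ 3 := by
    -- The factor `1` is the constant weight with which `sum_left_le` counts at most `K · K²` pairs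
    -- `(o, s)`.
    refine (integral_sum_sum_sq_le m4 (b := fun _ _ => v ^ 2 * 1) (fun o s s' hne => ?_)
      fun o s => ?_).trans ?_
    · have := h.fourth_uncorr (p o s) (q o s) (p o s') (q o s') (hpq.ne hd o s) (hpq.ne hd o s')
        (fun he => hne (hpq.left_injective o he.1)) (hpq.not_swap hd o s s')
      rw [← this]
      refine integral_congr_ae (Eventually.of_forall fun ω => ?_)
      simp only
      ring
    · rw [mul_one]
      refine le_of_eq_of_le (integral_congr_ae (Eventually.of_forall fun ω => ?_))
        (h.fourth_le (p o s) (q o s) (hpq.ne hd o s))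
      simp only
      ring
    · simp only [← Finset.mul_sum]
      refine mul_le_mul_of_nonneg_left ?_ (sq_nonneg v)
      refine (hpq.sum_left_le (g := fun _ => 1) fun _ => zero_le_one).trans_eq ?_
      simp
      ring
  have i1 := hSi m1
  have i2 := hSi m2
  have i3 := hSi m3
  have i4 := hSi m4
  have i12 := i1.add i2
  have i123 := i12.add i3
  have i1234 := i123.add i4
  have hpt : ∀ ω, ∑ o, partialTrace p q (tensorSquare (noisy D E ω)) o ^ 2 ≤
      4 * (∑ o, (∑ s, D ω (p o s).1 (p o s).2 * D ω (q o s).1 (q o s).2) ^ 2 +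
        ∑ o, (∑ s, E ω (p o s).1 (p o s).2 * D ω (q o s).1 (q o s).2) ^ 2 +
        ∑ o, (∑ s, E ω (q o s).1 (q o s).2 * D ω (p o s).1 (p o s).2) ^ 2 +
        ∑ o, (∑ s, E ω (p o s).1 (p o s).2 * E ω (q o s).1 (q o s).2) ^ 2) := by
    intro ω
    simp only [← Finset.sum_add_distrib, Finset.mul_sum]
    refine Finset.sum_le_sum fun o _ => ?_
    have e : partialTrace p q (tensorSquare (noisy D E ω)) o =
        ∑ s, D ω (p o s).1 (p o s).2 * D ω (q o s).1 (q o s).2 +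
        ∑ s, E ω (p o s).1 (p o s).2 * D ω (q o s).1 (q o s).2 +
        ∑ s, E ω (q o s).1 (q o s).2 * D ω (p o s).1 (p o s).2 +
        ∑ s, E ω (p o s).1 (p o s).2 * E ω (q o s).1 (q o s).2 := by
      simp only [partialTrace, ← Finset.sum_add_distrib, tensorSquare, noisy]
      exact Finset.sum_congr rfl fun s _ => by ring
    rw [e]
    generalize ∑ s, D ω (p o s).1 (p o s).2 * D ω (q o s).1 (q o s).2 = x
    generalize ∑ s, E ω (p o s).1 (p o s).2 * D ω (q o s).1 (q o s).2 = y
    generalize ∑ s, E ω (q o s).1 (q o s).2 * D ω (p o s).1 (p o s).2 = z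
    generalize ∑ s, E ω (p o s).1 (p o s).2 * E ω (q o s).1 (q o s).2 = w
    nlinarith [sq_nonneg (x - y), sq_nonneg (x - z), sq_nonneg (x - w), sq_nonneg (y - z),
      sq_nonneg (y - w), sq_nonneg (z - w)]
  refine (integral_mono_of_nonneg (Eventually.of_forall fun ω =>
    Finset.sum_nonneg fun o _ => sq_nonneg _) (i1234.const_mul 4)
    (Eventually.of_forall hpt)).trans ?_
  rw [integral_const_mul]
  have e := integral_add i123 i4
  have e2 := integral_add i12 i3
  have e3 := integral_add i1 i2
  simp only [Pi.add_apply] at e e2 e3 ⊢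
  rw [e, e2, e3]
  linarith

end Noise

end PartialTraces

/-! ### Averages of independent identically distributed variables -/

section Averages

variable {Ω : Type*} [MeasurableSpace Ω] {P : Measure Ω} [IsProbabilityMeasure P]

theorem integral_average_sub_sq_le {W : ℕ → Ω → ℝ} (hW : MemLp (W 0) 2 P)
    (hident : ∀ n, IdentDistrib (W n) (W 0) P P)
    (hindep : Pairwise fun m n => IndepFun (W m) (W n) P) {N : ℕ} (hN : 0 < N) :
    ∫ ω, (1 / (N : ℝ) * ∑ n ∈ Finset.range N, W n ω - ∫ ω', W 0 ω' ∂P) ^ 2 ∂P ≤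
      1 / (N : ℝ) * ∫ ω, W 0 ω ^ 2 ∂P := by
  have hN' : (0 : ℝ) < N := by exact_mod_cast hN
  have hWn : ∀ n, MemLp (W n) 2 P := fun n => (hident n).memLp_iff.2 hW
  have hS : MemLp (fun ω => ∑ n ∈ Finset.range N, W n ω) 2 P :=
    memLp_finsetSum _ fun n _ => hWn n
  have hmean : ∫ ω, 1 / (N : ℝ) * ∑ n ∈ Finset.range N, W n ω ∂P = ∫ ω', W 0 ω' ∂P := by
    rw [integral_const_mul, integral_finsetSum _ fun n _ => (hWn n).integrable one_le_two]
    simp only [fun n => (hident n).integral_eq, Finset.sum_const, Finset.card_range, nsmul_eq_mul]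
    field_simp
  have hvar : variance (fun ω => 1 / (N : ℝ) * ∑ n ∈ Finset.range N, W n ω) P =
      1 / (N : ℝ) * variance (W 0) P := by
    have e : (fun ω => ∑ n ∈ Finset.range N, W n ω) = ∑ n ∈ Finset.range N, W n := by
      ext ω; simp
    rw [variance_const_mul, e, IndepFun.variance_sum (fun n _ => hWn n)
      fun m _ n _ hmn => hindep hmn]
    simp only [fun n => (hident n).variance_eq, Finset.sum_const, Finset.card_range, nsmul_eq_mul]
    field_simp
  rw [← hmean, ← variance_eq_integral (hS.const_mul _).1.aemeasurable, hvar]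
  exact mul_le_mul_of_nonneg_left (variance_le_expectation_sq hW.1) (by positivity)

/-- Markov's inequality for the summed squared deviations; their expectation is at most `b/N` by
independence. -/
theorem measure_sum_average_sub_sq_le {O : Type*} [Fintype O] {W : O → ℕ → Ω → ℝ}
    (hW : ∀ o, MemLp (W o 0) 2 P) (hident : ∀ o n, IdentDistrib (W o n) (W o 0) P P)
    (hindep : ∀ o, Pairwise fun m n => IndepFun (W o m) (W o n) P) {b t : ℝ}
    (hb : ∫ ω, ∑ o, W o 0 ω ^ 2 ∂P ≤ b) (ht : 0 < t) {N : ℕ} (hN : 0 < N) :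
    P {ω | t / N < ∑ o, (1 / (N : ℝ) * ∑ n ∈ Finset.range N, W o n ω - ∫ ω', W o 0 ω' ∂P) ^ 2} ≤
      ENNReal.ofReal (b / t) := by
  have hN' : (0 : ℝ) < N := by exact_mod_cast hN
  have hWn : ∀ o n, MemLp (W o n) 2 P := fun o n => (hident o n).memLp_iff.2 (hW o)
  have hi : ∀ o, Integrable (fun ω => (1 / (N : ℝ) * ∑ n ∈ Finset.range N, W o n ω -
      ∫ ω', W o 0 ω' ∂P) ^ 2) P := fun o =>
    (((memLp_finsetSum _ fun n _ => hWn o n).const_mul _).sub (memLp_const _)).integrable_sq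
  have hle : ∫ ω, ∑ o, (1 / (N : ℝ) * ∑ n ∈ Finset.range N, W o n ω -
      ∫ ω', W o 0 ω' ∂P) ^ 2 ∂P ≤ 1 / (N : ℝ) * b := by
    rw [integral_finsetSum _ fun o _ => hi o]
    refine (Finset.sum_le_sum fun o _ =>
      integral_average_sub_sq_le (hW o) (hident o) (hindep o) hN).trans ?_
    rw [← Finset.mul_sum, ← integral_finsetSum _ fun o _ => (hW o).integrable_sq]
    exact mul_le_mul_of_nonneg_left hb (by positivity)
  have hM := mul_meas_ge_le_integral_of_nonneg (μ := P) (Eventually.of_forall fun ω =>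
    Finset.sum_nonneg fun o _ => sq_nonneg (1 / (N : ℝ) * ∑ n ∈ Finset.range N, W o n ω -
      ∫ ω', W o 0 ω' ∂P)) (integrable_finsetSum Finset.univ fun o _ => hi o) (t / N)
  refine (measure_mono (t := {ω | t / N ≤ ∑ o, (1 / (N : ℝ) * ∑ n ∈ Finset.range N, W o n ω -
      ∫ ω', W o 0 ω' ∂P) ^ 2}) (ofPred_subset_ofPred.2 fun ω h => h.le)).trans ?_
  rw [← ofReal_measureReal]
  refine ENNReal.ofReal_le_ofReal ?_
  rw [le_div_iff₀ ht]
  have := hM.trans hle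
  rw [div_mul_eq_mul_div, div_le_iff₀ hN'] at this
  calc _ = t * P.real {ω | t / N ≤ ∑ o, (1 / (N : ℝ) * ∑ n ∈ Finset.range N, W o n ω -
      ∫ ω', W o 0 ω' ∂P) ^ 2} := mul_comm _ _
    _ ≤ _ := this
    _ = b := by field_simp

end Averages

/-! ### Consistency of the partial traces of the empirical covariance -/

section EmpiricalTraces

theorem partialTrace_empCov {K : ℕ} {O S : Type*} [Fintype O] [Fintype S]
    (p q : O → S → Fin K × Fin K) (N : ℕ) (Z : ℕ → Fin K → Fin K → ℝ) (o : O) :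
    partialTrace p q (empCov N Z) o =
      1 / (N : ℝ) * ∑ n ∈ Finset.range N, partialTrace p q (tensorSquare (Z n)) o := by
  simp only [partialTrace, empCov, tensorSquare]
  rw [← Finset.mul_sum, Finset.sum_comm]

theorem measurable_partialTrace_tensorSquare {K : ℕ} {O S : Type*} [Fintype O] [Fintype S]
    (p q : O → S → Fin K × Fin K) (o : O) :
    Measurable fun Z : Fin K → Fin K → ℝ => partialTrace p q (tensorSquare Z) o := by
  simp only [partialTrace, tensorSquare]
  fun_prop

theorem sum_dite_eq_sum_subtype {ι : Type*} [Fintype ι] {Q : ι → Prop} [DecidablePred Q]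
    (f : ∀ i, Q i → ℝ) :
    (∑ i, if h : Q i then f i h else 0) = ∑ i : {i // Q i}, f i.1 i.2 := by
  calc (∑ i, if h : Q i then f i h else 0)
      = ∑ i ∈ Finset.univ.filter Q, if h : Q i then f i h else 0 :=
        (Finset.sum_filter_of_ne fun i _ hi => by
          by_contra hQ
          exact hi (dif_neg hQ)).symm
    _ = ∑ i : {i // Q i}, if h : Q i.1 then f i.1 h else 0 :=
        Finset.sum_subtype _ (by simp) _
    _ = ∑ i : {i // Q i}, f i.1 i.2 := Finset.sum_congr rfl fun i _ => dif_pos i.2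

variable {K : ℕ} (d : ℕ)

theorem discTr1_eq_partialTrace (M : Fin K → Fin K → Fin K → Fin K → ℝ) (x : Fin K × Fin K) :
    discTr1 d M x.1 x.2 = partialTrace (S := {j : Fin K // (j : ℕ) + d < K})
      (fun x j => (x.1, j.1)) (fun x j => (x.2, ⟨j.1 + d, j.2⟩)) M x :=
  sum_dite_eq_sum_subtype _

theorem discTr2_eq_partialTrace (M : Fin K → Fin K → Fin K → Fin K → ℝ) (x : Fin K × Fin K) :
    discTr2 d M x.1 x.2 = partialTrace (S := {i : Fin K // (i : ℕ) + d < K})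
      (fun x i => (i.1, x.1)) (fun x i => (⟨i.1 + d, i.2⟩, x.2)) M x :=
  sum_dite_eq_sum_subtype _

theorem discTr_eq_partialTrace (M : Fin K → Fin K → Fin K → Fin K → ℝ) (u : Unit) :
    discTr d M = partialTrace
      (S := {x : Fin K × Fin K // (x.1 : ℕ) + d < K ∧ (x.2 : ℕ) + d < K})
      (fun _ x => x.1) (fun _ x => (⟨x.1.1 + d, x.2.1⟩, ⟨x.1.2 + d, x.2.2⟩)) M u := by
  rw [discTr, ← Fintype.sum_prod_type' (f := fun i j : Fin K =>
    if h : (i : ℕ) + d < K ∧ (j : ℕ) + d < K then M i j ⟨i + d, h.1⟩ ⟨j + d, h.2⟩ else 0)]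
  exact sum_dite_eq_sum_subtype (Q := fun x : Fin K × Fin K => (x.1 : ℕ) + d < K ∧ (x.2 : ℕ) + d < K)
    fun x h => M x.1 x.2 ⟨x.1 + d, h.1⟩ ⟨x.2 + d, h.2⟩

theorem isShiftFamily_discTr1 : IsShiftFamily (K := K) (O := Fin K × Fin K)
    (S := {j : Fin K // (j : ℕ) + d < K}) d
    (fun x j => (x.1, j.1)) (fun x j => (x.2, ⟨j.1 + d, j.2⟩)) where
  injective := by
    rintro ⟨⟨i, k⟩, ⟨j, hj⟩, ⟨l, hl⟩⟩ ⟨⟨i', k'⟩, ⟨j', hj'⟩, ⟨l', hl'⟩⟩ h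
    simp only [Prod.mk.injEq, Fin.mk.injEq, Nat.add_right_cancel_iff, Fin.val_inj] at h
    simp [h]
  exists_left := ⟨fun x _ => x.2, by
    rintro ⟨⟨i, k⟩, ⟨j, hj⟩⟩ ⟨⟨i', k'⟩, ⟨j', hj'⟩⟩ h
    simp only [Prod.mk.injEq] at h
    simp [h]⟩
  exists_right := ⟨fun x _ => x.1, by
    rintro ⟨⟨i, k⟩, ⟨j, hj⟩⟩ ⟨⟨i', k'⟩, ⟨j', hj'⟩⟩ h
    simp only [Prod.mk.injEq, Fin.mk.injEq, Nat.add_right_cancel_iff, Fin.val_inj] at h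
    simp [h]⟩
  shift := Or.inr fun _ _ => le_rfl

theorem isShiftFamily_discTr2 : IsShiftFamily (K := K) (O := Fin K × Fin K)
    (S := {i : Fin K // (i : ℕ) + d < K}) d
    (fun x i => (i.1, x.1)) (fun x i => (⟨i.1 + d, i.2⟩, x.2)) where
  injective := by
    rintro ⟨⟨i, k⟩, ⟨j, hj⟩, ⟨l, hl⟩⟩ ⟨⟨i', k'⟩, ⟨j', hj'⟩, ⟨l', hl'⟩⟩ h
    simp only [Prod.mk.injEq, Fin.mk.injEq, Nat.add_right_cancel_iff, Fin.val_inj] at h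
    simp [h]
  exists_left := ⟨fun x _ => x.2, by
    rintro ⟨⟨i, k⟩, ⟨j, hj⟩⟩ ⟨⟨i', k'⟩, ⟨j', hj'⟩⟩ h
    simp only [Prod.mk.injEq] at h
    simp [h]⟩
  exists_right := ⟨fun x _ => x.1, by
    rintro ⟨⟨i, k⟩, ⟨j, hj⟩⟩ ⟨⟨i', k'⟩, ⟨j', hj'⟩⟩ h
    simp only [Prod.mk.injEq, Fin.mk.injEq, Nat.add_right_cancel_iff, Fin.val_inj] at h
    simp [h]⟩
  shift := Or.inl fun _ _ => le_rfl

/-- For the full trace the first or the second pixel alone already determines the summand, so the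
auxiliary index is arbitrary. -/
theorem isShiftFamily_discTr : IsShiftFamily (K := K) (O := Unit)
    (S := {x : Fin K × Fin K // (x.1 : ℕ) + d < K ∧ (x.2 : ℕ) + d < K}) d
    (fun _ x => x.1) (fun _ x => (⟨x.1.1 + d, x.2.1⟩, ⟨x.1.2 + d, x.2.2⟩)) where
  injective := by
    rintro ⟨_, ⟨⟨i, j⟩, hj⟩, ⟨⟨k, l⟩, hl⟩⟩ ⟨_, ⟨⟨i', j'⟩, hj'⟩, ⟨⟨k', l'⟩, hl'⟩⟩ h
    simp only [Prod.mk.injEq, Fin.mk.injEq, Nat.add_right_cancel_iff, Fin.val_inj] at h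
    simp [h]
  exists_left := ⟨fun _ x => x.1.1, by
    rintro ⟨_, ⟨⟨i, j⟩, hj⟩⟩ ⟨_, ⟨⟨i', j'⟩, hj'⟩⟩ h
    simp only [Prod.mk.injEq] at h
    simp [h]⟩
  exists_right := ⟨fun _ x => x.1.1, by
    rintro ⟨_, ⟨⟨i, j⟩, hj⟩⟩ ⟨_, ⟨⟨i', j'⟩, hj'⟩⟩ h
    simp only [Prod.mk.injEq, Fin.mk.injEq, Nat.add_right_cancel_iff, Fin.val_inj] at h
    simp [h]⟩
  shift := Or.inl fun _ _ => le_rfl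

variable {d} {Ω : Type*} [MeasurableSpace Ω] {P : Measure Ω} [IsProbabilityMeasure P]

/-- Distinct pixels at the prescribed shift make the empirical partial trace unbiased for that of
`α`; the second moment bound then gives a deviation of order `1/N`. -/
theorem measure_partialTrace_empCov_sub_le {O S : Type*} [Fintype O] [Fintype S] (hd : 0 < d)
    {p q : O → S → Fin K × Fin K} (hpq : IsShiftFamily d p q)
    {D E : ℕ → Ω → Fin K → Fin K → ℝ} {v : ℝ} (h : IsNoise P (D 0) (E 0) v)
    (hD : ∀ x : Fin K × Fin K, AEStronglyMeasurable (fun ω => D 0 ω x.1 x.2) P)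
    (hD4 : ∀ x : Fin K × Fin K, Integrable (fun ω => D 0 ω x.1 x.2 ^ 4) P)
    (hident : ∀ n, IdentDistrib (noisy (D n) (E n)) (noisy (D 0) (E 0)) P P)
    (hindep : Pairwise fun m n => IndepFun (noisy (D m) (E m)) (noisy (D n) (E n)) P)
    {α : Fin K → Fin K → Fin K → Fin K → ℝ}
    (hα : ∀ x y : Fin K × Fin K, ((x.1 : ℕ) + d ≤ y.1 ∨ (x.2 : ℕ) + d ≤ y.2) →
      ∫ ω, D 0 ω x.1 x.2 * D 0 ω y.1 y.2 ∂P = α x.1 x.2 y.1 y.2)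
    {b t : ℝ} (hb : 4 * (∫ ω, (∑ x : Fin K × Fin K, D 0 ω x.1 x.2 ^ 2) ^ 2 ∂P +
        2 * (v * (K * ∫ ω, ∑ x : Fin K × Fin K, D 0 ω x.1 x.2 ^ 2 ∂P)) + v ^ 2 * (K : ℝ) ^ 3) ≤ b)
    (hK : 0 < K) (ht : 0 < t) {N : ℕ} (hN : 0 < N) :
    P {ω | t / N < ∑ o, (partialTrace p q (empCov N fun n => noisy (D n) (E n) ω) o -
      partialTrace p q α o) ^ 2} ≤ ENNReal.ofReal (b / t) := by
  have hm : ∀ o s, MemLp (fun ω => noisy (D 0) (E 0) ω (p o s).1 (p o s).2 *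
      noisy (D 0) (E 0) ω (q o s).1 (q o s).2) 2 P := fun o s =>
    h.memLp_noisy_mul hD hD4 (hpq.ne hd o s)
  have hmean : ∀ o, ∫ ω, partialTrace p q (tensorSquare (noisy (D 0) (E 0) ω)) o ∂P =
      partialTrace p q α o := fun o => by
    simp only [partialTrace, tensorSquare]
    rw [integral_finsetSum _ fun s _ => (hm o s).integrable one_le_two]
    refine Finset.sum_congr rfl fun s _ => ?_
    rw [h.integral_noisy_mul hD hD4 (hpq.ne hd o s), hα]
    exact hpq.shift.imp (fun h => h o s) fun h => h o s
  have key := measure_sum_average_sub_sq_le (P := P)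
    (W := fun o n ω => partialTrace p q (tensorSquare (noisy (D n) (E n) ω)) o)
    (fun o => memLp_finsetSum _ fun s _ => hm o s)
    (fun o n => (hident n).comp (measurable_partialTrace_tensorSquare p q o))
    (fun o m n hmn => (hindep hmn).comp (measurable_partialTrace_tensorSquare p q o)
      (measurable_partialTrace_tensorSquare p q o))
    ((h.integral_sum_partialTrace_sq_le hK hD hD4 hd hpq).trans hb) ht hN
  simp only [hmean, ← partialTrace_empCov p q N fun n => noisy (D n) (E n) _] at key
  exact key

end EmpiricalTraces

/-! ### Consistency of the estimators -/

section Consistency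

variable {Ω : Type*} [MeasurableSpace Ω] {P : Measure Ω} [IsProbabilityMeasure P]

/-- The pure noise part `v² K³` is of order `K⁴` because `v = O(√K)`. The mixed part `v K · K²`
would tolerate `v = O(K)`. -/
theorem exists_second_moment_bound {D : (K : ℕ) → Ω → Fin K → Fin K → ℝ}
    (hDm : ∀ K (x : Fin K × Fin K), AEStronglyMeasurable (fun ω => D K ω x.1 x.2) P)
    {κ : ℝ} (hκ : ∀ K, (∀ x : Fin K × Fin K, Integrable (fun ω => D K ω x.1 x.2 ^ 4) P) ∧
      ∫ ω, (∑ x : Fin K × Fin K, D K ω x.1 x.2 ^ 2) ^ 2 ∂P ≤ κ * (K : ℝ) ^ 4)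
    {v : ℕ → ℝ} (hv : v =O[atTop] fun K : ℕ => Real.sqrt K) (hv0 : ∀ K, 0 < K → 0 ≤ v K) :
    ∃ b : ℝ, 0 < b ∧ ∀ᶠ K : ℕ in atTop,
      4 * (∫ ω, (∑ x : Fin K × Fin K, D K ω x.1 x.2 ^ 2) ^ 2 ∂P +
        2 * (v K * (K * ∫ ω, ∑ x : Fin K × Fin K, D K ω x.1 x.2 ^ 2 ∂P)) +
        v K ^ 2 * (K : ℝ) ^ 3) ≤ b * (K : ℝ) ^ 4 := by
  obtain ⟨c, hc0, hc⟩ := hv.exists_pos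
  have hκ0 : 0 ≤ κ := by
    have := (integral_nonneg fun ω => sq_nonneg (∑ x : Fin 1 × Fin 1, D 1 ω x.1 x.2 ^ 2)).trans
      (hκ 1).2
    simpa using this
  refine ⟨4 * (κ + c * (κ + 1) + c ^ 2), by positivity, ?_⟩
  filter_upwards [hc.bound, eventually_ge_atTop 1] with K hK hK1
  have hK' : (1 : ℝ) ≤ K := by exact_mod_cast hK1
  have hK0 : (0 : ℝ) < K := by linarith
  have hvK := hv0 K hK1
  rw [Real.norm_of_nonneg hvK, Real.norm_of_nonneg (Real.sqrt_nonneg _)] at hK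
  have hs : Real.sqrt K ≤ K := Real.sqrt_le_iff.2 ⟨by positivity, by nlinarith⟩
  have hv1 : v K ≤ c * K := hK.trans (mul_le_mul_of_nonneg_left hs hc0.le)
  have hv2 : v K ^ 2 ≤ c ^ 2 * K := by
    calc v K ^ 2 ≤ (c * Real.sqrt K) ^ 2 := pow_le_pow_left₀ hvK hK 2
      _ = c ^ 2 * K := by rw [mul_pow, Real.sq_sqrt hK0.le]
  have hD2 : ∀ x : Fin K × Fin K, MemLp (fun ω => D K ω x.1 x.2) 2 P := fun x =>
    memLp_two_of_pow_four (hDm K x) ((hκ K).1 x)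
  have hi : Integrable (fun ω => (∑ x : Fin K × Fin K, D K ω x.1 x.2 ^ 2) ^ 2) P :=
    MemLp.integrable_sq (memLp_finsetSum _ fun x _ => by
      simpa only [sq] using memLp_two_mul_of_pow_four (hDm K x) (hDm K x) ((hκ K).1 x) ((hκ K).1 x))
  -- The first moment of the energy comes from the second through `x ≤ x² / (2K²) + K² / 2`.
  have hm : ∫ ω, ∑ x : Fin K × Fin K, D K ω x.1 x.2 ^ 2 ∂P ≤ (κ + 1) / 2 * (K : ℝ) ^ 2 := by
    have h1 : ∫ ω, ∑ x : Fin K × Fin K, D K ω x.1 x.2 ^ 2 ∂P ≤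
        ∫ ω, (1 / (2 * (K : ℝ) ^ 2) * (∑ x : Fin K × Fin K, D K ω x.1 x.2 ^ 2) ^ 2 +
          (K : ℝ) ^ 2 / 2) ∂P := by
      refine integral_mono (integrable_finsetSum _ fun x _ => (hD2 x).integrable_sq)
        ((hi.const_mul _).fun_add (integrable_const _)) fun ω => ?_
      simp only
      generalize ∑ x : Fin K × Fin K, D K ω x.1 x.2 ^ 2 = x
      rw [← sub_nonneg]
      have : 1 / (2 * (K : ℝ) ^ 2) * x ^ 2 + (K : ℝ) ^ 2 / 2 - x =
          (x - (K : ℝ) ^ 2) ^ 2 / (2 * (K : ℝ) ^ 2) := by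
        field_simp
        ring
      rw [this]
      positivity
    rw [integral_add (hi.const_mul _) (integrable_const _), integral_const_mul,
      integral_const] at h1
    simp only [probReal_univ, one_smul] at h1
    have h2 := mul_le_mul_of_nonneg_left (hκ K).2 (show 0 ≤ 1 / (2 * (K : ℝ) ^ 2) by positivity)
    have h3 : 1 / (2 * (K : ℝ) ^ 2) * (κ * (K : ℝ) ^ 4) = κ / 2 * (K : ℝ) ^ 2 := by
      field_simp
    linarith
  have hm0 : 0 ≤ ∫ ω, ∑ x : Fin K × Fin K, D K ω x.1 x.2 ^ 2 ∂P :=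
    integral_nonneg fun ω => Finset.sum_nonneg fun x _ => sq_nonneg _
  have e1 : v K * (K * ∫ ω, ∑ x : Fin K × Fin K, D K ω x.1 x.2 ^ 2 ∂P) ≤
      c * K * (K * ((κ + 1) / 2 * (K : ℝ) ^ 2)) := by gcongr
  have e2 : v K ^ 2 * (K : ℝ) ^ 3 ≤ c ^ 2 * K * (K : ℝ) ^ 3 := by gcongr
  have e3 := (hκ K).2
  linarith

variable {X : ℕ → Ω → L2Q} {D E : (K : ℕ) → ℕ → Ω → Fin K → Fin K → ℝ}
  {A₁ A₂ : L2I →L[ℝ] L2I} {A B : L2Q →L[ℝ] L2Q} {a : ℝ × ℝ → ℝ × ℝ → ℝ} {L δ : ℝ} {σsq : ℕ → ℝ}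

/-- The separable component has pixelated versions `AK K` which approximate it up to the
discretization bias, and which the estimators approximate up to a stochastic error, uniformly in
the resolution. -/
theorem exists_approx_estimators (hX_meas : ∀ n, Measurable (X n))
    (h_indep : ∀ K, iIndepFun (fun n ω => (X n ω, E K n ω)) P)
    (h_ident : ∀ K n, IdentDistrib (fun ω => (X n ω, E K n ω)) (fun ω => (X 0 ω, E K 0 ω)) P P)
    (hX_fourth : MemLp (X 0) 4 P) (hX_mean : ∫ ω, X 0 ω ∂P = 0)
    (hA₁ : A₁.IsPositive) (hA₂ : A₂.IsPositive) (hA : IsTensorOp A₁ A₂ A)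
    (hX_cov : IsCovariance P (X 0) (A + B)) (ha : HasKernel A a)
    (hL : 0 < L) (ha_lip : LipschitzKernel L a)
    (hδ : δ ∈ Ico (0 : ℝ) 1) (hB_band : IsBanded B δ) (h_trace : shiftedTrace δ a ≠ 0)
    (h_sample : PointSampled P X D ∨ PixelSampled X D)
    (hσ : σsq =O[atTop] fun K : ℕ => Real.sqrt K)
    (h_noise : ∀ K n, IsNoise P (D K n) (E K n) (σsq K)) (symm : Bool) :
    ∃ (K₀ : ℕ) (AK : ℕ → L2Q →L[ℝ] L2Q), 0 < K₀ ∧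
      (∀ K ≥ K₀, ∀ x y, 0 ≤ ⟪AK K (tensorFun x y), tensorFun x y⟫) ∧
      (∀ K ≥ K₀, hsNormSq (AK K - A) ≤ ENNReal.ofReal (4 / 3 * L ^ 2 / (K : ℝ) ^ 2)) ∧
      ∀ ε : ℝ, 0 < ε → ∃ (M : ℝ) (N₀ : ℕ), 0 ≤ M ∧ ∀ N ≥ N₀, ∀ K ≥ K₀,
        P {ω | ¬ (trHat δ N (noisyData D E K ω) ≠ 0 ∧
          hsNormSq (contOpTensor (A1Hat symm δ N (noisyData D E K ω))
            (A2Hat symm δ N (noisyData D E K ω)) - AK K) ≤ ENNReal.ofReal (M / N))} ≤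
          ENNReal.ofReal ε := by
  obtain ⟨κ, hκ⟩ := exists_moment_bound hX_fourth h_sample
  obtain ⟨m, hm0, hm⟩ := ha_lip.exists_bound
  choose g hg hgD using exists_measurable_sampling h_sample
  choose α hαs hαa hαD using fun K => exists_sampled_tensor hX_meas hX_mean hA₁ hA₂ hA hX_cov ha
    ha_lip.continuousOn hB_band h_sample K (le_discBandwidth (δ := δ) K)
  obtain ⟨c, hc0, hc⟩ := exists_discTr_bound ha_lip hL.le hδ h_trace hαa
  have hDm : ∀ K (x : Fin K × Fin K), AEStronglyMeasurable (fun ω => D K 0 ω x.1 x.2) P :=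
    fun K x => by
      simp only [hgD]
      exact ((measurable_pi_apply x.2).comp ((measurable_pi_apply x.1).comp
        ((hg K).comp (hX_meas 0)))).aestronglyMeasurable
  obtain ⟨b, hb0, hb⟩ := exists_second_moment_bound hDm hκ hσ fun K hK =>
    (integral_nonneg fun _ => sq_nonneg _).trans ((h_noise K 0).var_le (⟨0, hK⟩, ⟨0, hK⟩))
  -- The choice of `K₀` involves only the lower bound on the shifted trace and the moment bound,
  -- hence neither `ε` nor the eigenvalue indices.
  obtain ⟨K₀, hK₀⟩ := eventually_atTop.1 ((hc.and hb).and (eventually_gt_atTop 0))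
  have hdpos : ∀ K, 0 < discBandwidth δ K := fun K => Nat.succ_pos _
  have hmeas : ∀ K, Measurable fun z : L2Q × (Fin K → Fin K → ℝ) => g K z.1 + z.2 := fun K =>
    ((hg K).comp measurable_fst).add measurable_snd
  -- As a measurable image of the pairs `(X n, E K n)`, the noisy data inherit independence and the
  -- common law.
  have hnoisy : ∀ K n, noisy (D K n) (E K n) =
      (fun z : L2Q × (Fin K → Fin K → ℝ) => g K z.1 + z.2) ∘ fun ω => (X n ω, E K n ω) := by
    intro K n
    ext ω i j
    simp [noisy, hgD]
  have hid : ∀ K n, IdentDistrib (noisy (D K n) (E K n)) (noisy (D K 0) (E K 0)) P P := by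
    intro K n
    rw [hnoisy, hnoisy]
    exact (h_ident K n).comp (hmeas K)
  have hind : ∀ K, Pairwise fun n n' =>
      IndepFun (noisy (D K n) (E K n)) (noisy (D K n') (E K n')) P := by
    intro K n n' hne
    rw [hnoisy, hnoisy]
    exact ((h_indep K).indepFun hne).comp (hmeas K) (hmeas K)
  have hr0 : ∀ K ≥ K₀, discTr (discBandwidth δ K) (α K) ≠ 0 := fun K hK => by
    have hK' : (0 : ℝ) < K := by exact_mod_cast (hK₀ K hK).2
    exact abs_pos.1 ((by positivity : (0 : ℝ) < c * (K : ℝ) ^ 2).trans_le (hK₀ K hK).1.1)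
  have hmul : ∀ K ≥ K₀, ∀ i j k l, discTr1 (discBandwidth δ K) (α K) i k *
      (discTr2 (discBandwidth δ K) (α K) j l / discTr (discBandwidth δ K) (α K)) =
        α K i j k l := fun K hK i j k l => by
    rw [← mul_div_assoc, (hαs K).discTr1_mul_discTr2, mul_div_assoc, div_self (hr0 K hK), mul_one]
  -- By `hmul` this operator has the step kernel with values `α K`. Writing it through the partial
  -- traces puts it in the form of the estimators.
  refine ⟨K₀, fun K => contOpTensor (discTr1 (discBandwidth δ K) (α K)) fun j l =>
    discTr2 (discBandwidth δ K) (α K) j l / discTr (discBandwidth δ K) (α K),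
    (hK₀ K₀ le_rfl).2, fun K hK x y => ?_, fun K hK => ?_, fun ε hε => ?_⟩
  · simp only [inner_contOpTensor_tensorFun, hmul K hK]
    exact (hαs K).nonneg _ _
  · refine hsNormSq_contOpTensor_sub_kernel_le (hK₀ K hK).2 ha ha_lip fun p q => ?_
    rw [hmul K hK]
    exact hαa K p q
  · set ρ := min 1 (c / 2) with hρ
    have hρ0 : 0 < ρ := lt_min one_pos (by positivity)
    -- Each of the three trace deviations exceeds `t K⁴ / N` with probability at most `b / t = ε /
    -- 3`.
    set t := 3 * b / ε with ht
    have ht0 : 0 < t := by positivity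
    -- The bound is the quotient stability constant with `η² = t / N`; the condition on `N` makes `η
    -- ≤ min 1 (c / 2)`.
    refine ⟨12 / c ^ 2 * (4 * m ^ 2 + 2) * t, ⌈t / ρ ^ 2⌉₊ + 1, by positivity,
      fun N hN K hK => ?_⟩
    have hN0 : 0 < N := lt_of_lt_of_le (Nat.succ_pos _) hN
    have hN' : (0 : ℝ) < N := by exact_mod_cast hN0
    have hK0 := (hK₀ K hK).2
    have hK' : (0 : ℝ) < K := by exact_mod_cast hK0
    set η := Real.sqrt (t / N) with hη
    have hη2 : η ^ 2 = t / N := Real.sq_sqrt (by positivity)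
    have hηρ : η ≤ ρ := by
      refine Real.sqrt_le_iff.2 ⟨hρ0.le, ?_⟩
      rw [div_le_iff₀ hN', mul_comm, ← div_le_iff₀ (by positivity)]
      refine (Nat.le_ceil _).trans ?_
      exact_mod_cast (Nat.le_succ _).trans hN
    have hprob : ∀ {O S : Type} [Fintype O] [Fintype S] {p q : O → S → Fin K × Fin K}
        (_ : IsShiftFamily (discBandwidth δ K) p q),
        P {ω | t * (K : ℝ) ^ 4 / N < ∑ o, (partialTrace p q (empCov N (noisyData D E K ω)) o -
          partialTrace p q (α K) o) ^ 2} ≤ ENNReal.ofReal (ε / 3) := by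
      intro O S _ _ p q hpq
      have := measure_partialTrace_empCov_sub_le (t := t * (K : ℝ) ^ 4) (hdpos K) hpq (h_noise K 0)
        (hDm K) (hκ K).1 (hid K) (hind K) (hαD K) (hK₀ K hK).1.2 hK0 (by positivity) hN0
      refine this.trans_eq ?_
      congr 1
      rw [ht]
      field_simp
    have h1 := hprob (isShiftFamily_discTr1 (K := K) (discBandwidth δ K))
    have h2 := hprob (isShiftFamily_discTr2 (K := K) (discBandwidth δ K))
    have h3 := hprob (isShiftFamily_discTr (K := K) (discBandwidth δ K))
    simp only [← discTr1_eq_partialTrace] at h1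
    simp only [← discTr2_eq_partialTrace] at h2
    simp only [← discTr_eq_partialTrace] at h3
    refine (measure_mono ?_).trans ((measure_union_le _ _).trans
      (add_le_add ((measure_union_le _ _).trans (add_le_add h1 h2)) h3)) |>.trans_eq ?_
    · intro ω hω
      by_contra hcon
      simp only [mem_union, mem_ofPred_eq, not_or, not_lt, Fintype.sum_prod_type,
        Fintype.sum_unique] at hcon
      refine hω ?_
      have e : t * (K : ℝ) ^ 4 / N = η ^ 2 * (K : ℝ) ^ 4 := by rw [hη2]; ring
      rw [e] at hcon
      obtain ⟨g1, g2⟩ := (hαs K).sum_sq_estimator_sub_le symm (discBandwidth δ K)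
        (fun i j k l => by
          obtain ⟨y, hy, y', hy', heq⟩ := hαa K (i, j) (k, l)
          rw [heq]
          exact hm _ (closedPixel_subset _ hy) _ (closedPixel_subset _ hy'))
        hm0 hc0 (hK₀ K hK).1.1 hK0 (Real.sqrt_nonneg _) (hηρ.trans (min_le_left _ _))
        (hηρ.trans (min_le_right _ _)) hcon.1.1 hcon.1.2 hcon.2
      refine ⟨g1, (hsNormSq_contOpTensor_sub_le hK0 _ _ _ _).trans (ENNReal.ofReal_le_ofReal ?_)⟩
      rw [div_le_iff₀ (by positivity)]
      simp only [hmul K hK]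
      refine g2.trans_eq ?_
      rw [hη2]
      ring
    · rw [← ENNReal.ofReal_add (by positivity) (by positivity),
        ← ENNReal.ofReal_add (by positivity) (by positivity)]
      congr 1
      ring

/-- An operator with a nontrivial shifted trace does not vanish on all product functions. -/
theorem IsTensorOp.right_ne_zero (hA : IsTensorOp A₁ A₂ A) (ha : HasKernel A a) (hL : 0 ≤ L)
    (ha_lip : LipschitzKernel L a) (hδ : δ ∈ Ico (0 : ℝ) 1) (h_trace : shiftedTrace δ a ≠ 0) :
    A₂ ≠ 0 := by
  rintro rfl
  have h0 : ∀ x y, A (tensorFun x y) = 0 := fun x y => by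
    rw [hA, ← norm_eq_zero, norm_tensorFun]
    simp
  -- All averages of `a` over pairs of pixels vanish, so the zero tensor is a sampled version of
  -- `a`, although its shifted trace would have to be bounded below.
  have hz : ∀ (K : ℕ) (p q : Fin K × Fin K), ∃ y ∈ closedPixel K p, ∃ y' ∈ closedPixel K q,
      (0 : ℝ) = a y y' := fun K p q => by
    obtain ⟨y, hy, y', hy', heq⟩ := ha.exists_inner_rect_eq ha_lip.continuousOn
      (zero_le_cell p.1) (div_lt_succ_div p.1) (cell_le_one p.1)
      (zero_le_cell p.2) (div_lt_succ_div p.2) (cell_le_one p.2)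
      (zero_le_cell q.1) (div_lt_succ_div q.1) (cell_le_one q.1)
      (zero_le_cell q.2) (div_lt_succ_div q.2) (cell_le_one q.2)
    refine ⟨y, hy, y', hy', ?_⟩
    rw [h0, inner_zero_right] at heq
    have := sub_pos.2 (div_lt_succ_div p.1)
    have := sub_pos.2 (div_lt_succ_div p.2)
    have := sub_pos.2 (div_lt_succ_div q.1)
    have := sub_pos.2 (div_lt_succ_div q.2)
    exact ((mul_eq_zero.1 heq.symm).resolve_right (by positivity)).symm
  obtain ⟨c, hc0, hc⟩ := exists_discTr_bound ha_lip hL hδ h_trace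
    (α := fun _ _ _ _ _ => 0) hz
  obtain ⟨K, hK, hK0⟩ := (hc.and (eventually_gt_atTop 0)).exists
  have hK' : (0 : ℝ) < K := by exact_mod_cast hK0
  have : 0 < c * (K : ℝ) ^ 2 := by positivity
  simp [discTr] at hK
  linarith

end Consistency

end

/-! ### The rates, as deterministic consequences of one good event -/

theorem theorem3
    {Ω : Type*} [MeasurableSpace Ω] (P : Measure Ω) [IsProbabilityMeasure P]
    -- the surfaces, their noiseless discrete versions, and the measurement errors
    (X : ℕ → Ω → L2Q) (D E : (K : ℕ) → ℕ → Ω → Fin K → Fin K → ℝ)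
    (hX_meas : ∀ n, Measurable (X n)) (hE_meas : ∀ K n, Measurable (E K n))
    (h_indep : ∀ K, iIndepFun (fun n ω => (X n ω, E K n ω)) P)
    (h_ident : ∀ K n, IdentDistrib (fun ω => (X n ω, E K n ω)) (fun ω => (X 0 ω, E K 0 ω)) P P)
    (hX_fourth : MemLp (X 0) 4 P) (hX_mean : ∫ ω, X 0 ω ∂P = 0)
    -- the separable-plus-banded covariance
    (A₁ A₂ : L2I →L[ℝ] L2I) (A B : L2Q →L[ℝ] L2Q)
    (hA₁ : IsPosTraceClass A₁) (hA₂ : IsPosTraceClass A₂) (hA : IsTensorOp A₁ A₂ A)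
    (hB : IsPosTraceClass B) (hX_cov : IsCovariance P (X 0) (A + B))
    (a : ℝ × ℝ → ℝ × ℝ → ℝ) (ha : HasKernel A a)
    (L : ℝ) (hL : 0 < L) (ha_lip : LipschitzKernel L a)
    (δ : ℝ) (hδ : δ ∈ Ico (0 : ℝ) 1) (hB_band : IsBanded B δ) (h_trace : shiftedTrace δ a ≠ 0)
    -- the sampling scheme and the noise level
    (h_sample : PointSampled P X D ∨ PixelSampled X D)
    (σsq : ℕ → ℝ) (hσ : σsq =O[atTop] fun K : ℕ => Real.sqrt K)
    (h_noise : ∀ K n, IsNoise P (D K n) (E K n) (σsq K))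
    -- the estimators with or without symmetrization
    (symm : Bool) :
    ∃ K₀ : ℕ,
      HasRate P K₀ (fun K => 2 * L ^ 2 / (K : ℝ) ^ 2) (fun N K r ω =>
        trHat δ N (noisyData D E K ω) ≠ 0 ∧
        hsNormSq (contOpTensor (A1Hat symm δ N (noisyData D E K ω))
          (A2Hat symm δ N (noisyData D E K ω)) - A) ≤ ENNReal.ofReal r) ∧
      ∀ (lam rho : ℕ → ℝ) (e f : ℕ → L2I),
        IsEigendecomposition A₁ lam e → IsEigendecomposition A₂ rho f →
        (∀ i j : ℕ, HasRate P K₀ (fun K => 2 * L ^ 2 / (K : ℝ) ^ 2) (fun N K r ω =>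
          trHat δ N (noisyData D E K ω) ≠ 0 ∧
          ∀ (lam' rho' : ℕ → ℝ) (e' f' : ℕ → L2I),
            IsEigendecomposition (contOp (A1Hat symm δ N (noisyData D E K ω))) lam' e' →
            IsEigendecomposition (contOp (A2Hat symm δ N (noisyData D E K ω))) rho' f' →
            |lam' i * rho' j - lam i * rho j| ^ 2 ≤ r)) ∧
        (∀ j : ℕ,
          Module.finrank ℝ (Module.End.eigenspace (A₁ : L2I →ₗ[ℝ] L2I) (lam j)) = 1 →
          ∃ c : ℝ, HasRate P K₀ (fun K => c * (2 * L ^ 2 / (K : ℝ) ^ 2)) (fun N K r ω =>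
            trHat δ N (noisyData D E K ω) ≠ 0 ∧
            ∀ (lam' : ℕ → ℝ) (e' : ℕ → L2I),
              IsEigendecomposition (contOp (A1Hat symm δ N (noisyData D E K ω))) lam' e' →
              ‖e' j - Real.sign ⟪e' j, e j⟫ • e j‖ ^ 2 ≤ r)) := by
  obtain ⟨K₀, AK, hK₀, hAK, hbias, hstoch⟩ := exists_approx_estimators hX_meas h_indep
    h_ident hX_fourth hX_mean hA₁.1 hA₂.1 hA hX_cov ha hL ha_lip hδ hB_band h_trace h_sample hσ
    h_noise symm
  -- The weight `3/2` on the bias `4/3 · L² / K²` gives the stated constant `2`.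
  have htotal : ∀ {M : ℝ} {N K : ℕ} {T : L2Q →L[ℝ] L2Q}, 0 ≤ M → K₀ ≤ K →
      hsNormSq (T - AK K) ≤ ENNReal.ofReal (M / N) →
      hsNormSq (T - A) ≤ ENNReal.ofReal (3 * M / N + 2 * L ^ 2 / (K : ℝ) ^ 2) := by
    intro M N K T hM hK hT
    have := hsNormSq_add_le (by positivity) (by positivity) hT (hbias K hK)
    rw [sub_add_sub_cancel] at this
    refine this.trans_eq (congrArg _ ?_)
    ring
  refine ⟨K₀, fun ε hε => ?_, fun lam rho e f he hf => ⟨fun i j ε hε => ?_, fun j hj => ?_⟩⟩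
  · obtain ⟨M, N₀, hM, h⟩ := hstoch ε hε
    refine ⟨3 * M, N₀, fun N hN K hK =>
      (measure_mono (ofPred_subset_ofPred.2 fun ω hω hgood => hω ?_)).trans (h N hN K hK)⟩
    exact ⟨hgood.1, htotal hM hK hgood.2⟩
  · obtain ⟨M, N₀, hM, h⟩ := hstoch ε hε
    -- With `x` the stochastic and `y` the bias bound, `(3x + y)² ≤ 27 x² + 3/2 · y²` amounts to
    -- `(6x - y)² ≥ 0`.
    refine ⟨27 * M, N₀, fun N hN K hK =>
      (measure_mono (ofPred_subset_ofPred.2 fun ω hω hgood => hω ?_)).trans (h N hN K hK)⟩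
    refine ⟨hgood.1, fun lam' rho' e' f' he' hf' => ?_⟩
    have hMN : 0 ≤ M / N := by positivity
    have hLK : 0 ≤ 4 / 3 * L ^ 2 / (K : ℝ) ^ 2 := by positivity
    have key := hA.abs_eigenvalue_mul_sub_le (isTensorOp_contOpTensor _ _) hA₁.1 hA₂.1 he hf he' hf'
      (hAK K hK) (fun w hw => norm_apply_le_of_hsNormSq_le hgood.2 hMN hw)
      (fun w hw => norm_apply_le_of_hsNormSq_le (hbias K hK) hLK hw) i j
    have h1 := Real.sq_sqrt hMN
    have h2 := Real.sq_sqrt hLK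
    refine (pow_le_pow_left₀ (abs_nonneg _) key 2).trans ?_
    have e1 : 27 * M / N + 2 * L ^ 2 / (K : ℝ) ^ 2 =
        27 * (M / N) + 3 / 2 * (4 / 3 * L ^ 2 / (K : ℝ) ^ 2) := by ring
    rw [e1]
    nlinarith [sq_nonneg (6 * Real.sqrt (M / N) - Real.sqrt (4 / 3 * L ^ 2 / (K : ℝ) ^ 2))]
  · obtain ⟨g, hg, hgj, hgap⟩ := he.exists_gap hA₁.1 hj
    -- If the largest eigenvalue of `A₂` vanished, `A₂` would be zero and so would the shifted
    -- trace.
    have hr : rho 0 ≠ 0 := fun h0 =>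
      hA.right_ne_zero ha hL.le ha_lip hδ h_trace (hf.eq_zero_of_zero h0)
    refine ⟨32 / (rho 0 * g) ^ 2, fun ε hε => ?_⟩
    obtain ⟨M, N₀, hM, h⟩ := hstoch ε hε
    refine ⟨32 / (rho 0 * g) ^ 2 * (3 * M), N₀,
      fun N hN K hK => (measure_mono (ofPred_subset_ofPred.2 fun ω hω hgood => hω ?_)).trans (h N hN K hK)⟩
    refine ⟨hgood.1, fun lam' e' he' => ?_⟩
    have h0 : 0 ≤ 3 * M / N + 2 * L ^ 2 / (K : ℝ) ^ 2 := by positivity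
    refine (hA.norm_eigenvector_sub_le (isTensorOp_contOpTensor _ _) hA₁.1 hA₂.1 he hf he' hr hg hgj
      hgap fun w hw => norm_apply_le_of_hsNormSq_le (htotal hM hK hgood.2) h0 hw).trans_eq ?_
    rw [Real.sq_sqrt h0]
    ring
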